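/- **Multiple context-free grammars.** An MCFG $\mathcal G$ over a finite alphabet $\Sigma$ has finitely many nonterminals $A$, each with an arity $\ge 1$, a start nonterminal $A_{\mathrm{start}}$ of arity $1$, and finitely many productions $$A(s_1,\ldots,s_n)\leftarrow\{B_1(x_{1,1},\ldots,x_{1,n_1}),\ldots,B_m(x_{m,1},\ldots,x_{m,n_m})\},$$ where $n,n_1,\dots,n_m$ are the arities of $A,B_1,\dots,B_m$, the $x_{i,j}$ are pairwise distinct variables, each $s_i$ is a word over $\Sigma$ and these variables, and each variable occurs at most once in $s_1\cdots s_n$. The sets $R(A)\subseteq(\Sigma^*)^n$ are defined inductively: if $(u_{i,1},\ldots,u_{i,n_i})\in R(B_i)$ for all $i\le m$, then the tuple obtained from $(s_1,\ldots,s_n)$ by replacing every $x_{i,j}$ with $u_{i,j}$ lies in $R(A)$. The language is $L(\mathcal G)=R(A_{\mathrm{start}})$. The dimension of $\mathcal G$ is the maximal arity of its nonterminals; its rank is the maximal number $m$ of terms on the right-hand side of a production, but $1$ if this number is $0$ for all productions. A $d$-MCFG($r$) is an MCFG of dimension $\le d$ and rank $\le r$. **Graphs and logic.** A linearly ordered graph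 over $\Sigma$ with a matching relation is a finite set $V$ with the successor relation $\mathrm{Succ}$ of a linear order on $V$, an arbitrary binary relation $\curvearrowright$ on $V$ (called the matching relation), and a labelling $\lambda:V\to\Sigma\cup\{\varepsilon\}$. If $v_1,\ldots,v_n$ are its vertices in increasing order, its word is $\lambda(v_1)\cdots\lambda(v_n)\in\Sigma^*$. MSO formulas are built from $a(x)$ (for $a\in\Sigma$), $x\in X$, $\mathrm{Succ}(x,y)$ and $x\curvearrowright y$ by negation, disjunction and existential quantification over vertices and over sets of vertices. A special tree decomposition of such a graph is a finite rooted tree whose nodes are labelled by bags of vertices such that each vertex lies in at least one bag, the nodes whose bags contain a given vertex form a path along a branch of the rooted tree, and any two vertices related by $\mathrm{Succ}$ or $\curvearrowright$ lie together in some bag. Its width is the maximum size of its bags, and the special treewidth of a graph is the minimum width of its special tree decompositions. **Theorem.** Given an MCFG $\mathcal G$ over $\Sigma$, one can effectively construct an MSO sentence $\varphi$ over linearly ordered graphs over $\Sigma$ with a matching relation such that for all $d,r$ for which $\mathcal G$ is a $d$-MCFG($r$), $$\{\mathrm{word}(H)\mid H\models\varphi,\ H\text{ has special treewidth at most }6dr\}=L(\mathcal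 G).$$ -/

import Mathlib

/-! ### Multiple context-free grammars -/

/-- A production `A(s₁,…,sₙ) ← {B₁(x₁₁,…), …, Bₘ(xₘ₁,…)}` over terminal letters `α`, nonterminal
names `N` and variable names `X`: `head` is `A`, `args` is the list `[s₁,…,sₙ]` of words over
letters (`Sum.inl`) and variables (`Sum.inr`), and `body` lists the terms `Bᵢ(xᵢ₁,…)`. -/
structure Production (α N X : Type) where
  head : N
  args : List (List (α ⊕ X))
  body : List (N × List X)

namespace Production

variable {α N X : Type}

/-- All variable occurrences in `s₁ s₂ ⋯ sₙ`, from left to right. -/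
def headVars (ρ : Production α N X) : List X := ρ.args.flatten.filterMap Sum.getRight?

/-- All variable occurrences in the body. -/
def bodyVars (ρ : Production α N X) : List X := ρ.body.flatMap Prod.snd

/-- The rank of a production is the number of terms in its body. -/
def rank (ρ : Production α N X) : ℕ := ρ.body.length

/-- The homomorphism on words over letters and variables that extends `η` and fixes letters. -/
def subst (η : X → List α) (s : List (α ⊕ X)) : List α :=
  s.flatMap (Sum.elim (fun a => [a]) η)

end Production

/-- A multiple context-free grammar with terminal letters in `α`, and with its finitely many
nonterminals and variables named by elements of `N` and `X`. The ranked set of nonterminals is given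
by the list of pairs `(A, arity A)`. -/
structure MCFG (α N X : Type) where
  nonterminals : List (N × ℕ)
  start : N
  rules : List (Production α N X)
  /-- every nonterminal has exactly one arity -/
  nodup_names : (nonterminals.map Prod.fst).Nodup
  one_le_arity : ∀ p ∈ nonterminals, 1 ≤ p.2
  start_mem : (start, 1) ∈ nonterminals
  /-- the head of a production has as many arguments as its arity says -/
  head_mem : ∀ ρ ∈ rules, (ρ.head, ρ.args.length) ∈ nonterminals
  /-- so has every term of the body -/
  body_mem : ∀ ρ ∈ rules, ∀ t ∈ ρ.body, (t.1, t.2.length) ∈ nonterminals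
  /-- a variable occurs at most once on the right-hand side -/
  nodup_body : ∀ ρ ∈ rules, ρ.bodyVars.Nodup
  /-- a variable occurs at most once on the left-hand side -/
  nodup_head : ∀ ρ ∈ rules, ρ.headVars.Nodup
  /-- variables on the left-hand side also occur on the right-hand side -/
  head_subset_body : ∀ ρ ∈ rules, ρ.headVars ⊆ ρ.bodyVars

namespace MCFG

variable {α N X : Type}

/-- `G.Derives A [u₁,…,uₙ]` says that `A` generates the tuple `(u₁,…,uₙ)`. -/
inductive Derives (G : MCFG α N X) : N → List (List α) → Prop
  | intro (ρ : Production α N X) (hρ : ρ ∈ G.rules) (η : X → List α)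
      (h : ∀ t ∈ ρ.body, Derives G t.1 (t.2.map η)) :
      Derives G ρ.head (ρ.args.map (Production.subst η))

/-- The language generated by the grammar. -/
def language (G : MCFG α N X) : Set (List α) := {w | G.Derives G.start [w]}

/-- The dimension: the maximal arity of the nonterminals. -/
def dimension (G : MCFG α N X) : ℕ := (G.nonterminals.map Prod.snd).foldr max 0

/-- The rank: the maximal rank of the productions, but `1` if all of them have rank `0`. -/
def rank (G : MCFG α N X) : ℕ := (G.rules.map Production.rank).foldr max 1

/-- `G` is a `d`-MCFG(`r`). -/
def IsDMCFG (G : MCFG α N X) (d r : ℕ) : Prop := G.dimension ≤ d ∧ G.rank ≤ r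

/-- The finite data that constitute a grammar: the input of an algorithm on grammars. -/
abbrev Data (α N X : Type) : Type :=
  List (N × ℕ) × N × List (N × List (List (α ⊕ X)) × List (N × List X))

/-- The data of a grammar. -/
def data (G : MCFG α N X) : Data α N X :=
  (G.nonterminals, G.start, G.rules.map fun ρ => (ρ.head, ρ.args, ρ.body))

end MCFG

/-! ### Linearly ordered graphs -/

/-- An lo-graph over `(α, Γ)`: a finite linearly ordered set of vertices, an edge relation for every
name in `Γ`, and vertex labels in `α ∪ {ε}`, where `none` stands for `ε`. The relation `Succ` is the
covering relation `⋖` of the order. -/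
structure LoGraph (α Γ : Type) where
  V : Type
  [fintypeV : Fintype V]
  [linearOrderV : LinearOrder V]
  edge : Γ → V → V → Prop
  label : V → Option α

attribute [instance] LoGraph.fintypeV LoGraph.linearOrderV

namespace LoGraph

variable {α Γ : Type}

/-- The successor relation of the linear order. -/
def Succ (G : LoGraph α Γ) (u v : G.V) : Prop := u ⋖ v

/-- The word spelled by the labels of the vertices in increasing order. -/
def word (G : LoGraph α Γ) : List α :=
  ((Finset.univ : Finset G.V).sort (· ≤ ·)).filterMap G.label

/-- Two vertices are adjacent if they are related by `Succ` or by one of the edge relations. -/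
def Adjacent (G : LoGraph α Γ) (u v : G.V) : Prop := G.Succ u v ∨ ∃ γ, G.edge γ u v

/-- A special tree decomposition. The rooted tree has node set `T` and is given by its parent map:
the root is mapped to itself, and every node reaches the root by iterating the map. The bags that
contain a given vertex are exactly those on a path that starts at some node `t` and climbs towards
the root for some number `n` of steps (in particular there is at least one such bag). -/
structure SpecialTreeDecomposition (G : LoGraph α Γ) where
  T : Type
  [fintypeT : Fintype T]
  root : T
  parent : T → T
  parent_root : parent root = root
  reaches_root : ∀ t, ∃ n : ℕ, parent^[n] t = root
  bag : T → Finset G.V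
  bags_path : ∀ v, ∃ t, ∃ n : ℕ, ∀ s, v ∈ bag s ↔ ∃ i ≤ n, parent^[i] t = s
  adjacent_bag : ∀ u v, G.Adjacent u v → ∃ t, u ∈ bag t ∧ v ∈ bag t

attribute [instance] SpecialTreeDecomposition.fintypeT

/-- The width: the maximum size of the bags. -/
def SpecialTreeDecomposition.width {G : LoGraph α Γ} (D : G.SpecialTreeDecomposition) : ℕ :=
  Finset.univ.sup fun t => (D.bag t).card

/-- The special treewidth: the minimum width over all special tree decompositions. -/
noncomputable def specialTreewidth (G : LoGraph α Γ) : ℕ :=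
  sInf {k | ∃ D : G.SpecialTreeDecomposition, D.width = k}

/-- Special tree decompositions always exist, so that the above minimum is attained. -/
theorem exists_width_eq (G : LoGraph α Γ) :
    ∃ D : G.SpecialTreeDecomposition, D.width = G.specialTreewidth :=
  Nat.sInf_mem (s := {k | ∃ D : G.SpecialTreeDecomposition, D.width = k})
    ⟨_, ⟨Unit, (), id, rfl, fun _ => ⟨0, rfl⟩, fun _ => Finset.univ,
      fun _ => ⟨(), 0, fun _ => ⟨fun _ => ⟨0, le_rfl, rfl⟩, fun _ => Finset.mem_univ _⟩⟩,
      fun u v _ => ⟨(), Finset.mem_univ u, Finset.mem_univ v⟩⟩, rfl⟩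

end LoGraph

/-! ### Monadic second-order logic -/

/-- Formulas of `MSO(α, Γ)`. First-order and second-order variables are named by natural numbers,
independently of each other. -/
inductive MSO (α Γ : Type) : Type
  | label (a : α) (x : ℕ)
  | mem (x S : ℕ)
  | succ (x y : ℕ)
  | edge (γ : Γ) (x y : ℕ)
  | neg (φ : MSO α Γ)
  | or (φ ψ : MSO α Γ)
  | ex (x : ℕ) (φ : MSO α Γ)
  | exSet (S : ℕ) (φ : MSO α Γ)

namespace MSO

variable {α Γ : Type}

/-- Free first-order variables. -/
def freeVars : MSO α Γ → Set ℕ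
  | label _ x => {x}
  | mem x _ => {x}
  | succ x y => {x, y}
  | edge _ x y => {x, y}
  | neg φ => φ.freeVars
  | or φ ψ => φ.freeVars ∪ ψ.freeVars
  | ex x φ => φ.freeVars \ {x}
  | exSet _ φ => φ.freeVars

/-- Free second-order variables. -/
def freeSetVars : MSO α Γ → Set ℕ
  | label _ _ => ∅
  | mem _ S => {S}
  | succ _ _ => ∅
  | edge _ _ _ => ∅
  | neg φ => φ.freeSetVars
  | or φ ψ => φ.freeSetVars ∪ ψ.freeSetVars
  | ex _ φ => φ.freeSetVars
  | exSet S φ => φ.freeSetVars \ {S}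

/-- A sentence is a formula without free variables. -/
def IsSentence (φ : MSO α Γ) : Prop := φ.freeVars = ∅ ∧ φ.freeSetVars = ∅

/-- Satisfaction in `G`. First-order assignments are partial, so that graphs without vertices are
covered; as long as the free variables are assigned, this is the usual semantics. -/
def Sat (G : LoGraph α Γ) : MSO α Γ → (ℕ → Option G.V) → (ℕ → Set G.V) → Prop
  | label a x, v, _ => ∃ u, v x = some u ∧ G.label u = some a
  | mem x S, v, σ => ∃ u, v x = some u ∧ u ∈ σ S
  | succ x y, v, _ => ∃ u w, v x = some u ∧ v y = some w ∧ G.Succ u w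
  | edge γ x y, v, _ => ∃ u w, v x = some u ∧ v y = some w ∧ G.edge γ u w
  | neg φ, v, σ => ¬ Sat G φ v σ
  | or φ ψ, v, σ => Sat G φ v σ ∨ Sat G ψ v σ
  | ex x φ, v, σ => ∃ u : G.V, Sat G φ (Function.update v x (some u)) σ
  | exSet S φ, v, σ => ∃ A : Set G.V, Sat G φ v (Function.update σ S A)

/-- `G` is a model of the sentence `φ`. -/
def Models (G : LoGraph α Γ) (φ : MSO α Γ) : Prop := Sat G φ (fun _ => none) (fun _ => ∅)

/-- The `k`-bounded graph language of `φ`: the models of `φ` of special treewidth at most `k`. -/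
def boundedGraphLanguage (k : ℕ) (φ : MSO α Γ) : Set (LoGraph α Γ) :=
  {G | Models G φ ∧ G.specialTreewidth ≤ k}

/-- The `k`-bounded word language of `φ`. -/
def boundedWordLanguage (k : ℕ) (φ : MSO α Γ) : Set (List α) :=
  LoGraph.word '' boundedGraphLanguage k φ

/-- A formula written down in prefix notation, with numbers as symbols. -/
def code [Encodable α] [Encodable Γ] : MSO α Γ → List ℕ
  | label a x => [0, Encodable.encode a, x]
  | mem x S => [1, x, S]
  | succ x y => [2, x, y]
  | edge γ x y => [3, Encodable.encode γ, x, y]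
  | neg φ => 4 :: φ.code
  | or φ ψ => 5 :: (φ.code ++ ψ.code)
  | ex x φ => 6 :: x :: φ.code
  | exSet S φ => 7 :: S :: φ.code

/-- The prefix notation determines the formula. -/
theorem code_append_inj [Encodable α] [Encodable Γ] (φ : MSO α Γ) :
    ∀ (ψ : MSO α Γ) (l m : List ℕ), φ.code ++ l = ψ.code ++ m → φ = ψ ∧ l = m := by
  induction φ with
  | or φ₁ φ₂ h₁ h₂ =>
    intro ψ l m h
    cases ψ with
    | or ψ₁ ψ₂ =>
      simp only [code, List.cons_append, List.append_assoc, List.cons.injEq, true_and] at h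
      obtain ⟨rfl, h'⟩ := h₁ _ _ _ h
      obtain ⟨rfl, h''⟩ := h₂ _ _ _ h'
      exact ⟨rfl, h''⟩
    | _ => simp [code] at h
  | neg φ ih =>
    intro ψ l m h
    cases ψ with
    | neg ψ =>
      simp only [code, List.cons_append, List.cons.injEq, true_and] at h
      obtain ⟨rfl, h'⟩ := ih _ _ _ h
      exact ⟨rfl, h'⟩
    | _ => simp [code] at h
  | ex x φ ih =>
    intro ψ l m h
    cases ψ with
    | ex y ψ =>
      simp only [code, List.cons_append, List.cons.injEq, true_and] at h
      obtain ⟨rfl, h'⟩ := ih _ _ _ h.2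
      exact ⟨by rw [h.1], h'⟩
    | _ => simp [code] at h
  | exSet x φ ih =>
    intro ψ l m h
    cases ψ with
    | exSet y ψ =>
      simp only [code, List.cons_append, List.cons.injEq, true_and] at h
      obtain ⟨rfl, h'⟩ := ih _ _ _ h.2
      exact ⟨by rw [h.1], h'⟩
    | _ => simp [code] at h
  | _ =>
    intro ψ l m h
    cases ψ <;> simp_all [code]

theorem code_injective [Encodable α] [Encodable Γ] :
    Function.Injective (code : MSO α Γ → List ℕ) := fun φ ψ h =>
  (code_append_inj φ ψ [] [] (by simpa using h)).1

end MSO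

/-- A map from grammars to formulas is effective if some algorithm computes the written form of the
formula from the data of the grammar. -/
def MCFG.IsEffective {α N X Γ : Type} [Primcodable α] [Primcodable N] [Primcodable X]
    [Encodable Γ] (F : MCFG α N X → MSO α Γ) : Prop :=
  ∃ c : MCFG.Data α N X → List ℕ, Computable c ∧ ∀ G, c G.data = (F G).code

set_option linter.unusedSectionVars false

/-! A derivation is drawn as a linearly ordered graph. A tuple `(u₁,…,uₙ)` generated by `A` becomes
`n` disjoint spans of consecutive vertices; the `i`-th runs from an opening end `oᵢ` to a closing
end `cᵢ`, both unlabelled, and the labels in between spell `uᵢ`. The matching relation, required to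
be a partial function, ties the spans together: it runs from a vertex coloured `A` through `o₁, c₁,
o₂, c₂, …, oₙ, cₙ`. Inside the span of an argument of the production stand its letters and the spans
of its variables, in this order. These conditions are local, so after quantification over one colour
per nonterminal, MSO can say that at every vertex coloured `A` a production with head `A` is
applied, and that some vertex of the start colour has a span consisting of all vertices.

A variable that the head deletes still needs a span, since its term must be derivable. Such
variables are put in front of the first argument, and one more set of vertices marks spans as
silent: deleted variables have silent spans, and a silent span omits the letters of its argument and
contains only silent spans, so it spells nothing.

Soundness holds for all models, whatever their treewidth. By functionality of the edges, the spans
found by following a production are those of the given tuple. The spans of the body lie strictly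
inside them, so induction on the number of enclosed vertices yields a derivation
(`Relations.derives_of_chain`), and `Relations.Path.betweenWord_eq` computes the words.

Completeness is an induction on derivations, for every choice of silent components, because silence
is dictated from above (`Piece.nonempty_of_rule`). Let `B` consist of the ends of the spans of the
head and of the body, at most `2d + 2dr` vertices. The decompositions of the subtrees are joined
under the bag `B`. Over it lies a path of bags, each `B` together with at most two consecutive
vertices of the sequence in which the insides of the body spans are skipped
(`Decomp.exists_isChain`). The ends of the spans of a subtree lie in its root bag, so the
occurrences of a vertex continue up a single branch. The width is at most `2d + 2dr + 2 ≤ 6dr`; as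
the bound enters only here, the sentence does not depend on `d` and `r`.

For effectivity, the formulas are folds of blocks whose last argument is the remaining formula. In
prefix notation a block is then a word put in front, folds become concatenations, and the code of
the sentence is primitive recursive in the grammar (`MSO.primrec_grammarCode`). -/

/-! ### Tokens -/

/-- The tokens of an argument of a production: letters, variables, and dropped variables. -/
abbrev Token (α X : Type) : Type := (α ⊕ X) ⊕ X

namespace Token

variable {α X : Type}

/-- The variable of a token, if any. -/
def var : Token α X → Option X
  | .inl (.inl _) => none
  | .inl (.inr x) => some x
  | .inr x => some x

/-- The word that a token stands for, in an argument that is silent (`b = true`) or not. -/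
def word (b : Bool) (η : X → List α) : Token α X → List α
  | .inl (.inl a) => if b then [] else [a]
  | .inl (.inr x) => if b then [] else η x
  | .inr _ => []

end Token

namespace Production

variable {α N X : Type}

theorem filterMap_var_map_inl (s : List (α ⊕ X)) :
    (s.map Sum.inl).filterMap Token.var = s.filterMap Sum.getRight? := by
  rw [List.filterMap_map]
  congr 1
  funext t
  rcases t with a | x <;> rfl

theorem filterMap_var_map_inr (l : List X) :
    (l.map (Sum.inr : X → Token α X)).filterMap Token.var = l := by
  rw [List.filterMap_map]
  exact List.filterMap_some

theorem flatMap_word_map_inl_false (η : X → List α) (s : List (α ⊕ X)) :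
    (s.map Sum.inl).flatMap (Token.word false η) = subst η s := by
  rw [List.flatMap_map]
  unfold subst
  congr 1
  funext t
  rcases t with a | x <;> rfl

theorem flatMap_word_true (η : X → List α) (s : List (Token α X)) :
    s.flatMap (Token.word true η) = [] := by
  rw [List.flatMap_eq_nil_iff]
  rintro ((a | x) | x) _ <;> rfl

variable [DecidableEq X]

/-- The variables of the body that do not occur in the head. -/
def dropped (args : List (List (α ⊕ X))) (body : List (N × List X)) : List X :=
  (body.flatMap Prod.snd).filter (· ∉ args.flatten.filterMap Sum.getRight?)

/-- The arguments as lists of tokens, with the dropped variables in front of the first one. -/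
def tokens (args : List (List (α ⊕ X))) (body : List (N × List X)) : List (List (Token α X)) :=
  (args.map (List.map Sum.inl)).modifyHead (((dropped args body).map Sum.inr) ++ ·)

theorem length_tokens (args : List (List (α ⊕ X))) (body : List (N × List X)) :
    (tokens args body).length = args.length := by
  simp [tokens]

/-- With the deleted variables put back, no variable of the body is missing from the tokens. They
are put into the first argument, so there has to be one. -/
theorem filterMap_var_tokens (args : List (List (α ⊕ X))) (body : List (N × List X))
    (h : args ≠ []) :
    (tokens args body).flatten.filterMap Token.var =
      dropped args body ++ args.flatten.filterMap Sum.getRight? := by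
  obtain ⟨s, ss, rfl⟩ := List.exists_cons_of_ne_nil h
  simp only [tokens, List.map_cons, List.modifyHead_cons, List.flatten_cons, List.filterMap_append,
    filterMap_var_map_inl, filterMap_var_map_inr, ← List.map_flatten, List.append_assoc]

theorem filterMap_var_subset (args : List (List (α ⊕ X))) (body : List (N × List X))
    (h : args.flatten.filterMap Sum.getRight? ⊆ body.flatMap Prod.snd) :
    ∀ s ∈ tokens args body, s.filterMap Token.var ⊆ body.flatMap Prod.snd := by
  intro s hs x hx
  have hx' : x ∈ (tokens args body).flatten.filterMap Token.var := by
    obtain ⟨t, ht, e⟩ := List.mem_filterMap.1 hx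
    exact List.mem_filterMap.2 ⟨t, List.mem_flatten.2 ⟨s, hs, ht⟩, e⟩
  have hne : args ≠ [] := by
    rintro rfl
    simp [tokens] at hs
  rw [filterMap_var_tokens args body hne, List.mem_append] at hx'
  exact hx'.elim (fun h => (List.mem_filter.1 h).1) fun h' => h h'

/-- The restored variables stand for the empty word, so they do not change what the arguments spell.
-/
theorem map_word_tokens (η : X → List α) (args : List (List (α ⊕ X)))
    (body : List (N × List X)) :
    (tokens args body).map (fun s => s.flatMap (Token.word false η)) = args.map (subst η) := by
  cases args with
  | nil => rfl
  | cons s ss =>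
    simp only [tokens, List.map_cons, List.modifyHead_cons, List.flatMap_append, List.map_map,
      flatMap_word_map_inl_false, List.cons.injEq, List.append_left_eq_self]
    refine ⟨?_, ?_⟩
    · rw [List.flatMap_map, List.flatMap_eq_nil_iff]
      intro x _
      rfl
    · apply List.map_congr_left
      intro t _
      exact flatMap_word_map_inl_false η t

end Production

theorem MCFG.filterMap_var_subset {α N X : Type} [DecidableEq X] (G : MCFG α N X)
    {ρ : Production α N X} (hρ : ρ ∈ G.rules) :
    ∀ s ∈ Production.tokens ρ.args ρ.body,
      s.filterMap Token.var ⊆ ρ.body.flatMap Prod.snd :=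
  Production.filterMap_var_subset ρ.args ρ.body (G.head_subset_body ρ hρ)

/-! ### Patterns in relational structures -/

/-- The relations on the vertices of a graph that the formula talks about. -/
structure Relations (α N V : Type) where
  succ : V → V → Prop
  lt : V → V → Prop
  edge : V → V → Prop
  lab : V → α → Prop
  col : N → V → Prop
  sil : V → Prop

namespace Relations

variable {α N X V : Type} (S : Relations α N V)

/-- The vertices from `p` to `q` follow the tokens `s`. -/
def Path (op cl : X → V) (b : Bool) (q : V) : List (Token α X) → V → Prop
  | [], p => S.succ p q
  | .inl (.inl a) :: s, p =>
    if b then Path op cl b q s p else ∃ r, S.succ p r ∧ S.lab r a ∧ Path op cl b q s r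
  | .inl (.inr x) :: s, p => S.succ p (op x) ∧ (S.sil (op x) ↔ b = true) ∧ Path op cl b q s (cl x)
  | .inr x :: s, p => S.succ p (op x) ∧ S.sil (op x) ∧ Path op cl b q s (cl x)

/-- The edges run from `h` through the spans of the list. -/
def Chain : List (V × V) → V → Prop
  | [], _ => True
  | p :: ps, h => S.edge h p.1 ∧ S.edge p.1 p.2 ∧ S.lt p.1 p.2 ∧ Chain ps p.2

/-- The edges run from `h` through spans that follow the arguments of the list. -/
def Args (op cl : X → V) : List (List (Token α X)) → V → Prop
  | [], _ => True
  | s :: ss, h => ∃ o c, S.edge h o ∧ S.edge o c ∧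
      (∃ b : Bool, (S.sil o ↔ b = true) ∧ S.Path op cl b c s o) ∧ Args op cl ss c

/-- The production with these arguments and this body is applied at the vertex `h`. -/
def Applies [DecidableEq X] (args : List (List (α ⊕ X))) (body : List (N × List X)) (h : V) :
    Prop :=
  ∃ op cl : X → V,
    (∀ t ∈ body, ∃ h', S.col t.1 h' ∧ S.Chain (t.2.map fun x => (op x, cl x)) h') ∧
    S.Args op cl (Production.tokens args body) h

theorem Chain.edge_lt {S : Relations α N V} : ∀ {P : List (V × V)} {h : V}, S.Chain P h →
    ∀ p ∈ P, S.edge p.1 p.2 ∧ S.lt p.1 p.2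
  | [], _, _ => by simp
  | p :: P, h, hP => by
    intro r hr
    rcases List.mem_cons.1 hr with rfl | hr
    · exact ⟨hP.2.1, hP.2.2.1⟩
    · exact Chain.edge_lt hP.2.2.2 r hr

end Relations

/-! ### Words of intervals -/

section Interval

variable {α V : Type} [Fintype V] [LinearOrder V] (lab : V → Option α)

/-- The word spelled by the labels strictly between two vertices. -/
def betweenWord (p q : V) : List α :=
  (((Finset.univ : Finset V).sort (· ≤ ·)).filter fun v => p < v ∧ v < q).filterMap lab

variable {lab}

theorem exists_sort_eq (r : V) : ∃ l₁ l₂, (Finset.univ : Finset V).sort (· ≤ ·) = l₁ ++ r :: l₂ ∧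
    (∀ v ∈ l₁, v < r) ∧ ∀ v ∈ l₂, r < v := by
  have hr : r ∈ (Finset.univ : Finset V).sort (· ≤ ·) := by simp
  obtain ⟨l₁, l₂, h⟩ := List.append_of_mem hr
  have hs := Finset.sortedLT_sort (Finset.univ : Finset V)
  rw [h] at hs
  have hp := hs.pairwise
  rw [List.pairwise_append] at hp
  refine ⟨l₁, l₂, h, fun v hv => hp.2.2 v hv r (by simp), fun v hv => ?_⟩
  exact (List.pairwise_cons.1 hp.2.1).1 v hv

/-- The sorted list of all vertices is cut at `r`; on either side of the cut one of the inequalities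
is automatic or impossible. -/
theorem betweenWord_split {p r q : V} (h₁ : p < r) (h₂ : r < q) :
    betweenWord lab p q = betweenWord lab p r ++ (lab r).toList ++ betweenWord lab r q := by
  obtain ⟨l₁, l₂, h, hl₁, hl₂⟩ := exists_sort_eq r
  have e₁ : ∀ v ∈ l₁, decide (p < v ∧ v < q) = decide (p < v ∧ v < r) := fun v hv => by
    have := hl₁ v hv
    simp [this, this.trans h₂]
  have e₂ : ∀ v ∈ l₂, decide (p < v ∧ v < q) = decide (r < v ∧ v < q) := fun v hv => by
    have := hl₂ v hv
    simp [this, h₁.trans this]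
  have e₃ : l₂.filter (fun v => decide (p < v ∧ v < r)) = [] := by
    rw [List.filter_eq_nil_iff]
    intro v hv
    simp [(hl₂ v hv).le]
  have e₄ : l₁.filter (fun v => decide (r < v ∧ v < q)) = [] := by
    rw [List.filter_eq_nil_iff]
    intro v hv
    simp [(hl₁ v hv).le]
  unfold betweenWord
  rw [h]
  simp only [List.filter_append, List.filter_cons, e₃, e₄, List.filter_congr e₁,
    List.filter_congr e₂]
  cases hr : lab r <;> simp [h₁, h₂, hr]

theorem betweenWord_eq_nil {p q : V} (h : p ⋖ q) : betweenWord lab p q = [] := by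
  unfold betweenWord
  rw [List.filter_eq_nil_iff.2, List.filterMap_nil]
  intro v _
  simpa using fun h' => not_lt.1 (h.2 h')

theorem filterMap_sort_eq {p q : V} (hpq : p < q) (hp : ∀ v, p ≤ v) (hq : ∀ v, v ≤ q)
    (lp : lab p = none) (lq : lab q = none) :
    ((Finset.univ : Finset V).sort (· ≤ ·)).filterMap lab = betweenWord lab p q := by
  obtain ⟨l₁, l₂, h, hl₁, hl₂⟩ := exists_sort_eq p
  obtain rfl : l₁ = [] := List.eq_nil_iff_forall_not_mem.2 fun v hv => (hl₁ v hv).not_ge (hp v)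
  obtain ⟨m₁, m₂, h', hm₁, hm₂⟩ := exists_sort_eq q
  obtain rfl : m₂ = [] := List.eq_nil_iff_forall_not_mem.2 fun v hv => (hm₂ v hv).not_ge (hq v)
  unfold betweenWord
  rcases m₁ with _ | ⟨m, m₁⟩
  · rw [h'] at h
    simp at h
    exact absurd h.1.symm hpq.ne
  rw [h'] at h
  simp only [List.nil_append, List.cons_append, List.cons.injEq] at h
  obtain ⟨rfl, rfl⟩ := h
  rw [h']
  have : m₁.filter (fun v => decide (m < v ∧ v < q)) = m₁ := by
    rw [List.filter_eq_self]
    intro v hv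
    simp [hl₂ v (by simp [hv]), hm₁ v (by simp [hv])]
  simp only [Bool.decide_and] at this
  simp [this, lp, lq]

end Interval

/-! ### Soundness -/

/-- The lists attached to different indices share no entry, so tuples chosen for each term
separately fit together to one substitution. -/
theorem exists_map_eq {ι X Y : Type} [Nonempty Y] (f : ι → List X) (g : ι → List Y) :
    ∀ l : List ι, (l.flatMap f).Nodup → (∀ i ∈ l, (f i).length = (g i).length) →
      ∃ η : X → Y, ∀ i ∈ l, (f i).map η = g i
  | [], _, _ => ⟨fun _ => Classical.arbitrary Y, by simp⟩
  | i :: l, hn, hl => by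
    classical
    rw [List.flatMap_cons, List.nodup_append] at hn
    obtain ⟨η, hη⟩ := exists_map_eq f g l hn.2.1 fun j hj => hl j (List.mem_cons_of_mem _ hj)
    have hi := hl i List.mem_cons_self
    refine ⟨fun x => if x ∈ f i then (g i).getD ((f i).idxOf x) (Classical.arbitrary Y) else η x,
      fun j hj => ?_⟩
    rcases List.mem_cons.1 hj with rfl | hj'
    · apply List.ext_getElem (by simpa using hi)
      intro n h₁ h₂
      simp only [List.length_map] at h₁
      simp [hn.1.idxOf_getElem, h₂]
    · rw [← hη j hj']
      apply List.map_congr_left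
      intro x hx
      have : x ∉ f i := fun hx' =>
        hn.2.2 x hx' x (List.mem_flatMap.2 ⟨j, hj', hx⟩) rfl
      simp [this]

namespace Relations

variable {α N X V : Type} [LinearOrder V] {S : Relations α N V} {lab : V → Option α}

/-- The relations are those of a graph with this order and these labels, its edges are the graph of
a partial function, and the ends of edges are unlabelled. -/
structure Compatible (S : Relations α N V) (lab : V → Option α) : Prop where
  covBy : ∀ u v, S.succ u v → u ⋖ v
  lt : ∀ u v, S.lt u v → u < v
  lab_eq : ∀ v a, S.lab v a → lab v = some a
  edge_unique : ∀ u v w, S.edge u v → S.edge u w → v = w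
  edge_left : ∀ u v, S.edge u v → lab u = none
  edge_right : ∀ u v, S.edge u v → lab v = none

/-- A path only climbs: by successor steps, and across spans from the opening to the closing end.
Every span on it therefore lies strictly inside, which makes the induction of `derives_of_chain`
terminate. -/
theorem Path.lt (hS : S.Compatible lab) {op cl : X → V} {b : Bool} {q : V} :
    ∀ {s : List (Token α X)} {p : V}, S.Path op cl b q s p →
      (∀ x ∈ s.filterMap Token.var, op x < cl x) →
      p < q ∧ ∀ x ∈ s.filterMap Token.var, p < op x ∧ cl x < q
  | [], p, h, _ => ⟨(hS.covBy _ _ h).lt, by simp⟩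
  | .inl (.inl a) :: s, p, h, hx => by
    have e : (Sum.inl (.inl a) :: s).filterMap Token.var = s.filterMap Token.var := rfl
    rw [e] at hx ⊢
    cases b with
    | true => exact Path.lt hS (by simpa [Path] using h) hx
    | false =>
      obtain ⟨r, h₁, -, h₂⟩ : ∃ r, S.succ p r ∧ S.lab r a ∧ S.Path op cl false q s r := by
        simpa [Path] using h
      have := (hS.covBy _ _ h₁).lt
      obtain ⟨h₃, h₄⟩ := Path.lt hS h₂ hx
      exact ⟨this.trans h₃, fun x hx => ⟨this.trans (h₄ x hx).1, (h₄ x hx).2⟩⟩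
  | .inl (.inr y) :: s, p, h, hx => by
    have e : (Sum.inl (.inr y) :: s).filterMap Token.var = y :: s.filterMap Token.var := rfl
    rw [e] at hx ⊢
    have := (hS.covBy _ _ h.1).lt
    have hy := hx y (by simp)
    obtain ⟨h₃, h₄⟩ := Path.lt hS h.2.2 fun x h' => hx x (by simp [h'])
    refine ⟨this.trans (hy.trans h₃), fun x hx => ?_⟩
    rcases List.mem_cons.1 hx with rfl | hx
    · exact ⟨this, h₃⟩
    · exact ⟨this.trans (hy.trans (h₄ x hx).1), (h₄ x hx).2⟩
  | .inr y :: s, p, h, hx => by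
    have e : (Sum.inr y :: s).filterMap Token.var = y :: s.filterMap Token.var := rfl
    rw [e] at hx ⊢
    have := (hS.covBy _ _ h.1).lt
    have hy := hx y (by simp)
    obtain ⟨h₃, h₄⟩ := Path.lt hS h.2.2 fun x h' => hx x (by simp [h'])
    refine ⟨this.trans (hy.trans h₃), fun x hx => ?_⟩
    rcases List.mem_cons.1 hx with rfl | hx
    · exact ⟨this, h₃⟩
    · exact ⟨this.trans (hy.trans (h₄ x hx).1), (h₄ x hx).2⟩

/-- The edges form a partial function, so the spans whose existence `Args` asserts are forced to be
those of the chain starting at the same vertex. -/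
theorem Args.forall₂ (hS : S.Compatible lab) {op cl : X → V} :
    ∀ {ss : List (List (Token α X))} {P : List (V × V)} {h : V}, S.Args op cl ss h → S.Chain P h →
      ss.length = P.length →
      List.Forall₂ (fun s p => ∃ b : Bool, (S.sil p.1 ↔ b = true) ∧ S.Path op cl b p.2 s p.1) ss P
  | [], [], _, _, _, _ => .nil
  | s :: ss, (o', c') :: P, h, ⟨o, c, ho, hc, hs, hss⟩, hP, hl => by
    obtain rfl := hS.edge_unique _ _ _ ho hP.1
    obtain rfl := hS.edge_unique _ _ _ hc hP.2.1
    exact .cons hs (Args.forall₂ hS hss hP.2.2.2 (by simpa using hl))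
  | [], _ :: _, _, _, _, hl => by simp at hl
  | _ :: _, [], _, _, _, hl => by simp at hl

variable [Fintype V]

theorem betweenWord_var (hS : S.Compatible lab) {p q o c : V} (h : p ⋖ o) (hoc : o < c)
    (hcq : c < q) (hx : S.edge o c) :
    betweenWord lab p q = betweenWord lab o c ++ betweenWord lab c q := by
  rw [betweenWord_split h.lt (hoc.trans hcq), betweenWord_split hoc hcq, betweenWord_eq_nil h,
    hS.edge_left _ _ hx, hS.edge_right _ _ hx]
  simp

/-- The interval is cut at every letter and at both ends of every span. Whether a span contributes
`η x` or nothing depends on its silence, which equals `b` for an ordinary variable and always holds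
for a dropped one. -/
theorem Path.betweenWord_eq (hS : S.Compatible lab) {op cl : X → V} {b : Bool} {q : V}
    {η : X → List α} :
    ∀ {s : List (Token α X)} {p : V}, S.Path op cl b q s p →
      (∀ x ∈ s.filterMap Token.var, op x < cl x ∧ S.edge (op x) (cl x) ∧
        (S.sil (op x) → betweenWord lab (op x) (cl x) = []) ∧
        (¬ S.sil (op x) → betweenWord lab (op x) (cl x) = η x)) →
      betweenWord lab p q = s.flatMap (Token.word b η)
  | [], p, h, _ => betweenWord_eq_nil (hS.covBy _ _ h)
  | .inl (.inl a) :: s, p, h, hx => by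
    have e : (Sum.inl (.inl a) :: s).filterMap Token.var = s.filterMap Token.var := rfl
    rw [e] at hx
    rw [List.flatMap_cons]
    cases b with
    | true => exact Path.betweenWord_eq hS (by simpa [Path] using h) hx
    | false =>
      obtain ⟨r, h₁, hr, h₂⟩ : ∃ r, S.succ p r ∧ S.lab r a ∧ S.Path op cl false q s r := by
        simpa [Path] using h
      rw [betweenWord_split (hS.covBy _ _ h₁).lt (Path.lt hS h₂ fun x h => (hx x h).1).1,
        betweenWord_eq_nil (hS.covBy _ _ h₁), hS.lab_eq _ _ hr, Path.betweenWord_eq hS h₂ hx]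
      rfl
  | .inl (.inr y) :: s, p, h, hx => by
    have e : (Sum.inl (.inr y) :: s).filterMap Token.var = y :: s.filterMap Token.var := rfl
    rw [e] at hx
    have hy := hx y (by simp)
    have hs : ∀ x ∈ s.filterMap Token.var, _ := fun x h' => hx x (by simp [h'])
    have hq := (Path.lt hS h.2.2 fun x h => (hs x h).1).1
    rw [List.flatMap_cons, betweenWord_var hS (hS.covBy _ _ h.1) hy.1 hq hy.2.1,
      Path.betweenWord_eq hS h.2.2 hs]
    congr 1
    cases b with
    | true => simpa [Token.word] using hy.2.2.1 (h.2.1.2 rfl)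
    | false => simpa [Token.word] using hy.2.2.2 fun h' => by simpa using h.2.1.1 h'
  | .inr y :: s, p, h, hx => by
    have e : (Sum.inr y :: s).filterMap Token.var = y :: s.filterMap Token.var := rfl
    rw [e] at hx
    have hy := hx y (by simp)
    have hs : ∀ x ∈ s.filterMap Token.var, _ := fun x h' => hx x (by simp [h'])
    have hq := (Path.lt hS h.2.2 fun x h => (hs x h).1).1
    rw [List.flatMap_cons, betweenWord_var hS (hS.covBy _ _ h.1) hy.1 hq hy.2.1,
      Path.betweenWord_eq hS h.2.2 hs]
    congr 1
    exact hy.2.2.1 h.2.1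

variable [DecidableEq X]

/-- Induction on a strict bound for the number of vertices inside each span. A silent span spells
nothing and leaves its component of the derived tuple unconstrained; all that is needed there is
that some tuple is derivable. -/
theorem derives_of_chain (hS : S.Compatible lab) (G : MCFG α N X)
    (hG : ∀ A h, S.col A h → (∃ n, (A, n) ∈ G.nonterminals) →
      ∃ ρ ∈ G.rules, ρ.head = A ∧ S.Applies ρ.args ρ.body h) (n : ℕ) :
    ∀ (A : N) (P : List (V × V)) (h : V), (A, P.length) ∈ G.nonterminals → S.col A h →
      S.Chain P h →
      (∀ p ∈ P, ((Finset.univ : Finset V).filter fun v => p.1 < v ∧ v < p.2).card < n) →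
      ∃ u, G.Derives A u ∧ List.Forall₂ (fun p w =>
        (S.sil p.1 → betweenWord lab p.1 p.2 = []) ∧
        (¬ S.sil p.1 → betweenWord lab p.1 p.2 = w)) P u := by
  induction n with
  | zero =>
    intro A P h hA _ _ hn
    -- As the arity is positive, there is a span, and it would have to enclose fewer than zero
    -- vertices.
    have := G.one_le_arity _ hA
    cases P with
    | nil => simp at this
    | cons p P => simpa using hn p (by simp)
  | succ n ih =>
    intro A P h hA hh hP hn
    obtain ⟨ρ, hρ, rfl, op, cl, hbody, hargs⟩ := hG A h hh ⟨_, hA⟩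
    have hlen : ρ.args.length = P.length := by
      have := List.inj_on_of_nodup_map G.nodup_names (G.head_mem ρ hρ) hA rfl
      exact congrArg Prod.snd this
    have hne : ρ.args ≠ [] := by
      have := G.one_le_arity _ (G.head_mem ρ hρ)
      intro h
      simp [h] at this
    have hvars := Production.filterMap_var_tokens ρ.args ρ.body hne
    have hF := Args.forall₂ hS hargs hP (by rw [Production.length_tokens, hlen])
    have : Nonempty V := ⟨h⟩
    choose! h' hcol hchain using hbody
    have hx : ∀ x ∈ ρ.bodyVars, op x < cl x ∧ S.edge (op x) (cl x) := by
      intro x hx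
      obtain ⟨t, ht, hxt⟩ := List.mem_flatMap.1 hx
      have := (hchain t ht).edge_lt (op x, cl x) (List.mem_map_of_mem hxt)
      exact ⟨hS.lt _ _ this.2, this.1⟩
    have hsub := G.filterMap_var_subset hρ
    -- This is what the dropped variables are restored for: even the span of a deleted variable lies
    -- inside a span of the head, so the induction hypothesis applies to every term of the body.
    have hcov : ∀ x ∈ ρ.bodyVars, ∃ s ∈ Production.tokens ρ.args ρ.body,
        x ∈ s.filterMap Token.var := by
      intro x hx
      have : x ∈ (Production.tokens ρ.args ρ.body).flatten.filterMap Token.var := by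
        rw [hvars, List.mem_append]
        by_cases h : x ∈ ρ.args.flatten.filterMap Sum.getRight?
        · exact Or.inr h
        · exact Or.inl (List.mem_filter.2 ⟨hx, by simpa using h⟩)
      obtain ⟨t, ht, e⟩ := List.mem_filterMap.1 this
      obtain ⟨s, hs, ht⟩ := List.mem_flatten.1 ht
      exact ⟨s, hs, List.mem_filterMap.2 ⟨t, ht, e⟩⟩
    have hsmall : ∀ x ∈ ρ.bodyVars,
        ((Finset.univ : Finset V).filter fun v => op x < v ∧ v < cl x).card < n := by
      intro x hxb
      obtain ⟨s, hs, hxs⟩ := hcov x hxb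
      obtain ⟨i, hi, rfl⟩ := List.getElem_of_mem hs
      have hi' : i < P.length := hF.length_eq ▸ hi
      obtain ⟨b, -, hpath⟩ := hF.get hi hi'
      have h₁ := (Path.lt hS hpath fun x h => (hx x (hsub _ hs h)).1).2 x hxs
      refine lt_of_lt_of_le (Finset.card_lt_card ?_)
        (Nat.lt_succ_iff.1 (hn _ (List.getElem_mem hi')))
      rw [Finset.ssubset_iff_of_subset]
      -- The opening end of the smaller span lies inside the larger span but not strictly inside its
      -- own.
      · refine ⟨op x, ?_, by simp⟩
        simpa using ⟨h₁.1, (hx x hxb).1.trans h₁.2⟩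
      · intro v
        simp only [Finset.mem_filter, Finset.mem_univ, true_and]
        exact fun hv => ⟨h₁.1.trans hv.1, hv.2.trans h₁.2⟩
    have hih : ∀ t ∈ ρ.body, ∃ u, G.Derives t.1 u ∧ List.Forall₂ (fun p w =>
        (S.sil p.1 → betweenWord lab p.1 p.2 = []) ∧
        (¬ S.sil p.1 → betweenWord lab p.1 p.2 = w)) (t.2.map fun x => (op x, cl x)) u := by
      intro t ht
      refine ih t.1 _ (h' t) (by simpa using G.body_mem ρ hρ t ht) (hcol t ht) (hchain t ht) ?_
      intro p hp
      obtain ⟨x, hx, rfl⟩ := List.mem_map.1 hp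
      exact hsmall x (List.mem_flatMap.2 ⟨t, ht, hx⟩)
    choose! u hu hw using hih
    obtain ⟨η, hη⟩ := exists_map_eq Prod.snd u ρ.body (G.nodup_body ρ hρ) fun t ht => by
      simpa using (hw t ht).length_eq
    refine ⟨_, MCFG.Derives.intro ρ hρ η fun t ht => by rw [hη t ht]; exact hu t ht, ?_⟩
    have hwx : ∀ x ∈ ρ.bodyVars, (S.sil (op x) → betweenWord lab (op x) (cl x) = []) ∧
        (¬ S.sil (op x) → betweenWord lab (op x) (cl x) = η x) := by
      intro x hx
      obtain ⟨t, ht, hxt⟩ := List.mem_flatMap.1 hx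
      have := hw t ht
      rw [← hη t ht, List.forall₂_map_left_iff, List.forall₂_map_right_iff,
        List.forall₂_same] at this
      exact this x hxt
    rw [← Production.map_word_tokens η ρ.args ρ.body, List.forall₂_map_right_iff]
    refine List.Forall₂.flip ?_
    rw [List.forall₂_iff_get] at hF ⊢
    refine ⟨hF.1, fun i h₁ h₂ => ?_⟩
    obtain ⟨b, hb, hpath⟩ := hF.2 i h₁ h₂
    have := Path.betweenWord_eq (η := η) hS hpath fun x hxs =>
      have hxb := hsub _ (List.get_mem _ _) hxs
      ⟨(hx x hxb).1, (hx x hxb).2, hwx x hxb⟩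
    cases b with
    | true => exact ⟨fun _ => by rw [this, Production.flatMap_word_true],
        fun h => absurd (hb.2 rfl) h⟩
    | false => exact ⟨fun h => by simpa using hb.1 h, fun _ => this⟩

theorem mem_language_of_chain (hS : S.Compatible lab) (G : MCFG α N X)
    (hG : ∀ A h, S.col A h → (∃ n, (A, n) ∈ G.nonterminals) →
      ∃ ρ ∈ G.rules, ρ.head = A ∧ S.Applies ρ.args ρ.body h) {h o c : V}
    (hh : S.col G.start h) (ho : S.edge h o) (hc : S.edge o c) (hoc : S.lt o c) (hsil : ¬ S.sil o)
    (hmin : ∀ v, o ≤ v) (hmax : ∀ v, v ≤ c) :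
    ((Finset.univ : Finset V).sort (· ≤ ·)).filterMap lab ∈ G.language := by
  obtain ⟨u, hu, hw⟩ := derives_of_chain hS G hG (Fintype.card V + 1) G.start [(o, c)] h
    G.start_mem hh ⟨ho, hc, hoc, trivial⟩ fun p _ => Nat.lt_succ_iff.2 (Finset.card_le_univ _)
  rw [filterMap_sort_eq (hS.lt _ _ hoc) hmin hmax (hS.edge_left _ _ hc) (hS.edge_right _ _ hc)]
  cases hw with
  | cons h₁ h₂ =>
    cases h₂
    rw [MCFG.language, Set.mem_ofPred_eq, h₁.2 hsil]
    exact hu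

end Relations

/-! ### Auxiliary formulas -/

namespace MSO

variable {α Γ : Type}

/-- All free variables of a formula satisfy the given predicates. -/
def Uses : MSO α Γ → (ℕ → Prop) → (ℕ → Prop) → Prop
  | label _ x, P, _ => P x
  | mem x S, P, Q => P x ∧ Q S
  | succ x y, P, _ => P x ∧ P y
  | edge _ x y, P, _ => P x ∧ P y
  | neg φ, P, Q => φ.Uses P Q
  | or φ ψ, P, Q => φ.Uses P Q ∧ ψ.Uses P Q
  | ex x φ, P, Q => φ.Uses (fun n => n = x ∨ P n) Q
  | exSet S φ, P, Q => φ.Uses P fun n => n = S ∨ Q n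

/-- Bounds on the free variables pass through the quantifiers by enlarging a predicate, so being a
sentence is the case of two false predicates. -/
theorem Uses.subset {φ : MSO α Γ} : ∀ {P Q : ℕ → Prop}, φ.Uses P Q →
    (∀ n ∈ φ.freeVars, P n) ∧ ∀ n ∈ φ.freeSetVars, Q n := by
  induction φ with
  | or φ ψ h₁ h₂ =>
    rintro P Q ⟨h, h'⟩
    simp only [freeVars, freeSetVars, Set.mem_union]
    exact ⟨fun n hn => hn.elim ((h₁ h).1 n) ((h₂ h').1 n),
      fun n hn => hn.elim ((h₁ h).2 n) ((h₂ h').2 n)⟩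
  | neg φ ih => exact fun h => ih h
  | ex x φ ih =>
    exact fun h => ⟨fun n hn => ((ih h).1 n hn.1).resolve_left hn.2, (ih h).2⟩
  | exSet S φ ih =>
    exact fun h => ⟨(ih h).1, fun n hn => ((ih h).2 n hn.1).resolve_left hn.2⟩
  | _ => simp_all [Uses, freeVars, freeSetVars]

theorem Uses.isSentence {φ : MSO α Γ} (h : φ.Uses (fun _ => False) fun _ => False) :
    φ.IsSentence :=
  ⟨Set.eq_empty_iff_forall_notMem.2 h.subset.1, Set.eq_empty_iff_forall_notMem.2 h.subset.2⟩

/-- Conjunction. -/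
def and (φ ψ : MSO α Γ) : MSO α Γ := neg (or (neg φ) (neg ψ))

/-- A false sentence. -/
def falsum : MSO α Γ := ex 0 (succ 0 0)

/-- Equality of vertices. -/
def eqv (x y : ℕ) : MSO α Γ := neg (exSet 0 (and (mem x 0) (neg (mem y 0))))

/-- The reflexive order of the vertices. -/
def le (x y : ℕ) : MSO α Γ :=
  neg (exSet 0 (and (mem x 0) (and
    (neg (ex 8 (ex 9 (and (mem 8 0) (and (succ 8 9) (neg (mem 9 0))))))) (neg (mem y 0)))))

/-- The strict order of the vertices. -/
def lt (x y : ℕ) : MSO α Γ := ex 7 (and (succ x 7) (le 7 y))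

variable {G : LoGraph α Γ} {v : ℕ → Option G.V} {σ : ℕ → Set G.V}

@[simp]
theorem sat_and {φ ψ : MSO α Γ} : Sat G (and φ ψ) v σ ↔ Sat G φ v σ ∧ Sat G ψ v σ := by
  simp [and, Sat]

@[simp]
theorem uses_and {φ ψ : MSO α Γ} {P Q : ℕ → Prop} :
    (and φ ψ).Uses P Q ↔ φ.Uses P Q ∧ ψ.Uses P Q := Iff.rfl

@[simp]
theorem not_sat_falsum : ¬ Sat G falsum v σ := by
  simp [falsum, Sat, LoGraph.Succ]

@[simp]
theorem uses_falsum {P Q : ℕ → Prop} : (falsum : MSO α Γ).Uses P Q := by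
  simp [falsum, Uses]

theorem sat_ex {x : ℕ} {φ : MSO α Γ} :
    Sat G (ex x φ) v σ ↔ ∃ u, Sat G φ (Function.update v x (some u)) σ := Iff.rfl

theorem sat_neg {φ : MSO α Γ} : Sat G (neg φ) v σ ↔ ¬ Sat G φ v σ := Iff.rfl

theorem sat_or {φ ψ : MSO α Γ} : Sat G (or φ ψ) v σ ↔ Sat G φ v σ ∨ Sat G ψ v σ := Iff.rfl

theorem sat_label {a : α} {x : ℕ} {u : G.V} (hx : v x = some u) :
    Sat G (label a x) v σ ↔ G.label u = some a := by
  simp [Sat, hx]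

theorem sat_mem {x A : ℕ} {u : G.V} (hx : v x = some u) : Sat G (mem x A) v σ ↔ u ∈ σ A := by
  simp [Sat, hx]

theorem sat_succ {x y : ℕ} {u w : G.V} (hx : v x = some u) (hy : v y = some w) :
    Sat G (succ x y) v σ ↔ G.Succ u w := by
  simp [Sat, hx, hy]

theorem sat_edge {γ : Γ} {x y : ℕ} {u w : G.V} (hx : v x = some u) (hy : v y = some w) :
    Sat G (edge γ x y) v σ ↔ G.edge γ u w := by
  simp [Sat, hx, hy]

theorem sat_eqv {x y : ℕ} {a b : G.V} (hx : v x = some a) (hy : v y = some b) :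
    Sat G (eqv x y) v σ ↔ a = b := by
  simp only [eqv, Sat, sat_and, hx, hy, Option.some.injEq, exists_eq_left', Function.update_self]
  constructor
  · intro h
    by_contra hab
    exact h ⟨{a}, rfl, fun h => hab h.symm⟩
  · rintro rfl ⟨A, h, h'⟩
    exact h' h

@[simp]
theorem uses_eqv {x y : ℕ} {P Q : ℕ → Prop} :
    (eqv x y : MSO α Γ).Uses P Q ↔ P x ∧ P y := by
  simp [eqv, Uses]

/-- The formula says that every set closed under successors that contains `x` contains `y`. The
up-set of `a` is such a set; conversely, the order of a finite chain is generated by its covering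
relation. -/
theorem sat_le {x y : ℕ} {a b : G.V} (hx : v x = some a) (hy : v y = some b) :
    Sat G (le x y) v σ ↔ a ≤ b := by
  have h89 : (8 : ℕ) ≠ 9 := by decide
  simp only [le, Sat, sat_and, hx, hy, Option.some.injEq, exists_eq_left', Function.update_self,
    Function.update_of_ne h89]
  constructor
  · intro h
    by_contra hab
    refine h ⟨{u | a ≤ u}, le_refl a, ?_, hab⟩
    rintro ⟨u, w, hu, ⟨_, _, rfl, rfl, huw⟩, hw⟩
    exact hw (le_trans (show a ≤ u from hu) huw.le)
  · rintro hab ⟨A, ha, hA, hb⟩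
    refine hb ?_
    let _ : LocallyFiniteOrder G.V := Fintype.toLocallyFiniteOrder
    have := le_iff_reflTransGen_covBy.1 hab
    clear hab hb hy
    induction this with
    | refl => exact ha
    | @tail c d h₁ h₂ ih =>
      by_contra hd
      exact hA ⟨c, d, ih, ⟨c, d, rfl, rfl, h₂⟩, hd⟩

@[simp]
theorem uses_le {x y : ℕ} {P Q : ℕ → Prop} : (le x y : MSO α Γ).Uses P Q ↔ P x ∧ P y := by
  simp [le, Uses]

theorem sat_lt {x y : ℕ} {a b : G.V} (hx : v x = some a) (hy : v y = some b) (hx7 : x ≠ 7)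
    (hy7 : y ≠ 7) : Sat G (lt x y) v σ ↔ a < b := by
  have (u : G.V) : Sat G (le 7 y) (Function.update v 7 (some u)) σ ↔ u ≤ b :=
    sat_le (by simp) (by simp [hy7, hy])
  simp only [lt, Sat, sat_and, this, Function.update_of_ne hx7, hx, Function.update_self,
    Option.some.injEq]
  constructor
  · rintro ⟨u, ⟨_, _, rfl, rfl, h⟩, h'⟩
    exact lt_of_lt_of_le h.lt h'
  · intro hab
    let _ : LocallyFiniteOrder G.V := Fintype.toLocallyFiniteOrder
    obtain ⟨c, hc, hcb⟩ := Relation.TransGen.head'_iff.1 (lt_iff_transGen_covBy.1 hab)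
    exact ⟨c, ⟨a, c, rfl, rfl, hc⟩, le_iff_reflTransGen_covBy.2 hcb⟩

@[simp]
theorem uses_lt {x y : ℕ} {P Q : ℕ → Prop} :
    (lt x y : MSO α Γ).Uses P Q ↔ (x = 7 ∨ P x) ∧ (y = 7 ∨ P y) := by
  simp [lt, Uses]

end MSO

/-! ### The formula of a grammar -/

namespace MSO

variable {α N X : Type} [Encodable N] [Encodable X]

/-- The first-order variable for the first vertex of the span of a variable of the grammar. -/
def opVar (x : X) : ℕ := 2 * Encodable.encode x + 10

/-- The first-order variable for the last vertex of the span of a variable of the grammar. -/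
def clVar (x : X) : ℕ := 2 * Encodable.encode x + 11

/-- The set variable for a nonterminal. -/
def colVar (A : N) : ℕ := Encodable.encode A + 2

/-- The span of `x` comes next, and is silent or not, and is followed by something with `ψ`. -/
def spanFormula (b : Bool) (x : X) (ψ : MSO α Unit) : MSO α Unit :=
  and (succ 0 (opVar x)) (and (if b then mem (opVar x) 1 else neg (mem (opVar x) 1))
    (ex 0 (and (eqv 0 (clVar x)) ψ)))

/-- The token comes next, and is followed by something with `ψ`. -/
def tokenFormula (b : Bool) : Token α X → MSO α Unit → MSO α Unit
  | .inl (.inl a), ψ =>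
    if b then ψ else ex 5 (and (succ 0 5) (and (label a 5) (ex 0 (and (eqv 0 5) ψ))))
  | .inl (.inr x), ψ => spanFormula b x ψ
  | .inr x, ψ => spanFormula true x ψ

/-- The vertices from `0` to `1` follow the tokens. -/
def pathFormula (b : Bool) (s : List (Token α X)) : MSO α Unit :=
  s.foldr (tokenFormula b) (succ 0 1)

/-- The edges run from `1` through a span that follows the tokens, and then `ψ` holds. -/
def argFormula (s : List (Token α X)) (ψ : MSO α Unit) : MSO α Unit :=
  ex 2 (and (edge () 1 2) (ex 1 (and (edge () 2 1) (and
    (or (and (neg (mem 2 1)) (ex 0 (and (eqv 0 2) (pathFormula false s))))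
      (and (mem 2 1) (ex 0 (and (eqv 0 2) (pathFormula true s))))) ψ))))

/-- The edges run from `1` through spans that follow the arguments. -/
def argsFormula (ss : List (List (Token α X))) : MSO α Unit := ss.foldr argFormula (neg falsum)

/-- The edges run from `1` through the span of `x`, and then `ψ` holds. -/
def linkFormula (x : X) (ψ : MSO α Unit) : MSO α Unit :=
  and (edge () 1 (opVar x)) (and (edge () (opVar x) (clVar x)) (and (lt (opVar x) (clVar x))
    (ex 1 (and (eqv 1 (clVar x)) ψ))))

/-- The edges run from `1` through the spans of the variables. -/
def chainFormula (xs : List X) : MSO α Unit := xs.foldr linkFormula (neg falsum)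

/-- The edges run from a vertex of the right colour through the spans of the variables. -/
def termFormula (t : N × List X) (ψ : MSO α Unit) : MSO α Unit :=
  and (ex 1 (and (mem 1 (colVar t.1)) (chainFormula t.2))) ψ

/-- Quantification over the ends of the span of a variable. -/
def exSpan (x : X) (ψ : MSO α Unit) : MSO α Unit := ex (opVar x) (ex (clVar x) ψ)

/-- A production is applied at the vertex `4`. -/
def ruleFormula [DecidableEq X] (args : List (List (α ⊕ X))) (body : List (N × List X)) :
    MSO α Unit :=
  (body.flatMap Prod.snd).foldr exSpan
    (body.foldr termFormula (ex 1 (and (eqv 1 4) (argsFormula (Production.tokens args body)))))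

/-! ### Correctness of the building blocks -/

variable {G : LoGraph α Unit} {v : ℕ → Option G.V} {σ : ℕ → Set G.V}

/-- The relations of a graph with a valuation of the set variables. -/
def relations (G : LoGraph α Unit) (σ : ℕ → Set G.V) : Relations α N G.V where
  succ := G.Succ
  lt u w := u < w
  edge := G.edge ()
  lab u a := G.label u = some a
  col A u := u ∈ σ (colVar A)
  sil u := u ∈ σ 1

/-- The assignment maps the variables for ends of spans to those ends. -/
def Assigns (op cl : X → G.V) (xs : List X) (v : ℕ → Option G.V) : Prop :=
  ∀ x ∈ xs, v (opVar x) = some (op x) ∧ v (clVar x) = some (cl x)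

/-- Auxiliary first-order variables are numbered below 10, those for the ends of spans from 10 on,
so rebinding the former never disturbs the latter. -/
theorem Assigns.update {op cl : X → G.V} {xs : List X} (h : Assigns op cl xs v) {n : ℕ}
    (hn : n < 10) (u : Option G.V) : Assigns op cl xs (Function.update v n u) := by
  intro x hx
  have h₁ : opVar x ≠ n := by unfold opVar; omega
  have h₂ : clVar x ≠ n := by unfold clVar; omega
  rw [Function.update_of_ne h₁, Function.update_of_ne h₂]
  exact h x hx

theorem opVar_ne (x : X) {n : ℕ} (hn : n < 10) : opVar x ≠ n := by unfold opVar; omega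

theorem clVar_ne (x : X) {n : ℕ} (hn : n < 10) : clVar x ≠ n := by unfold clVar; omega

/-- This is how a variable is overwritten: it is bound anew and pinned to the value of another one.
A few fixed variables can thereby walk along the graph. -/
theorem sat_ex_eqv {x y : ℕ} {ψ : MSO α Unit} {u : G.V} (hy : v y = some u) (hxy : y ≠ x) :
    Sat G (ex x (and (eqv x y) ψ)) v σ ↔ Sat G ψ (Function.update v x (some u)) σ := by
  have (w : G.V) : Sat G (eqv x y) (Function.update v x (some w)) σ ↔ w = u :=
    sat_eqv (by simp) (by simp [hxy, hy])
  simp only [Sat, sat_and, this, exists_eq_left]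

theorem sat_spanFormula {b : Bool} {op cl : X → G.V} {x : X} {p : G.V} {ψ : MSO α Unit}
    (h₀ : v 0 = some p) (hx : Assigns op cl [x] v) :
    Sat G (spanFormula b x ψ) v σ ↔ G.Succ p (op x) ∧ (op x ∈ σ 1 ↔ b = true) ∧
      Sat G ψ (Function.update v 0 (some (cl x))) σ := by
  obtain ⟨ho, hc⟩ := hx x (by simp)
  rw [spanFormula, sat_and, sat_and, sat_succ h₀ ho, sat_ex_eqv hc (clVar_ne x (by decide))]
  cases b <;> simp [Sat, ho]

theorem sat_pathFormula {b : Bool} {op cl : X → G.V} {q : G.V} {s : List (Token α X)} :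
    ∀ {v : ℕ → Option G.V} {p : G.V}, v 0 = some p → v 1 = some q →
      Assigns op cl (s.filterMap Token.var) v →
      (Sat G (pathFormula b s) v σ ↔ (relations (N := N) G σ).Path op cl b q s p) := by
  induction s with
  | nil =>
    intro v p h₀ h₁ _
    exact sat_succ h₀ h₁
  | cons t s ih =>
    intro v p h₀ h₁ h
    have h10 : (1 : ℕ) ≠ 0 := by decide
    rcases t with (a | x) | x
    · have e : (Sum.inl (.inl a) :: s).filterMap Token.var = s.filterMap Token.var := rfl
      rw [e] at h
      cases b with
      | true => simpa [pathFormula, tokenFormula, Relations.Path] using ih h₀ h₁ h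
      | false =>
        have h5 (r : G.V) : Function.update v 5 (some r) 5 = some r := by simp
        have h0 (r : G.V) : Function.update v 5 (some r) 0 = some p := by simpa using h₀
        have (r : G.V) := ih (v := Function.update (Function.update v 5 (some r)) 0 (some r))
          (p := r) (by simp) (by simpa using h₁) ((h.update (by decide) _).update (by decide) _)
        simp only [pathFormula, List.foldr_cons, tokenFormula, Bool.false_eq_true, if_false,
          Relations.Path] at this ⊢
        rw [Sat]
        simp only [sat_and, sat_succ (h0 _) (h5 _), sat_label (h5 _),
          sat_ex_eqv (h5 _) (show 5 ≠ 0 by decide), this]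
        rfl
    · have e : (Sum.inl (.inr x) :: s).filterMap Token.var = x :: s.filterMap Token.var := rfl
      rw [e] at h
      refine (sat_spanFormula h₀ fun y hy => h y (by simp_all)).trans ?_
      refine and_congr Iff.rfl (and_congr Iff.rfl (ih (by simp) (by simpa using h₁) ?_))
      exact Assigns.update (fun y hy => h y (by simp [hy])) (by decide) _
    · have e : (Sum.inr x :: s).filterMap Token.var = x :: s.filterMap Token.var := rfl
      rw [e] at h
      refine (sat_spanFormula h₀ fun y hy => h y (by simp_all)).trans ?_
      refine and_congr Iff.rfl (and_congr (by simp [relations])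
        (ih (by simp) (by simpa using h₁) ?_))
      exact Assigns.update (fun y hy => h y (by simp [hy])) (by decide) _

/-- The variable 1 is rebound to the closing end, which is both the target of the path of this
argument and the vertex from which the edge to the next argument starts. -/
theorem sat_argsFormula {op cl : X → G.V} {ss : List (List (Token α X))} :
    ∀ {v : ℕ → Option G.V} {h : G.V}, v 1 = some h →
      (∀ s ∈ ss, Assigns op cl (s.filterMap Token.var) v) →
      (Sat G (argsFormula ss) v σ ↔ (relations (N := N) G σ).Args op cl ss h) := by
  induction ss with
  | nil =>
    intro v h _ _
    simp [argsFormula, Relations.Args, Sat]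
  | cons s ss ih =>
    intro v h h₁ hs
    have h2 (o : G.V) : Function.update v 2 (some o) 2 = some o := by simp
    have h1 (o : G.V) : Function.update v 2 (some o) 1 = some h := by simpa using h₁
    have h2' (o c : G.V) :
      Function.update (Function.update v 2 (some o)) 1 (some c) 2 = some o := by simp
    have h1' (o c : G.V) :
      Function.update (Function.update v 2 (some o)) 1 (some c) 1 = some c := by simp
    have hA (o c : G.V) (t) (ht : t ∈ s :: ss) := ((hs t ht).update (n := 2) (by decide)
      (some o)).update (n := 1) (by decide) (some c)
    have h3 (o c : G.V) (b : Bool) := sat_pathFormula (N := N) (σ := σ) (b := b) (p := o) (q := c)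
      (v := Function.update (Function.update (Function.update v 2 (some o)) 1 (some c)) 0 (some o))
      (by simp) (by simp) ((hA o c s (by simp)).update (by decide) _)
    have h4 (o c : G.V) := ih (h1' o c) fun t ht => hA o c t (by simp [ht])
    simp only [argsFormula, List.foldr_cons] at h4 ⊢
    rw [argFormula]
    rw [Sat]
    simp only [sat_and]
    refine exists_congr fun o => ?_
    rw [sat_edge (h1 o) (h2 o), sat_ex, ← exists_and_left]
    refine exists_congr fun c => ?_
    rw [sat_and, sat_and, sat_edge (h2' o c) (h1' o c), h4]
    refine and_congr Iff.rfl (and_congr Iff.rfl (and_congr ?_ Iff.rfl))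
    rw [sat_or, sat_and, sat_and, sat_neg, sat_mem (h2' o c), sat_ex_eqv (h2' o c) (by decide),
      sat_ex_eqv (h2' o c) (by decide), h3, h3, Bool.exists_bool]
    simp [relations]

theorem sat_chainFormula {op cl : X → G.V} {xs : List X} :
    ∀ {v : ℕ → Option G.V} {h : G.V}, v 1 = some h → Assigns op cl xs v →
      (Sat G (chainFormula xs) v σ ↔
        (relations (N := N) G σ).Chain (xs.map fun x => (op x, cl x)) h) := by
  induction xs with
  | nil =>
    intro v h _ _
    simp [chainFormula, Relations.Chain, Sat]
  | cons x xs ih =>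
    intro v h h₁ hv
    obtain ⟨ho, hc⟩ := hv x (by simp)
    have := ih (v := Function.update v 1 (some (cl x))) (h := cl x) (by simp)
      (Assigns.update (fun y hy => hv y (by simp [hy])) (by decide) _)
    simp only [chainFormula, List.foldr_cons] at this ⊢
    rw [linkFormula, sat_and, sat_and, sat_and, sat_edge h₁ ho, sat_edge ho hc,
      sat_lt ho hc (opVar_ne x (by decide)) (clVar_ne x (by decide)),
      sat_ex_eqv hc (clVar_ne x (by decide)), this]
    rfl

theorem sat_foldr_termFormula {op cl : X → G.V} {ψ : MSO α Unit} {body : List (N × List X)} :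
    Assigns op cl (body.flatMap Prod.snd) v →
      (Sat G (body.foldr termFormula ψ) v σ ↔
        (∀ t ∈ body, ∃ h', (relations (N := N) G σ).col t.1 h' ∧
          (relations (N := N) G σ).Chain (t.2.map fun x => (op x, cl x)) h') ∧ Sat G ψ v σ) := by
  induction body with
  | nil => simp
  | cons t body ih =>
    intro hv
    have hv' := ih fun y hy => hv y (by simp only [List.flatMap_cons, List.mem_append, hy, or_true])
    rw [List.foldr_cons, termFormula, sat_and, hv']
    simp only [List.forall_mem_cons, and_assoc]
    refine and_congr ?_ Iff.rfl
    rw [Sat]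
    refine exists_congr fun h' => ?_
    rw [sat_and, sat_mem (u := h') (by simp), sat_chainFormula (N := N) (h := h') (by simp)
      (Assigns.update (fun y hy => hv y (by simp [hy])) (by decide) _)]
    rfl

theorem opVar_inj {x y : X} : opVar x = opVar y ↔ x = y := by
  simp [opVar]

theorem clVar_inj {x y : X} : clVar x = clVar y ↔ x = y := by
  simp [clVar]

theorem opVar_ne_clVar (x y : X) : opVar x ≠ clVar y := by
  unfold opVar clVar
  omega

/-- A variable may be bound again but never loses its value; hence the induction carries along the
pairs that are already assigned. -/
theorem exists_of_sat_exSpan {ψ : MSO α Unit} {xs : List X} : ∀ {v : ℕ → Option G.V},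
    Sat G (xs.foldr exSpan ψ) v σ → ∃ v', (∀ n < 10, v' n = v n) ∧
      (∀ x, (x ∈ xs ∨ (v (opVar x)).isSome ∧ (v (clVar x)).isSome) →
        (v' (opVar x)).isSome ∧ (v' (clVar x)).isSome) ∧ Sat G ψ v' σ := by
  induction xs with
  | nil => exact fun h => ⟨_, fun _ _ => rfl, by simp, h⟩
  | cons x xs ih =>
    rintro v ⟨o, c, h⟩
    obtain ⟨v', h₁, h₂, h₃⟩ := ih h
    refine ⟨v', fun n hn => ?_, fun y hy => h₂ y ?_, h₃⟩
    · rw [h₁ n hn, Function.update_of_ne (clVar_ne x hn).symm,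
        Function.update_of_ne (opVar_ne x hn).symm]
    · by_cases hyx : y = x
      · subst hyx
        right
        simp [Function.update_of_ne (opVar_ne_clVar y y)]
      · rw [List.mem_cons, or_iff_right hyx] at hy
        rwa [Function.update_of_ne (opVar_ne_clVar y x),
          Function.update_of_ne (mt opVar_inj.1 hyx), Function.update_of_ne (mt clVar_inj.1 hyx),
          Function.update_of_ne (opVar_ne_clVar x y).symm]

theorem sat_exSpan_of_forall {ψ : MSO α Unit} {op cl : X → G.V} {xs ys : List X} :
    ∀ {v : ℕ → Option G.V}, Assigns op cl ys v →
    (∀ v', (∀ n < 10, v' n = v n) → Assigns op cl (xs ++ ys) v' → Sat G ψ v' σ) →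
      Sat G (xs.foldr exSpan ψ) v σ := by
  induction xs generalizing ys with
  | nil => exact fun hv h => h _ (fun _ _ => rfl) hv
  | cons x xs ih =>
    intro v hv h
    refine ⟨op x, cl x, ih (ys := x :: ys) (fun y hy => ?_) fun v' h₁ h₂ => h v' (fun n hn => ?_)
      fun y hy => h₂ y ?_⟩
    · by_cases hyx : y = x
      · subst hyx
        simp [Function.update_of_ne (opVar_ne_clVar y y)]
      · rw [List.mem_cons, or_iff_right hyx] at hy
        rw [Function.update_of_ne (opVar_ne_clVar y x),
          Function.update_of_ne (mt opVar_inj.1 hyx), Function.update_of_ne (mt clVar_inj.1 hyx),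
          Function.update_of_ne (opVar_ne_clVar x y).symm]
        exact hv y hy
    · rw [h₁ n hn, Function.update_of_ne (clVar_ne x hn).symm,
        Function.update_of_ne (opVar_ne x hn).symm]
    · simp only [List.cons_append, List.mem_cons, List.mem_append] at hy ⊢
      tauto

variable [DecidableEq X]

theorem sat_ruleFormula {args : List (List (α ⊕ X))} {body : List (N × List X)} {h : G.V}
    (h₄ : v 4 = some h)
    (hvars : ∀ s ∈ Production.tokens args body, s.filterMap Token.var ⊆ body.flatMap Prod.snd) :
    Sat G (ruleFormula args body) v σ ↔ (relations G σ).Applies args body h := by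
  have key (v' : ℕ → Option G.V) (op cl : X → G.V) (hv : Assigns op cl (body.flatMap Prod.snd) v')
      (h₄ : v' 4 = some h) := (sat_foldr_termFormula (N := N) (σ := σ) hv).trans
    (and_congr Iff.rfl ((sat_ex_eqv h₄ (by decide)).trans (sat_argsFormula (N := N)
      (ss := Production.tokens args body) (h := h) (by simp) fun s hs =>
        Assigns.update (fun y hy => hv y (hvars s hs hy)) (n := 1) (by decide) (some h))))
  constructor
  · intro hs
    obtain ⟨v', h₁, h₂, h₃⟩ := exists_of_sat_exSpan hs
    -- The default `h` is taken only by variables outside the body, whose spans play no role.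
    refine ⟨fun x => (v' (opVar x)).getD h, fun x => (v' (clVar x)).getD h, (key v' _ _ ?_ ?_).1 h₃⟩
    · intro x hx
      obtain ⟨ho, hc⟩ := h₂ x (Or.inl hx)
      obtain ⟨o, ho⟩ := Option.isSome_iff_exists.1 ho
      obtain ⟨c, hc⟩ := Option.isSome_iff_exists.1 hc
      simp [ho, hc]
    · rw [h₁ 4 (by decide), h₄]
  · rintro ⟨op, cl, hoc⟩
    refine sat_exSpan_of_forall (op := op) (cl := cl) (ys := []) (by simp [Assigns]) ?_
    intro v' h₁ h₂
    exact (key v' op cl (by simpa using h₂) (by rw [h₁ 4 (by decide), h₄])).2 hoc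

end MSO

/-! ### Free variables, and the sentence of the grammar -/

namespace MSO

variable {α N X : Type} [Encodable N] [Encodable X]

theorem Uses.mono {φ : MSO α Unit} : ∀ {P P' Q : ℕ → Prop}, (∀ n, P n → P' n) → φ.Uses P Q →
    φ.Uses P' Q := by
  induction φ with
  | or φ ψ h₁ h₂ => exact fun h h' => ⟨h₁ h h'.1, h₂ h h'.2⟩
  | neg φ ih => exact fun h h' => ih h h'
  | ex x φ ih => exact fun h h' => ih (fun n hn => hn.imp id (h n)) h'
  | exSet S φ ih => exact fun h h' => ih h h'
  | label a x => exact fun h h' => h _ h'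
  | mem x S => exact fun h h' => ⟨h _ h'.1, h'.2⟩
  | succ x y => exact fun h h' => ⟨h _ h'.1, h _ h'.2⟩
  | edge γ x y => exact fun h h' => ⟨h _ h'.1, h _ h'.2⟩

theorem uses_ex {φ : MSO α Unit} {x : ℕ} {P Q : ℕ → Prop} (h : φ.Uses P Q) : (ex x φ).Uses P Q :=
  show φ.Uses (fun n => n = x ∨ P n) Q from h.mono fun _ => Or.inr

theorem uses_spanFormula {P Q : ℕ → Prop} {b : Bool} {x : X} {ψ : MSO α Unit} (h₀ : P 0)
    (hQ : Q 1) (hx : P (opVar x) ∧ P (clVar x)) (hψ : ψ.Uses P Q) :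
    (spanFormula b x ψ).Uses P Q := by
  have : (MSO.ex 0 (and (eqv 0 (clVar x)) ψ)).Uses P Q := uses_ex (by simp [h₀, hx, hψ])
  cases b <;> simp [spanFormula, this] <;> simp [Uses, h₀, hx, hQ]

theorem uses_pathFormula {P Q : ℕ → Prop} {b : Bool} {s : List (Token α X)} (h₀ : P 0) (h₁ : P 1)
    (hQ : Q 1) (hs : ∀ x ∈ s.filterMap Token.var, P (opVar x) ∧ P (clVar x)) :
    (pathFormula b s).Uses P Q := by
  induction s with
  | nil => exact ⟨h₀, h₁⟩
  | cons t s ih =>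
    rcases t with (a | x) | x
    · have h := ih hs
      cases b with
      | true => exact h
      | false =>
        have h5 := h.mono (P' := fun n => n = 5 ∨ P n) fun n => Or.inr
        have h50 := h5.mono (P' := fun n => n = 0 ∨ n = 5 ∨ P n) fun n => Or.inr
        exact ⟨⟨Or.inr h₀, Or.inl rfl⟩, Or.inl rfl, by simp [Uses], h50⟩
    · have e : (Sum.inl (.inr x) :: s).filterMap Token.var = x :: s.filterMap Token.var := rfl
      rw [e] at hs
      exact uses_spanFormula h₀ hQ (hs x (by simp)) (ih fun y hy => hs y (by simp [hy]))
    · have e : (Sum.inr x :: s).filterMap Token.var = x :: s.filterMap Token.var := rfl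
      rw [e] at hs
      exact uses_spanFormula h₀ hQ (hs x (by simp)) (ih fun y hy => hs y (by simp [hy]))

theorem uses_argsFormula {P Q : ℕ → Prop} {ss : List (List (Token α X))} (h₁ : P 1) (hQ : Q 1)
    (hs : ∀ s ∈ ss, ∀ x ∈ s.filterMap Token.var, P (opVar x) ∧ P (clVar x)) :
    (argsFormula ss).Uses P Q := by
  induction ss with
  | nil => simp [argsFormula, Uses]
  | cons s ss ih =>
    have h := ih fun t ht => hs t (by simp [ht])
    have hp (b : Bool) (P' : ℕ → Prop) (hP : ∀ n, P n → P' n) (h0 : P' 0) :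
        (pathFormula b s).Uses P' Q := uses_pathFormula h0 (hP _ h₁) hQ fun x hx =>
      (hs s (by simp) x hx).imp (hP _) (hP _)
    have h2 := (h.mono (P' := fun n => n = 2 ∨ P n) fun n => Or.inr).mono
      (P' := fun n => n = 1 ∨ n = 2 ∨ P n) fun n => Or.inr
    refine ⟨⟨Or.inr h₁, Or.inl rfl⟩, ⟨by simp, by simp⟩, ⟨⟨?_, ?_⟩, ?_, ?_⟩, h2⟩
    · exact ⟨by simp, hQ⟩
    · exact ⟨by simp [Uses], hp _ _ (fun n hn => Or.inr (Or.inr (Or.inr hn))) (Or.inl rfl)⟩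
    · exact ⟨by simp, hQ⟩
    · exact ⟨by simp [Uses], hp _ _ (fun n hn => Or.inr (Or.inr (Or.inr hn))) (Or.inl rfl)⟩

theorem uses_chainFormula {P Q : ℕ → Prop} {xs : List X} (h₁ : P 1)
    (hs : ∀ x ∈ xs, P (opVar x) ∧ P (clVar x)) : (chainFormula xs : MSO α Unit).Uses P Q := by
  induction xs with
  | nil => simp [chainFormula, Uses]
  | cons x xs ih =>
    have h := (ih fun y hy => hs y (by simp [hy])).mono (P' := fun n => n = 1 ∨ P n)
      fun n => Or.inr
    obtain ⟨ho, hc⟩ := hs x (by simp)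
    exact ⟨⟨h₁, ho⟩, ⟨ho, hc⟩, by simp [Uses, ho, hc], by simp [Uses, hc], h⟩

theorem uses_foldr_termFormula {P Q : ℕ → Prop} {body : List (N × List X)} {ψ : MSO α Unit}
    (hQ : ∀ t ∈ body, Q (colVar t.1))
    (hs : ∀ x ∈ body.flatMap Prod.snd, P (opVar x) ∧ P (clVar x)) (hψ : ψ.Uses P Q) :
    (body.foldr termFormula ψ).Uses P Q := by
  induction body with
  | nil => exact hψ
  | cons t body ih =>
    refine ⟨⟨⟨Or.inl rfl, hQ t (by simp)⟩, uses_chainFormula (Or.inl rfl) fun x hx => ?_⟩,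
      ih (fun t' ht => hQ t' (by simp [ht])) fun x hx => hs x ?_⟩
    · exact (hs x (by simp [hx])).imp Or.inr Or.inr
    · rw [List.flatMap_cons, List.mem_append]
      exact Or.inr hx

theorem uses_foldr_exSpan {Q : ℕ → Prop} {xs : List X} {ψ : MSO α Unit} : ∀ {P : ℕ → Prop},
    ψ.Uses (fun n => P n ∨ ∃ x ∈ xs, n = opVar x ∨ n = clVar x) Q →
      (xs.foldr exSpan ψ).Uses P Q := by
  induction xs with
  | nil => exact fun h => h.mono fun n => by simp
  | cons x xs ih =>
    intro P h
    refine ih (h.mono fun n => ?_)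
    simp only [List.exists_mem_cons_iff]
    rintro (h | (h | h) | h) <;> simp [h]

/-- Every vertex has at most one outgoing edge. -/
def functionalFormula : MSO α Unit :=
  neg (ex 0 (ex 1 (ex 2 (and (edge () 0 1) (and (edge () 0 2) (neg (eqv 1 2)))))))

/-- The ends of an edge do not carry the letter. -/
def unlabelledFormula (a : α) (ψ : MSO α Unit) : MSO α Unit :=
  and (neg (ex 0 (ex 1 (and (edge () 0 1) (or (label a 0) (label a 1)))))) ψ

/-- Some vertex of the colour of the start symbol has a span that consists of all vertices. -/
def startFormula (A : N) : MSO α Unit :=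
  ex 4 (and (mem 4 (colVar A)) (ex 1 (and (edge () 4 1) (ex 2 (and (edge () 1 2) (and (lt 1 2)
    (and (neg (mem 1 1)) (and (neg (ex 0 (succ 0 1))) (neg (ex 0 (succ 2 0)))))))))))

variable [DecidableEq N] [DecidableEq X]

/-- A production with head `A` is applied at the vertex `4`, or `ψ` holds. -/
def choiceFormula (A : N) (ρ : Production α N X) (ψ : MSO α Unit) : MSO α Unit :=
  if ρ.head = A then or (ruleFormula ρ.args ρ.body) ψ else ψ

/-- A production with head `A` is applied at every vertex of the colour `A`. -/
def nonterminalFormula (rules : List (Production α N X)) (p : N × ℕ) (ψ : MSO α Unit) :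
    MSO α Unit :=
  and (neg (ex 4 (and (mem 4 (colVar p.1)) (neg (rules.foldr (choiceFormula p.1) falsum))))) ψ

/-- The formula of a grammar inside the quantification over the colours. -/
def innerFormula (letters : List α) (G : MCFG α N X) : MSO α Unit :=
  and functionalFormula (and (letters.foldr unlabelledFormula (neg falsum))
    (and (startFormula G.start) (G.nonterminals.foldr (nonterminalFormula G.rules) (neg falsum))))

/-- Quantification over the colour of a nonterminal. -/
def exColour (p : N × ℕ) (ψ : MSO α Unit) : MSO α Unit := exSet (colVar p.1) ψ

/-- The sentence whose models spell the words generated by the grammar. -/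
def grammarFormula (letters : List α) (G : MCFG α N X) : MSO α Unit :=
  G.nonterminals.foldr exColour (exSet 1 (innerFormula letters G))

theorem uses_ruleFormula {P Q : ℕ → Prop} {args : List (List (α ⊕ X))} {body : List (N × List X)}
    (hP : P 4) (hQ : Q 1) (hbody : ∀ t ∈ body, Q (colVar t.1))
    (hvars : ∀ s ∈ Production.tokens args body, s.filterMap Token.var ⊆ body.flatMap Prod.snd) :
    (ruleFormula args body).Uses P Q := by
  have hx : ∀ x ∈ body.flatMap Prod.snd,
      (P (opVar x) ∨ ∃ y ∈ body.flatMap Prod.snd, opVar x = opVar y ∨ opVar x = clVar y) ∧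
      (P (clVar x) ∨ ∃ y ∈ body.flatMap Prod.snd, clVar x = opVar y ∨ clVar x = clVar y) :=
    fun x hx => ⟨Or.inr ⟨x, hx, Or.inl rfl⟩, Or.inr ⟨x, hx, Or.inr rfl⟩⟩
  refine uses_foldr_exSpan (uses_foldr_termFormula hbody hx ⟨?_, ?_⟩)
  · simp [Uses, hP]
  · exact uses_argsFormula (Or.inl rfl) hQ fun s hs x hxs =>
      (hx x (hvars s hs hxs)).imp Or.inr Or.inr

theorem uses_foldr {P Q : ℕ → Prop} {β : Type} {f : β → MSO α Unit → MSO α Unit} {l : List β}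
    {φ : MSO α Unit} (hφ : φ.Uses P Q) (hf : ∀ b ∈ l, ∀ ψ, ψ.Uses P Q → (f b ψ).Uses P Q) :
    (l.foldr f φ).Uses P Q := by
  induction l with
  | nil => exact hφ
  | cons b l ih => exact hf b (by simp) _ (ih fun c hc => hf c (by simp [hc]))

theorem uses_innerFormula {P Q : ℕ → Prop} (letters : List α) (G : MCFG α N X) (hQ : Q 1)
    (hQ' : ∀ p ∈ G.nonterminals, Q (colVar p.1)) : (innerFormula letters G).Uses P Q := by
  refine ⟨?_, ?_, ?_, ?_⟩
  · simp [functionalFormula, Uses]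
  · refine uses_foldr (by simp [Uses]) fun a _ ψ hψ => ⟨?_, hψ⟩
    simp [Uses]
  · have := hQ' _ G.start_mem
    simp [startFormula, Uses, hQ, this]
  · refine uses_foldr (by simp [Uses]) fun p hp ψ hψ => ⟨⟨?_, ?_⟩, hψ⟩
    · exact ⟨Or.inl rfl, hQ' p hp⟩
    · refine uses_foldr (by simp) fun ρ hρ ψ hψ => ?_
      unfold choiceFormula
      split_ifs
      · exact ⟨uses_ruleFormula (Or.inl rfl) hQ (fun t ht => hQ' _ (G.body_mem ρ hρ t ht))
          (G.filterMap_var_subset hρ), hψ⟩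
      · exact hψ

theorem uses_foldr_exColour {P : ℕ → Prop} {l : List (N × ℕ)} {ψ : MSO α Unit} :
    ∀ {Q : ℕ → Prop}, (∀ Q' : ℕ → Prop, (∀ n, Q n → Q' n) → (∀ p ∈ l, Q' (colVar p.1)) →
      ψ.Uses P Q') → (l.foldr exColour ψ).Uses P Q := by
  induction l with
  | nil => exact fun h => h _ (fun _ => id) (by simp)
  | cons p l ih =>
    refine fun h => ih fun Q' h₁ h₂ => h Q' (fun n hn => h₁ n (Or.inr hn)) ?_
    simpa using ⟨h₁ _ (Or.inl rfl), fun a b => h₂ (a, b)⟩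

theorem isSentence_grammarFormula (letters : List α) (G : MCFG α N X) :
    (grammarFormula letters G).IsSentence := by
  refine Uses.isSentence (uses_foldr_exColour fun Q' _ h => ?_)
  exact uses_innerFormula letters G (Or.inl rfl) fun p hp => Or.inr (h p hp)

/-! ### Satisfaction of the formula of a grammar -/

section Sat

variable {H : LoGraph α Unit} {v : ℕ → Option H.V} {σ : ℕ → Set H.V}

theorem sat_functionalFormula : Sat H functionalFormula v σ ↔
    ∀ x y z, H.edge () x y → H.edge () x z → y = z := by
  have h (x y z : H.V) := sat_eqv (G := H) (σ := σ) (x := 1) (y := 2) (a := y) (b := z)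
    (v := Function.update (Function.update (Function.update v 0 (some x)) 1 (some y)) 2 (some z))
    (by simp) (by simp)
  simp only [functionalFormula, sat_neg, sat_ex, sat_and, h, not_exists, not_and, not_not]
  simp [Sat]

theorem sat_unlabelled {letters : List α} :
    Sat H (letters.foldr unlabelledFormula (neg falsum)) v σ ↔
      ∀ a ∈ letters, ∀ x y, H.edge () x y → H.label x ≠ some a ∧ H.label y ≠ some a := by
  induction letters with
  | nil => simp [Sat]
  | cons a l ih =>
    rw [List.foldr_cons, unlabelledFormula, sat_and, ih]
    simp [Sat]

theorem sat_startFormula {A : N} : Sat H (startFormula A) v σ ↔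
    ∃ h o c, (h ∈ σ (colVar A) ∧ H.edge () h o ∧ H.edge () o c) ∧ o < c ∧ o ∉ σ 1 ∧
      (∀ u, ¬ H.Succ u o) ∧ ∀ u, ¬ H.Succ c u := by
  have h (x y z : H.V) := sat_lt (G := H) (σ := σ) (x := 1) (y := 2) (a := y) (b := z)
    (v := Function.update (Function.update (Function.update v 4 (some x)) 1 (some y)) 2 (some z))
    (by simp) (by simp) (by decide) (by decide)
  simp only [startFormula, sat_neg, sat_ex, sat_and, h]
  simp [Sat, and_assoc]

theorem sat_choice {A : N} {rules : List (Production α N X)} :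
    Sat H (rules.foldr (choiceFormula A) falsum) v σ ↔
      ∃ ρ ∈ rules, ρ.head = A ∧ Sat H (ruleFormula ρ.args ρ.body) v σ := by
  induction rules with
  | nil => simp
  | cons ρ l ih =>
    rw [List.foldr_cons, choiceFormula, List.exists_mem_cons_iff, ← ih]
    split_ifs with h
    · simp [h, sat_or]
    · simp [h]

theorem sat_nonterminals {G : MCFG α N X} {l : List (N × ℕ)} :
    Sat H (l.foldr (nonterminalFormula G.rules) (neg falsum)) v σ ↔
      ∀ p ∈ l, ∀ h ∈ σ (colVar p.1), ∃ ρ ∈ G.rules, ρ.head = p.1 ∧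
        (relations H σ).Applies ρ.args ρ.body h := by
  induction l with
  | nil => simp [sat_neg]
  | cons p l ih =>
    rw [List.foldr_cons, nonterminalFormula, sat_and, ih, List.forall_mem_cons]
    refine and_congr ?_ Iff.rfl
    have (h : H.V) : Sat H (mem 4 (colVar p.1)) (Function.update v 4 (some h)) σ ↔
        h ∈ σ (colVar p.1) := sat_mem (by simp)
    simp only [sat_neg, sat_ex, sat_and, this, sat_choice, not_exists, not_and]
    refine forall₂_congr fun h _ => ?_
    push Not
    refine exists_congr fun ρ => and_congr_right fun hρ => and_congr Iff.rfl ?_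
    rw [sat_ruleFormula (h := h) (by simp) (G.filterMap_var_subset hρ)]

/-- The colours `σ` witness that the graph represents a derivation of the grammar. -/
structure Represents (H : LoGraph α Unit) (G : MCFG α N X) (σ : ℕ → Set H.V) : Prop where
  edge_unique : ∀ x y z, H.edge () x y → H.edge () x z → y = z
  unlabelled : ∀ x y, H.edge () x y → H.label x = none ∧ H.label y = none
  start : ∃ h o c, (h ∈ σ (colVar G.start) ∧ H.edge () h o ∧ H.edge () o c) ∧ o < c ∧ o ∉ σ 1 ∧
      (∀ u, ¬ H.Succ u o) ∧ ∀ u, ¬ H.Succ c u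
  applies : ∀ p ∈ G.nonterminals, ∀ h ∈ σ (colVar p.1), ∃ ρ ∈ G.rules, ρ.head = p.1 ∧
        (relations H σ).Applies ρ.args ρ.body h

/-- The list must contain all letters: only then does carrying none of them mean being unlabelled.
-/
theorem sat_innerFormula {letters : List α} (hl : ∀ a, a ∈ letters) {G : MCFG α N X} :
    Sat H (innerFormula letters G) v σ ↔ Represents H G σ := by
  rw [innerFormula, sat_and, sat_and, sat_and, sat_functionalFormula, sat_unlabelled,
    sat_startFormula, sat_nonterminals]
  constructor
  · rintro ⟨h₁, h₂, h₃, h₄⟩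
    refine ⟨h₁, fun x y hxy => ?_, h₃, h₄⟩
    simp only [Option.eq_none_iff_forall_ne_some]
    exact ⟨fun a => (h₂ a (hl a) x y hxy).1, fun a => (h₂ a (hl a) x y hxy).2⟩
  · rintro ⟨h₁, h₂, h₃, h₄⟩
    refine ⟨h₁, fun a _ x y hxy => ?_, h₃, h₄⟩
    simp [h₂ x y hxy]

theorem exists_of_sat_exColour {l : List (N × ℕ)} {ψ : MSO α Unit} : ∀ {σ : ℕ → Set H.V},
    Sat H (l.foldr exColour ψ) v σ → ∃ σ', Sat H ψ v σ' := by
  induction l with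
  | nil => exact fun h => ⟨_, h⟩
  | cons p l ih =>
    rintro σ ⟨A, h⟩
    exact ih h

theorem sat_exColour_of_sat {l : List (N × ℕ)} {ψ : MSO α Unit} {σ' : ℕ → Set H.V} :
    ∀ {σ : ℕ → Set H.V}, Sat H ψ v (fun n => if ∃ p ∈ l, colVar p.1 = n then σ' n else σ n) →
      Sat H (l.foldr exColour ψ) v σ := by
  induction l with
  | nil => exact fun h => by simpa using h
  | cons p l ih =>
    intro σ h
    refine ⟨σ' (colVar p.1), ih ?_⟩
    convert h using 2 with n
    by_cases hn : colVar p.1 = n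
    · subst hn
      simp
    · simp only [List.exists_mem_cons_iff, hn, false_or, Function.update_of_ne (Ne.symm hn)]

theorem exists_represents_of_models {letters : List α} (hl : ∀ a, a ∈ letters) {G : MCFG α N X}
    (h : Models H (grammarFormula letters G)) : ∃ σ, Represents H G σ := by
  obtain ⟨σ, A, h⟩ := exists_of_sat_exColour h
  exact ⟨_, (sat_innerFormula hl).1 h⟩

/-- Satisfaction of a sentence starts from the empty assignment, so the witness has to be empty at
all set variables that are not quantified. -/
theorem models_of_represents {letters : List α} (hl : ∀ a, a ∈ letters) {G : MCFG α N X}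
    (hσ : ∀ n, n ≠ 1 → (∀ p ∈ G.nonterminals, colVar p.1 ≠ n) → σ n = ∅)
    (h : Represents H G σ) : Models H (grammarFormula letters G) := by
  refine sat_exColour_of_sat (σ' := σ) ⟨σ 1, ?_⟩
  convert (sat_innerFormula hl).2 h using 1
  funext n
  by_cases h1 : n = 1
  · subst h1
    simp
  · rw [Function.update_of_ne h1]
    split_ifs with hp
    · rfl
    · exact (hσ n h1 fun p hp' hn => hp ⟨p, hp', hn⟩).symm

/-- In a finite linear order a vertex without predecessor is the least one and a vertex without
successor the greatest one, so the start span covers the whole graph. No bound on the treewidth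
enters. -/
theorem Represents.word_mem {G : MCFG α N X} (h : Represents H G σ) : H.word ∈ G.language := by
  obtain ⟨u, o, c, ⟨hu, ho, hc⟩, hoc, hsil, hmin, hmax⟩ := h.start
  let _ : LocallyFiniteOrder H.V := Fintype.toLocallyFiniteOrder
  have hS : (relations (N := N) H σ).Compatible H.label :=
    ⟨fun _ _ h => h, fun _ _ h => h, fun _ _ h => h, h.edge_unique,
      fun x y hxy => (h.unlabelled x y hxy).1, fun x y hxy => (h.unlabelled x y hxy).2⟩
  refine Relations.mem_language_of_chain hS G
    (fun A x hx ⟨n, hn⟩ => h.applies (A, n) hn x hx) hu ho hc hoc hsil (fun v => ?_) fun v => ?_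
  · by_contra hv
    obtain ⟨x, -, hx⟩ := Relation.TransGen.tail'_iff.1 (lt_iff_transGen_covBy.1 (not_le.1 hv))
    exact hmin x hx
  · by_contra hv
    obtain ⟨x, hx, -⟩ := Relation.TransGen.head'_iff.1 (lt_iff_transGen_covBy.1 (not_le.1 hv))
    exact hmax x hx

end Sat

end MSO

/-! ### Effectivity -/

namespace MSO

variable {α N X : Type} [Primcodable α] [Primcodable N] [Primcodable X]

theorem code_and (φ ψ : MSO α Unit) :
    (and φ ψ).code = 4 :: 5 :: 4 :: (φ.code ++ 4 :: ψ.code) := by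
  simp [and, code]

/-- If a block contributes a prefix that does not depend on the remaining formula, a fold of blocks
is written as a concatenation. All blocks of the sentence have this form. -/
theorem code_foldr {β : Type} {f : β → MSO α Unit → MSO α Unit} {c : β → List ℕ}
    (h : ∀ b ψ, (f b ψ).code = c b ++ ψ.code) (l : List β) (φ : MSO α Unit) :
    (l.foldr f φ).code = l.flatMap c ++ φ.code := by
  induction l with
  | nil => rfl
  | cons b l ih => rw [List.foldr_cons, h, ih, List.flatMap_cons, List.append_assoc]

/-- The written form of `spanFormula` up to its last argument. -/
def spanCode (b : Bool) (x : X) : List ℕ :=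
  4 :: 5 :: 4 :: 2 :: 0 :: opVar x :: 4 :: 4 :: 5 :: 4 ::
    ((if b then [1, opVar x, 1] else [4, 1, opVar x, 1]) ++
      4 :: 6 :: 0 :: 4 :: 5 :: 4 :: ((eqv 0 (clVar x) : MSO Unit Unit).code ++ [4]))

/-- The written form of `tokenFormula` for a letter up to its last argument. -/
def letterCode (b : Bool) (a : α) : List ℕ :=
  if b then [] else 6 :: 5 :: 4 :: 5 :: 4 :: 2 :: 0 :: 5 :: 4 :: 4 :: 5 :: 4 :: 0 ::
    Encodable.encode a :: 5 :: 4 :: 6 :: 0 :: 4 :: 5 :: 4 ::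
      ((eqv 0 5 : MSO Unit Unit).code ++ [4])

/-- The written form of `tokenFormula` up to its last argument. -/
def tokenCode (b : Bool) (t : Token α X) : List ℕ :=
  Sum.casesOn t (fun s => Sum.casesOn s (letterCode b) (spanCode b)) (spanCode true)

/-- The written form of `pathFormula`. -/
def pathCode (b : Bool) (s : List (Token α X)) : List ℕ := s.flatMap (tokenCode b) ++ [2, 0, 1]

/-- The written form of `argFormula` up to its last argument. -/
def argCode (s : List (Token α X)) : List ℕ :=
  [6, 2, 4, 5, 4, 3, 0, 1, 2, 4, 6, 1, 4, 5, 4, 3, 0, 2, 1, 4, 4, 5, 4, 5, 4, 5, 4, 4, 1, 2, 1, 4,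
    6, 0, 4, 5, 4] ++ (eqv 0 2 : MSO Unit Unit).code ++ 4 :: (pathCode false s ++
    [4, 5, 4, 1, 2, 1, 4, 6, 0, 4, 5, 4] ++ (eqv 0 2 : MSO Unit Unit).code ++
    4 :: (pathCode true s ++ [4]))

/-- The written form of `linkFormula` up to its last argument. -/
def linkCode (x : X) : List ℕ :=
  4 :: 5 :: 4 :: 3 :: 0 :: 1 :: opVar x :: 4 :: 4 :: 5 :: 4 :: 3 :: 0 :: opVar x :: clVar x ::
    4 :: 4 :: 5 :: 4 :: ((lt (opVar x) (clVar x) : MSO Unit Unit).code ++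
      4 :: 6 :: 1 :: 4 :: 5 :: 4 :: ((eqv 1 (clVar x) : MSO Unit Unit).code ++ [4]))

/-- The written form of `termFormula` up to its last argument. -/
def termCode (t : N × List X) : List ℕ :=
  4 :: 5 :: 4 :: 6 :: 1 :: 4 :: 5 :: 4 :: 1 :: 1 :: colVar t.1 :: 4 ::
    (t.2.flatMap linkCode ++ (neg falsum : MSO Unit Unit).code ++ [4])

/-- The written form of `ruleFormula`. -/
def ruleCode [DecidableEq X] (d : List (List (α ⊕ X)) × List (N × List X)) : List ℕ :=
  (d.2.flatMap Prod.snd).flatMap (fun x => [6, opVar x, 6, clVar x]) ++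
    (d.2.flatMap termCode ++ (6 :: 1 :: 4 :: 5 :: 4 :: ((eqv 1 4 : MSO Unit Unit).code ++ 4 ::
      ((Production.tokens d.1 d.2).flatMap argCode ++ (neg falsum : MSO Unit Unit).code))))

/-- No letter occurs in this formula, so its written form is the same over every alphabet. -/
theorem code_eqv (x y : ℕ) : (eqv x y : MSO α Unit).code = (eqv x y : MSO Unit Unit).code := rfl

theorem code_lt (x y : ℕ) : (lt x y : MSO α Unit).code = (lt x y : MSO Unit Unit).code := rfl

theorem code_neg_falsum :
    (neg falsum : MSO α Unit).code = (neg falsum : MSO Unit Unit).code := rfl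

theorem code_spanFormula (b : Bool) (x : X) (ψ : MSO α Unit) :
    (spanFormula b x ψ).code = spanCode b x ++ ψ.code := by
  cases b <;> simp [spanFormula, spanCode, code, code_and, code_eqv]

theorem code_tokenFormula (b : Bool) (t : Token α X) (ψ : MSO α Unit) :
    (tokenFormula b t ψ).code = tokenCode b t ++ ψ.code := by
  rcases t with (a | x) | x
  · cases b <;> simp [tokenFormula, tokenCode, letterCode, code, code_and, code_eqv]
  · exact code_spanFormula b x ψ
  · exact code_spanFormula true x ψ

theorem code_pathFormula (b : Bool) (s : List (Token α X)) :
    (pathFormula b s).code = pathCode b s :=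
  code_foldr (code_tokenFormula b) s _

theorem code_argFormula (s : List (Token α X)) (ψ : MSO α Unit) :
    (argFormula s ψ).code = argCode s ++ ψ.code := by
  simp [argFormula, argCode, code, code_and, code_eqv, code_pathFormula]

theorem code_linkFormula (x : X) (ψ : MSO α Unit) :
    (linkFormula x ψ).code = linkCode x ++ ψ.code := by
  simp [linkFormula, linkCode, code, code_and, code_eqv, code_lt]

theorem code_termFormula (t : N × List X) (ψ : MSO α Unit) :
    (termFormula t ψ).code = termCode t ++ ψ.code := by
  simp [termFormula, termCode, code, code_and, chainFormula, code_foldr code_linkFormula, falsum]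

theorem code_ruleFormula [DecidableEq X] (args : List (List (α ⊕ X)))
    (body : List (N × List X)) :
    (ruleFormula args body).code = ruleCode (args, body) := by
  rw [ruleFormula, code_foldr (c := fun x => [6, opVar x, 6, clVar x]) (fun _ _ => rfl),
    code_foldr code_termFormula, code, code_and, code_eqv, argsFormula,
    code_foldr code_argFormula]
  rfl

variable [DecidableEq N] [DecidableEq X]

/-- The written form of `choiceFormula` up to its last argument. -/
def choiceCode (A : N) (ρ : N × List (List (α ⊕ X)) × List (N × List X)) : List ℕ :=
  if ρ.1 = A then 5 :: ruleCode ρ.2 else []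

/-- The written form of `nonterminalFormula` up to its last argument. -/
def nonterminalCode (rules : List (N × List (List (α ⊕ X)) × List (N × List X))) (p : N × ℕ) :
    List ℕ :=
  4 :: 5 :: 4 :: 4 :: 6 :: 4 :: 4 :: 5 :: 4 :: 1 :: 4 :: colVar p.1 :: 4 :: 4 ::
    (rules.flatMap (choiceCode p.1) ++ (falsum : MSO Unit Unit).code ++ [4])

/-- The written form of `startFormula`. -/
def startCode (A : N) : List ℕ :=
  6 :: 4 :: 4 :: 5 :: 4 :: 1 :: 4 :: colVar A :: 4 :: (ex 1 (and (edge () 4 1) (ex 2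
    (and (edge () 1 2) (and (lt 1 2) (and (neg (mem 1 1)) (and (neg (ex 0 (succ 0 1)))
      (neg (ex 0 (succ 2 0))))))))) : MSO Unit Unit).code

/-- The written form of `grammarFormula`. -/
def grammarCode (letters : List α) (d : MCFG.Data α N X) : List ℕ :=
  d.1.flatMap (fun p => [7, colVar p.1]) ++ 7 :: 1 :: 4 :: 5 :: 4 ::
    ((functionalFormula : MSO α Unit).code ++ 4 :: 4 :: 5 :: 4 ::
      ((letters.foldr unlabelledFormula (neg falsum)).code ++ 4 :: 4 :: 5 :: 4 ::
        (startCode d.2.1 ++ 4 :: (d.1.flatMap (nonterminalCode d.2.2) ++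
          (neg falsum : MSO Unit Unit).code))))

theorem code_choiceFormula (A : N) (ρ : Production α N X) (ψ : MSO α Unit) :
    (choiceFormula A ρ ψ).code = choiceCode A (ρ.head, ρ.args, ρ.body) ++ ψ.code := by
  unfold choiceFormula choiceCode
  split_ifs <;> simp [code, code_ruleFormula]

theorem code_nonterminalFormula (rules : List (Production α N X)) (p : N × ℕ) (ψ : MSO α Unit) :
    (nonterminalFormula rules p ψ).code =
      nonterminalCode (rules.map fun ρ => (ρ.head, ρ.args, ρ.body)) p ++ ψ.code := by
  simp [nonterminalFormula, nonterminalCode, code, code_and, code_foldr (code_choiceFormula p.1),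
    List.flatMap_map, falsum]

theorem code_grammarFormula (letters : List α) (G : MCFG α N X) :
    (grammarFormula letters G).code = grammarCode letters G.data := by
  rw [grammarFormula, code_foldr (c := fun p => [7, colVar p.1]) (fun _ _ => rfl), code,
    innerFormula, code_and, code_and, code_and, code_foldr (code_nonterminalFormula G.rules)]
  rfl

/-! ### Primitive recursiveness of the written forms -/

theorem primrec_opVar : Primrec (opVar : X → ℕ) :=
  Primrec.nat_add.comp (Primrec.nat_mul.comp (Primrec.const 2) Primrec.encode) (Primrec.const 10)

theorem primrec_clVar : Primrec (clVar : X → ℕ) :=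
  Primrec.nat_add.comp (Primrec.nat_mul.comp (Primrec.const 2) Primrec.encode) (Primrec.const 11)

theorem primrec_colVar : Primrec (colVar : N → ℕ) :=
  Primrec.nat_add.comp Primrec.encode (Primrec.const 2)

theorem primrec_cons {β : Type} [Primcodable β] {f : β → ℕ} {g : β → List ℕ} (hf : Primrec f)
    (hg : Primrec g) : Primrec fun b => f b :: g b :=
  Primrec.list_cons.comp hf hg

theorem primrec_cons_const {β : Type} [Primcodable β] {n : ℕ} {g : β → List ℕ}
    (hg : Primrec g) : Primrec fun b => n :: g b :=
  Primrec.list_cons.comp (Primrec.const n) hg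

theorem primrec_append {β : Type} [Primcodable β] {f g : β → List ℕ} (hf : Primrec f)
    (hg : Primrec g) : Primrec fun b => f b ++ g b :=
  Primrec.list_append.comp hf hg

theorem primrec_spanCode (b : Bool) : Primrec (spanCode b : X → List ℕ) := by
  have h₁ := primrec_opVar (X := X)
  have h₂ := primrec_clVar (X := X)
  unfold spanCode
  cases b <;> simp only [eqv, and, code, List.cons_append, List.nil_append, Bool.false_eq_true,
    if_true, if_false] <;>
  repeat first
    | exact Primrec.const _
    | apply primrec_cons_const
    | apply primrec_cons h₁
    | apply primrec_cons h₂

theorem primrec_linkCode : Primrec (linkCode : X → List ℕ) := by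
  have h₁ := primrec_opVar (X := X)
  have h₂ := primrec_clVar (X := X)
  unfold linkCode
  simp only [eqv, lt, le, and, code, List.cons_append, List.nil_append]
  repeat first
    | exact Primrec.const _
    | apply primrec_cons_const
    | apply primrec_cons h₁
    | apply primrec_cons h₂

theorem primrec_letterCode (b : Bool) : Primrec (letterCode b : α → List ℕ) := by
  cases b
  · show Primrec fun a : α => 6 :: _
    iterate 13 apply primrec_cons_const
    exact primrec_cons Primrec.encode (Primrec.const _)
  · exact Primrec.const _

theorem primrec_tokenCode (b : Bool) : Primrec (tokenCode b : Token α X → List ℕ) := by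
  have h : Primrec fun s : α ⊕ X => (Sum.casesOn s (letterCode b) (spanCode b) : List ℕ) :=
    Primrec.sumCasesOn Primrec.id ((primrec_letterCode b).comp Primrec.snd).to₂
      ((primrec_spanCode b).comp Primrec.snd).to₂
  exact Primrec.sumCasesOn Primrec.id (h.comp Primrec.snd).to₂
    ((primrec_spanCode true).comp Primrec.snd).to₂

theorem primrec_pathCode (b : Bool) : Primrec (pathCode b : List (Token α X) → List ℕ) :=
  primrec_append (Primrec.list_flatMap Primrec.id ((primrec_tokenCode b).comp Primrec.snd).to₂)
    (Primrec.const _)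

theorem primrec_argCode : Primrec (argCode : List (Token α X) → List ℕ) :=
  primrec_append (Primrec.const _) (primrec_cons_const (primrec_append (primrec_append
    (primrec_append (primrec_pathCode false) (Primrec.const _)) (Primrec.const _))
      (primrec_cons_const (primrec_append (primrec_pathCode true) (Primrec.const _)))))

theorem primrec_termCode : Primrec (termCode : N × List X → List ℕ) := by
  unfold termCode
  iterate 10 apply primrec_cons_const
  exact primrec_cons (primrec_colVar.comp Primrec.fst) (primrec_cons_const (primrec_append
    (primrec_append (Primrec.list_flatMap Primrec.snd (primrec_linkCode.comp Primrec.snd).to₂)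
      (Primrec.const _)) (Primrec.const _)))

theorem primrec_dropped : Primrec₂
    (Production.dropped : List (List (α ⊕ X)) → List (N × List X) → List X) := by
  have hmem : PrimrecRel fun (x : X) (l : List X) => x ∉ l :=
    PrimrecRel.not (PrimrecPred.of_eq ((PrimrecRel.exists_mem_list Primrec.eq).comp
      Primrec.snd Primrec.fst) fun p => by simp)
  have hvar : Primrec (Sum.getRight? : α ⊕ X → Option X) :=
    (Primrec.sumCasesOn Primrec.id ((Primrec.const none).to₂ : Primrec₂ fun _ (_ : α) => none)
      (Primrec.option_some.comp Primrec.snd).to₂).of_eq fun s => by cases s <;> rfl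
  exact (PrimrecRel.listFilter hmem).comp
    (Primrec.list_flatMap Primrec.snd (Primrec.snd.comp Primrec.snd).to₂)
    (Primrec.listFilterMap (Primrec.list_flatten.comp Primrec.fst) (hvar.comp Primrec.snd).to₂)

theorem primrec_tokens : Primrec₂
    (Production.tokens : List (List (α ⊕ X)) → List (N × List X) → List (List (Token α X))) := by
  have h : Primrec₂ fun (l : List X) (s : List (Token α X)) => l.map Sum.inr ++ s :=
    Primrec.list_append.comp (Primrec.list_map Primrec.fst (Primrec.sumInr.comp Primrec.snd).to₂)
      Primrec.snd
  exact (Primrec.list_modifyHead' h).comp (Primrec.list_map Primrec.fst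
    (Primrec.list_map Primrec.snd (Primrec.sumInl.comp Primrec.snd).to₂).to₂) primrec_dropped

theorem primrec_ruleCode :
    Primrec (ruleCode : List (List (α ⊕ X)) × List (N × List X) → List ℕ) := by
  refine primrec_append (Primrec.list_flatMap
    (Primrec.list_flatMap Primrec.snd (Primrec.snd.comp Primrec.snd).to₂) ?_)
    (primrec_append (Primrec.list_flatMap Primrec.snd (primrec_termCode.comp Primrec.snd).to₂) ?_)
  · have h : Primrec fun x : X => [6, opVar x, 6, clVar x] :=
      primrec_cons_const (primrec_cons primrec_opVar (primrec_cons_const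
        (primrec_cons primrec_clVar (Primrec.const _))))
    exact (h.comp Primrec.snd).to₂
  · iterate 5 apply primrec_cons_const
    exact primrec_append (Primrec.const _) (primrec_cons_const (primrec_append
      (Primrec.list_flatMap (primrec_tokens.comp Primrec.fst Primrec.snd)
        (primrec_argCode.comp Primrec.snd).to₂) (Primrec.const _)))

theorem primrec_choiceCode : Primrec₂ (choiceCode :
    N → N × List (List (α ⊕ X)) × List (N × List X) → List ℕ) :=
  Primrec.ite (Primrec.eq.comp (Primrec.fst.comp Primrec.snd) Primrec.fst)
    (primrec_cons_const (primrec_ruleCode.comp (Primrec.snd.comp Primrec.snd))) (Primrec.const [])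

theorem primrec_nonterminalCode : Primrec₂ (nonterminalCode :
    List (N × List (List (α ⊕ X)) × List (N × List X)) → N × ℕ → List ℕ) := by
  unfold nonterminalCode
  iterate 11 apply primrec_cons_const
  exact primrec_cons (primrec_colVar.comp (Primrec.fst.comp Primrec.snd))
    (primrec_cons_const (primrec_cons_const (primrec_append (primrec_append
      (Primrec.list_flatMap Primrec.fst (primrec_choiceCode.comp
        (Primrec.fst.comp (Primrec.snd.comp Primrec.fst)) Primrec.snd).to₂)
      (Primrec.const _)) (Primrec.const _))))

theorem primrec_startCode : Primrec (startCode : N → List ℕ) := by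
  unfold startCode
  iterate 7 apply primrec_cons_const
  exact primrec_cons primrec_colVar (Primrec.const _)

/-- The alphabet is fixed, so the conjunction over its letters is a constant; only the parts for
colours, start symbol and productions depend on the grammar. -/
theorem primrec_grammarCode (letters : List α) :
    Primrec (grammarCode letters : MCFG.Data α N X → List ℕ) := by
  have h : Primrec fun p : N × ℕ => [7, colVar p.1] :=
    primrec_cons_const (primrec_cons (primrec_colVar.comp Primrec.fst) (Primrec.const _))
  refine primrec_append (Primrec.list_flatMap Primrec.fst (h.comp Primrec.snd).to₂) ?_
  iterate 5 apply primrec_cons_const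
  refine primrec_append (Primrec.const _) ?_
  iterate 4 apply primrec_cons_const
  refine primrec_append (Primrec.const _) ?_
  iterate 4 apply primrec_cons_const
  exact primrec_append (primrec_startCode.comp (Primrec.fst.comp Primrec.snd))
    (primrec_cons_const (primrec_append (Primrec.list_flatMap Primrec.fst
      (primrec_nonterminalCode.comp (Primrec.snd.comp (Primrec.snd.comp Primrec.fst))
        Primrec.snd).to₂) (Primrec.const _)))

theorem isEffective_grammarFormula (letters : List α) :
    MCFG.IsEffective (grammarFormula letters : MCFG α N X → MSO α Unit) :=
  ⟨_, (primrec_grammarCode letters).to_comp, fun G => (code_grammarFormula letters G).symm⟩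

end MSO

/-! ### Special tree decompositions by lists -/

/-- A special tree decomposition of some of the elements of `V`, with bags of size at most `k`. -/
structure Decomp (V : Type) (k : ℕ) where
  T : Type
  [finite : Finite T]
  root : T
  parent : T → T
  parent_root : parent root = root
  reaches_root : ∀ t, ∃ n : ℕ, parent^[n] t = root
  bag : T → List V
  length_le : ∀ t, (bag t).length ≤ k
  -- The root is its own parent. Demanding that the root is not met before step `n` makes `n` the
  -- exact length of the climb, so that it can be prolonged once a new root is added.
  path : ∀ v, (∃ t, v ∈ bag t) → ∃ t, ∃ n : ℕ, (∀ i < n, parent^[i] t ≠ root) ∧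
    ∀ s, v ∈ bag s ↔ ∃ i ≤ n, parent^[i] t = s

namespace Decomp

variable {V W ι : Type} {k : ℕ}

/-- The element lies in some bag. -/
def Covers (D : Decomp V k) (v : V) : Prop := ∃ t, v ∈ D.bag t

/-- The elements lie in a common bag. -/
def Joins (D : Decomp V k) (u v : V) : Prop := ∃ t, u ∈ D.bag t ∧ v ∈ D.bag t

/-- The decomposition of the images under an injective map. -/
def map (D : Decomp V k) (f : V → W) (hf : Function.Injective f) : Decomp W k where
  T := D.T
  finite := D.finite
  root := D.root
  parent := D.parent
  parent_root := D.parent_root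
  reaches_root := D.reaches_root
  bag t := (D.bag t).map f
  length_le t := by simpa using D.length_le t
  path := by
    rintro v ⟨t, ht⟩
    obtain ⟨w, hw, rfl⟩ := List.mem_map.1 ht
    simpa [List.mem_map_of_injective hf] using D.path w ⟨t, hw⟩

open Classical in
/-- The parent map of the tree that joins several trees under a new root. -/
noncomputable def joinParent (D : ι → Decomp V k) :
    Option (Σ i, (D i).T) → Option (Σ i, (D i).T)
  | none => none
  | some ⟨i, t⟩ => if t = (D i).root then none else some ⟨i, (D i).parent t⟩

/-- Until the climb leaves the old root it stays in its own tree. The old root is excluded only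
before step `m`, so step `m` may be the one that reaches it. -/
theorem joinParent_iterate (D : ι → Decomp V k) {i : ι} {t : (D i).T} {m : ℕ}
    (h : ∀ j < m, (D i).parent^[j] t ≠ (D i).root) :
    (joinParent D)^[m] (some ⟨i, t⟩) = some ⟨i, (D i).parent^[m] t⟩ := by
  induction m with
  | zero => rfl
  | succ m ih =>
    rw [Function.iterate_succ_apply', Function.iterate_succ_apply', ih fun j hj => h j (by omega),
      joinParent, if_neg (h m (by omega))]

theorem joinParent_root (D : ι → Decomp V k) (i : ι) :
    joinParent D (some ⟨i, (D i).root⟩) = none := by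
  rw [joinParent, if_pos rfl]

/-- Decompositions of disjoint sets are joined under a new root. -/
noncomputable def join [Finite ι] (D : ι → Decomp V k) (R : List V) (hR : R.length ≤ k)
    (disjoint : ∀ i j v, (D i).Covers v → (D j).Covers v → i = j)
    (mem_root : ∀ i, ∀ v ∈ R, (D i).Covers v → v ∈ (D i).bag (D i).root) : Decomp V k where
  T := Option (Σ i, (D i).T)
  finite := by
    have := fun i => (D i).finite
    infer_instance
  root := none
  parent := joinParent D
  parent_root := rfl
  reaches_root := by
    rintro (_ | ⟨i, t⟩)
    · exact ⟨0, rfl⟩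
    · classical
      -- The first visit to the old root, and one more step to the new one.
      refine ⟨Nat.find ((D i).reaches_root t) + 1, ?_⟩
      rw [Function.iterate_succ_apply', joinParent_iterate D fun j hj => Nat.find_min _ hj,
        Nat.find_spec ((D i).reaches_root t), joinParent_root]
  bag
    | none => R
    | some ⟨i, t⟩ => (D i).bag t
  length_le := by
    rintro (_ | ⟨i, t⟩)
    · exact hR
    · exact (D i).length_le t
  path := by
    intro v hv
    by_cases h : ∃ i, (D i).Covers v
    · obtain ⟨i, hi⟩ := h
      obtain ⟨t, n, hn, ht⟩ := (D i).path v hi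
      have hit : ∀ m ≤ n, (joinParent D)^[m] (some ⟨i, t⟩) = some ⟨i, (D i).parent^[m] t⟩ :=
        fun m hm => joinParent_iterate D fun j hj => hn j (by omega)
      by_cases hvR : v ∈ R
      · obtain ⟨m, hm, hroot⟩ := (ht _).1 (mem_root i v hvR hi)
        -- The old root is met exactly at the end of the path, which can now be prolonged by one
        -- step to the new root.
        obtain rfl : m = n := by
          by_contra hmn
          exact hn m (by omega) hroot
        have hit' : (joinParent D)^[m + 1] (some ⟨i, t⟩) = none := by
          rw [Function.iterate_succ_apply', hit m le_rfl, hroot, joinParent_root]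
        refine ⟨some ⟨i, t⟩, m + 1, fun j hj => ?_, ?_⟩
        · rw [hit j (by omega)]
          simp
        · rintro (_ | ⟨i', s⟩)
          · exact ⟨fun _ => ⟨m + 1, le_rfl, hit'⟩, fun _ => hvR⟩
          · constructor
            · intro hs
              obtain rfl := disjoint _ _ v hi ⟨s, hs⟩
              obtain ⟨j, hj, hjs⟩ := (ht s).1 hs
              exact ⟨j, by omega, by rw [hit j hj, hjs]⟩
            · rintro ⟨j, hj, hjs⟩
              rcases Nat.lt_or_ge j (m + 1) with hj' | hj'
              · rw [hit j (by omega)] at hjs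
                cases hjs
                exact (ht _).2 ⟨j, by omega, rfl⟩
              · obtain rfl : j = m + 1 := by omega
                rw [hit'] at hjs
                cases hjs
      · refine ⟨some ⟨i, t⟩, n, fun j hj => ?_, ?_⟩
        · rw [hit j hj.le]
          simp
        · rintro (_ | ⟨i', s⟩)
          · refine ⟨fun h => absurd h hvR, ?_⟩
            rintro ⟨j, hj, hjs⟩
            rw [hit j hj] at hjs
            cases hjs
          · constructor
            · intro hs
              obtain rfl := disjoint _ _ v hi ⟨s, hs⟩
              obtain ⟨j, hj, hjs⟩ := (ht s).1 hs
              exact ⟨j, hj, by rw [hit j hj, hjs]⟩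
            · rintro ⟨j, hj, hjs⟩
              rw [hit j hj] at hjs
              cases hjs
              exact (ht _).2 ⟨j, hj, rfl⟩
    · push Not at h
      have hvR : v ∈ R := by
        obtain ⟨_ | ⟨i, t⟩, ht⟩ := hv
        · exact ht
        · exact absurd ⟨t, ht⟩ (h i)
      refine ⟨none, 0, by simp, ?_⟩
      rintro (_ | ⟨i, t⟩)
      · exact ⟨fun _ => ⟨0, le_rfl, rfl⟩, fun _ => hvR⟩
      · refine ⟨fun ht => absurd ⟨t, ht⟩ (h i), ?_⟩
        rintro ⟨j, hj, hjs⟩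
        obtain rfl : j = 0 := by omega
        cases hjs

section join

variable [Finite ι] {D : ι → Decomp V k} {R : List V} {hR : R.length ≤ k}
  {disjoint : ∀ i j v, (D i).Covers v → (D j).Covers v → i = j}
  {mem_root : ∀ i, ∀ v ∈ R, (D i).Covers v → v ∈ (D i).bag (D i).root}

theorem covers_join {v : V} (h : (join D R hR disjoint mem_root).Covers v) :
    v ∈ R ∨ ∃ i, (D i).Covers v := by
  obtain ⟨_ | ⟨i, t⟩, ht⟩ := h
  · exact Or.inl ht
  · exact Or.inr ⟨i, t, ht⟩

theorem Joins.join {i : ι} {u v : V} (h : (D i).Joins u v) :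
    (join D R hR disjoint mem_root).Joins u v := by
  obtain ⟨t, ht⟩ := h
  exact ⟨some ⟨i, t⟩, ht⟩

theorem joins_join_of_mem {u v : V} (hu : u ∈ R) (hv : v ∈ R) :
    (Decomp.join D R hR disjoint mem_root).Joins u v :=
  ⟨none, hu, hv⟩

end join

/-- A list of further elements can be added to a decomposition such that the elements of the root
bag stay in the root bag and neighbours in the list are joined. -/
theorem exists_isChain (D : Decomp V k) {B : List V} (hB : D.bag D.root = B)
    (hk : B.length + 2 ≤ k) : ∀ {ls : List V}, ls.Nodup → (∀ l ∈ ls, D.Covers l → l ∈ B) →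
      ∃ D' : Decomp V k, D'.bag D'.root = B ++ ls.take 2 ∧ (∀ u v, D.Joins u v → D'.Joins u v) ∧
        (∀ v, D'.Covers v → D.Covers v ∨ v ∈ ls) ∧ ls.IsChain D'.Joins
  | [], _, _ => ⟨D, by simp [hB], fun _ _ => id, fun _ => Or.inl, .nil⟩
  | l :: ls, hn, hl => by
    rw [List.nodup_cons] at hn
    obtain ⟨D', h₁, h₂, h₃, h₄⟩ := exists_isChain D hB hk hn.2
      fun l' h' => hl l' (List.mem_cons_of_mem _ h')
    -- The new root bag holds `B` and the first two elements of the list, the bag below it `B` and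
    -- the next pair. So each element outside `B` lies in at most two bags, one above the other.
    have hlen : (B ++ (l :: ls).take 2).length ≤ k := by
      rw [List.length_append]
      have := List.length_take_le 2 (l :: ls)
      omega
    have hmem : ∀ v ∈ B ++ (l :: ls).take 2, D'.Covers v → v ∈ D'.bag D'.root := by
      intro v hv hc
      rw [h₁, List.mem_append]
      rw [List.mem_append, List.take_succ_cons, List.mem_cons] at hv
      rcases hv with hv | rfl | hv
      · exact Or.inl hv
      · rcases h₃ _ hc with h | h
        · exact Or.inl (hl _ List.mem_cons_self h)
        · exact absurd h hn.1
      · exact Or.inr ((List.take_subset_take_left ls (by decide)) hv)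
    refine ⟨join (fun _ : Unit => D') _ hlen (fun _ _ _ _ _ => rfl) fun _ => hmem, rfl,
      fun u v huv => (h₂ u v huv).join (D := fun _ : Unit => D') (i := ()), fun v hv => ?_, ?_⟩
    · rcases covers_join hv with hv | ⟨-, hv⟩
      · rw [List.mem_append] at hv
        rcases hv with hv | hv
        · exact Or.inl ⟨_, hB ▸ hv⟩
        · exact Or.inr (List.mem_of_mem_take hv)
      · exact (h₃ v hv).imp id (List.mem_cons_of_mem _)
    · refine List.isChain_cons.2 ⟨fun y hy => ?_, h₄.imp fun u v huv => huv.join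
        (D := fun _ : Unit => D') (i := ())⟩
      cases ls with
      | nil => simp at hy
      | cons l' ls =>
        obtain rfl : l' = y := by simpa using hy
        exact joins_join_of_mem (by simp) (by simp)

theorem Joins.map {D : Decomp V k} {f : V → W} {hf : Function.Injective f} {u v : V}
    (h : D.Joins u v) : (D.map f hf).Joins (f u) (f v) := by
  obtain ⟨t, hu, hv⟩ := h
  exact ⟨t, List.mem_map_of_mem hu, List.mem_map_of_mem hv⟩

theorem covers_map {D : Decomp V k} {f : V → W} {hf : Function.Injective f} {w : W}
    (h : (D.map f hf).Covers w) : ∃ v, f v = w := by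
  obtain ⟨t, ht⟩ := h
  obtain ⟨v, -, hv⟩ := List.mem_map.1 ht
  exact ⟨v, hv⟩

theorem covers_of_isChain {D : Decomp V k} : ∀ {l : List V} {u : V}, D.Covers u →
    (u :: l).IsChain D.Joins → ∀ v ∈ u :: l, D.Covers v
  | [], u, hu, _ => by simpa using hu
  | w :: l, u, hu, h => by
    rw [List.isChain_cons_cons] at h
    obtain ⟨t, -, hw⟩ := h.1
    intro v hv
    rcases List.mem_cons.1 hv with rfl | hv
    · exact hu
    · exact covers_of_isChain (show D.Covers w from ⟨t, hw⟩) h.2 v hv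

/-- Bags are pulled back along `f`; elements outside its range disappear, and injectivity keeps the
bags small. -/
theorem specialTreewidth_le {α Γ : Type} (H : LoGraph α Γ) (D : Decomp V k) (f : H.V → V)
    (hf : Function.Injective f) (hcov : ∀ v, D.Covers (f v))
    (hadj : ∀ u v, H.Adjacent u v → D.Joins (f u) (f v)) : H.specialTreewidth ≤ k := by
  classical
  have := D.finite
  let _ : Fintype D.T := Fintype.ofFinite D.T
  let E : H.SpecialTreeDecomposition :=
    { T := D.T
      root := D.root
      parent := D.parent
      parent_root := D.parent_root
      reaches_root := D.reaches_root
      bag := fun t => Finset.univ.filter fun v => f v ∈ D.bag t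
      bags_path := fun v => by
        obtain ⟨t, n, -, h⟩ := D.path (f v) (hcov v)
        exact ⟨t, n, fun s => by simpa using h s⟩
      adjacent_bag := fun u v huv => by
        obtain ⟨t, h⟩ := hadj u v huv
        exact ⟨t, by simpa using h⟩ }
  have hE : E.width ≤ k := by
    refine Finset.sup_le fun t _ => ?_
    have h : (E.bag t).image f ⊆ (D.bag t).toFinset := by
      intro v hv
      obtain ⟨u, hu, rfl⟩ := Finset.mem_image.1 hv
      simpa [E] using hu
    calc (E.bag t).card = ((E.bag t).image f).card := (Finset.card_image_of_injective _ hf).symm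
      _ ≤ (D.bag t).toFinset.card := Finset.card_le_card h
      _ ≤ (D.bag t).length := List.toFinset_card_le _
      _ ≤ k := D.length_le t
  have h : E.width ∈ {k | ∃ D : H.SpecialTreeDecomposition, D.width = k} := ⟨E, rfl⟩
  exact (Nat.sInf_le h).trans hE

end Decomp

/-! ### Lists -/

namespace List

variable {α β γ : Type}

theorem eq_of_nodup_filterMap {f : α → Option β} : ∀ {l : List α}, (l.filterMap f).Nodup →
    ∀ {a b : α} {x : β}, a ∈ l → b ∈ l → f a = some x → f b = some x → a = b
  | [], _, _, _, _, ha, _, _, _ => by simp at ha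
  | c :: l, h, a, b, x, ha, hb, hax, hbx => by
    rw [List.mem_cons] at ha hb
    have hmem : ∀ d ∈ l, f d = some x → f c ≠ some x := by
      intro d hd hdx hcx
      rw [List.filterMap_cons_some hcx, List.nodup_cons] at h
      exact h.1 (List.mem_filterMap.2 ⟨d, hd, hdx⟩)
    rcases ha with rfl | ha <;> rcases hb with rfl | hb
    · rfl
    · exact absurd hax (hmem b hb hbx)
    · exact absurd hbx (hmem a ha hax)
    · refine eq_of_nodup_filterMap ?_ ha hb hax hbx
      exact h.sublist ((List.sublist_cons_self c l).filterMap f)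

/-- A chain is tested inside the blocks and at their junctions, and the junctions see only first and
last elements. A block may thus be exchanged for another chain with the same ends, such as a
two-vertex skeleton for the full span. -/
theorem isChain_flatMap_append {R : β → β → Prop} {f g : α → List β} {post : List β} :
    ∀ {l : List α}, (∀ a ∈ l, (f a).IsChain R ∧ (f a).head? = (g a).head? ∧
      (f a).getLast? = (g a).getLast?) → (l.flatMap g ++ post).IsChain R →
      (l.flatMap f ++ post).IsChain R ∧ (l.flatMap f ++ post).head? = (l.flatMap g ++ post).head?
  | [], _, h => ⟨h, rfl⟩
  | a :: l, hl, h => by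
    rw [List.flatMap_cons, List.append_assoc, List.isChain_append] at h
    obtain ⟨h₁, h₂⟩ := isChain_flatMap_append (l := l)
      (fun b hb => hl b (List.mem_cons_of_mem _ hb)) h.2.1
    obtain ⟨h₃, h₄, h₅⟩ := hl a List.mem_cons_self
    rw [List.flatMap_cons, List.flatMap_cons, List.append_assoc, List.append_assoc,
      List.isChain_append, h₂, h₅]
    refine ⟨⟨h₃, h₁, h.2.2⟩, ?_⟩
    simp only [List.head?_append] at h₂ ⊢
    rw [h₄, h₂]

theorem disjoint_of_nodup_flatMap {f : α → List β} {l : List α} (h : (l.flatMap f).Nodup) {a b : α}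
    (ha : a ∈ l) (hb : b ∈ l) (hab : a ≠ b) : List.Disjoint (f a) (f b) := by
  have : Std.Symm (Function.onFun List.Disjoint f) := ⟨fun _ _ h => h.symm⟩
  exact (List.nodup_flatMap.1 h).2.forall ha hb hab

/-- All elements of the lists are numbered consecutively. -/
def number : ℕ → List (List α) → List (List (α × ℕ))
  | _, [] => []
  | k, s :: ss => s.zipIdx k :: number (k + s.length) ss

theorem flatten_number : ∀ (k : ℕ) (ss : List (List α)),
    (number k ss).flatten = ss.flatten.zipIdx k
  | _, [] => rfl
  | k, s :: ss => by
    rw [number, List.flatten_cons, List.flatten_cons, flatten_number, List.zipIdx_append]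

theorem map_number : ∀ (k : ℕ) (ss : List (List α)),
    (number k ss).map (List.map Prod.fst) = ss
  | _, [] => rfl
  | k, s :: ss => by
    rw [number, List.map_cons, map_number, List.zipIdx_map_fst]

theorem length_number : ∀ (k : ℕ) (ss : List (List α)), (number k ss).length = ss.length
  | _, [] => rfl
  | k, s :: ss => by
    rw [number, List.length_cons, List.length_cons, length_number]

end List

/-! ### Spans -/

/-- A span: a nonempty sequence of vertices, from its first to its last vertex. -/
structure Span (V : Type) where
  first : V
  inner : List V
  last : V

namespace Span

variable {V W : Type}

/-- The vertices of a span. -/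
def list (p : Span V) : List V := p.first :: (p.inner ++ [p.last])

/-- The first and the last vertex. -/
def ends (p : Span V) : V × V := (p.first, p.last)

/-- The span of the first and the last vertex only. -/
def skeleton (p : Span V) : Span V := ⟨p.first, [], p.last⟩

/-- The image of a span. -/
def map (f : V → W) (p : Span V) : Span W := ⟨f p.first, p.inner.map f, f p.last⟩

theorem list_map (f : V → W) (p : Span V) : (p.map f).list = p.list.map f := by
  simp [map, list]

theorem skeleton_sublist (p : Span V) : p.skeleton.list.Sublist p.list := by
  simp [skeleton, list]

end Span

/-- The edges, labels, colours and silent vertices of a graph whose edges form a partial function. -/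
structure Frame (α N V : Type) where
  next : V → Option V
  lab : V → Option α
  col : V → Option N
  sil : V → Bool

namespace Frame

variable {α N X V : Type}

/-- The relations of a frame with a successor relation and an order. -/
def rel (F : Frame α N V) (R lt : V → V → Prop) : Relations α N V where
  succ := R
  lt := lt
  edge u v := F.next u = some v
  lab v a := F.lab v = some a
  col A v := F.col v = some A
  sil v := F.sil v = true

end Frame

/-! ### Transport of patterns along maps -/

namespace Relations

variable {α N X V W : Type}

/-- Maps that preserve the relations. -/
structure Hom (S : Relations α N V) (S' : Relations α N W) (f : V → W) : Prop where
  succ : ∀ u v, S.succ u v → S'.succ (f u) (f v)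
  lt : ∀ u v, S.lt u v → S'.lt (f u) (f v)
  edge : ∀ u v, S.edge u v → S'.edge (f u) (f v)
  -- Labels and silence are compared only at vertices reached by a successor step or, for silence,
  -- an edge. The map into the final graph takes arbitrary values elsewhere.
  lab : ∀ u v a, S.succ u v → S.lab v a → S'.lab (f v) a
  col : ∀ A v, S.col A v → S'.col A (f v)
  sil : ∀ u v, S.succ u v ∨ S.edge u v → (S.sil v ↔ S'.sil (f v))

variable {S : Relations α N V} {S' : Relations α N W} {f : V → W}

theorem Path.map (hf : S.Hom S' f) {op cl : X → V} {b : Bool} {q : V} :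
    ∀ {s : List (Token α X)} {p : V}, S.Path op cl b q s p →
      S'.Path (f ∘ op) (f ∘ cl) b (f q) s (f p)
  | [], p, h => hf.succ _ _ h
  | .inl (.inl a) :: s, p, h => by
    cases b with
    | true =>
      simp only [Path, if_true] at h ⊢
      exact Path.map hf h
    | false =>
      simp only [Path, Bool.false_eq_true, if_false] at h ⊢
      obtain ⟨r, h₁, h₂, h₃⟩ := h
      exact ⟨f r, hf.succ _ _ h₁, hf.lab _ _ _ h₁ h₂, Path.map hf h₃⟩
  | .inl (.inr x) :: s, p, h =>
    ⟨hf.succ _ _ h.1, (hf.sil _ _ (.inl h.1)).symm.trans h.2.1, Path.map hf h.2.2⟩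
  | .inr x :: s, p, h => ⟨hf.succ _ _ h.1, (hf.sil _ _ (.inl h.1)).1 h.2.1, Path.map hf h.2.2⟩

theorem Chain.map (hf : S.Hom S' f) : ∀ {P : List (V × V)} {h : V}, S.Chain P h →
    S'.Chain (P.map (Prod.map f f)) (f h)
  | [], _, _ => trivial
  | _ :: _, _, h => ⟨hf.edge _ _ h.1, hf.edge _ _ h.2.1, hf.lt _ _ h.2.2.1, Chain.map hf h.2.2.2⟩

theorem Args.map (hf : S.Hom S' f) {op cl : X → V} : ∀ {ss : List (List (Token α X))} {h : V},
    S.Args op cl ss h → S'.Args (f ∘ op) (f ∘ cl) ss (f h)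
  | [], _, _ => trivial
  | _ :: _, _, ⟨o, c, h₁, h₂, ⟨b, h₃, h₄⟩, h₅⟩ =>
    ⟨f o, f c, hf.edge _ _ h₁, hf.edge _ _ h₂, ⟨b, (hf.sil _ _ (.inr h₁)).symm.trans h₃, h₄.map hf⟩,
      Args.map hf h₅⟩

theorem Applies.map [DecidableEq X] (hf : S.Hom S' f) {args : List (List (α ⊕ X))}
    {body : List (N × List X)} {h : V} (ha : S.Applies args body h) :
    S'.Applies args body (f h) := by
  obtain ⟨op, cl, h₁, h₂⟩ := ha
  refine ⟨f ∘ op, f ∘ cl, fun t ht => ?_, h₂.map hf⟩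
  obtain ⟨h', h₃, h₄⟩ := h₁ t ht
  refine ⟨f h', hf.col _ _ h₃, ?_⟩
  have := h₄.map hf
  rwa [List.map_map] at this

end Relations

/-! ### The spans of a production -/

section OwnSpans

variable {α N X V : Type} (br : ℕ → V) (letter : α → ℕ → V) (sp : X → Span V)

/-- The vertices for a numbered token. -/
def tokenList (b : Bool) : Token α X × ℕ → List V
  | (.inl (.inl a), j) => if b then [] else [letter a j]
  | (.inl (.inr x), _) => (sp x).list
  | (.inr x, _) => (sp x).list

/-- The spans for arguments that are silent or not. -/
def ownSpans (i : ℕ) (ss : List (List (Token α X × ℕ) × Bool)) : List (Span V) :=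
  (ss.zipIdx i).map fun q =>
    ⟨br (2 * q.2), q.1.1.flatMap (tokenList letter sp q.1.2), br (2 * q.2 + 1)⟩

/-- The tokens with their numbers and the silence of their arguments. -/
def allTokens (ss : List (List (Token α X × ℕ) × Bool)) : List ((Token α X × ℕ) × Bool) :=
  ss.flatMap fun q => q.1.map fun t => (t, q.2)

variable {br letter sp}

theorem mem_allTokens {ss : List (List (Token α X × ℕ) × Bool)} {t : (Token α X × ℕ) × Bool} :
    t ∈ allTokens ss ↔ ∃ q ∈ ss, t.1 ∈ q.1 ∧ t.2 = q.2 := by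
  simp only [allTokens, List.mem_flatMap, List.mem_map]
  refine exists_congr fun q => and_congr Iff.rfl ⟨?_, ?_⟩
  · rintro ⟨t, ht, rfl⟩
    exact ⟨ht, rfl⟩
  · exact fun h => ⟨t.1, h.1, by rw [← h.2]⟩

theorem allTokens_cons (q : List (Token α X × ℕ) × Bool)
    (ss : List (List (Token α X × ℕ) × Bool)) :
    allTokens (q :: ss) = (q.1.map fun t => (t, q.2)) ++ allTokens ss := rfl

theorem ownSpans_cons (i : ℕ) (q : List (Token α X × ℕ) × Bool)
    (ss : List (List (Token α X × ℕ) × Bool)) : ownSpans br letter sp i (q :: ss) =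
      ⟨br (2 * i), q.1.flatMap (tokenList letter sp q.2), br (2 * i + 1)⟩ ::
        ownSpans br letter sp (i + 1) ss := rfl

/-- The `i`-th span has the ends numbered `2i` and `2i + 1`. Sorting the ends before everything else
lets distinctness and membership be checked separately for ends and tokens. -/
theorem ownSpans_perm : ∀ (i : ℕ) (ss : List (List (Token α X × ℕ) × Bool)),
    ((ownSpans br letter sp i ss).flatMap Span.list).Perm
      ((List.range' (2 * i) (2 * ss.length)).map br ++
        (allTokens ss).flatMap fun t => tokenList letter sp t.2 t.1)
  | _, [] => .refl _
  | i, q :: ss => by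
    have h := ownSpans_perm (i + 1) ss
    have e : 2 * (q :: ss).length = 2 * ss.length + 1 + 1 := by simp; omega
    rw [ownSpans_cons, List.flatMap_cons, allTokens_cons, List.flatMap_append, e,
      List.range'_succ, List.range'_succ, List.flatMap_map, Span.list]
    simp only [List.map_cons, List.cons_append, List.append_assoc, List.nil_append]
    refine List.Perm.cons _ (List.perm_middle.trans (List.Perm.cons _ ?_))
    exact (h.append_left _).trans (List.perm_append_comm_assoc _ _ _)

/-- Ends, letters and spans of variables are of three different kinds. Two letters differ in the
number of their token, two spans belong to different variables. -/
theorem nodup_ownSpans {ss : List (List (Token α X × ℕ) × Bool)} (hbr : Function.Injective br)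
    (hbl : ∀ i a j, br i ≠ letter a j) (hl : ∀ a i b j, letter a i = letter b j → i = j)
    (hidx : ((allTokens ss).map fun t => t.1.2).Nodup)
    (hvar : ((allTokens ss).filterMap fun t => t.1.1.var).Nodup)
    (h₁ : ∀ x ∈ (allTokens ss).filterMap fun t => t.1.1.var, (sp x).list.Nodup ∧
      ∀ v ∈ (sp x).list, (∀ i, v ≠ br i) ∧ ∀ a i, v ≠ letter a i)
    (h₂ : ∀ x ∈ (allTokens ss).filterMap fun t => t.1.1.var,
      ∀ y ∈ (allTokens ss).filterMap fun t => t.1.1.var, x ≠ y →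
        List.Disjoint (sp x).list (sp y).list) :
    ((ownSpans br letter sp 0 ss).flatMap Span.list).Nodup := by
  rw [(ownSpans_perm 0 ss).nodup_iff, List.nodup_append]
  have hmem : ∀ t ∈ allTokens ss, ∀ x, t.1.1.var = some x →
      x ∈ (allTokens ss).filterMap fun t => t.1.1.var :=
    fun t ht x hx => List.mem_filterMap.2 ⟨t, ht, hx⟩
  have hcases : ∀ t ∈ allTokens ss, ∀ v ∈ tokenList letter sp t.2 t.1,
      (∃ a, v = letter a t.1.2) ∨ ∃ x, t.1.1.var = some x ∧ v ∈ (sp x).list := by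
    rintro ⟨⟨(a | x) | x, j⟩, b⟩ ht v hv
    · cases b
      · exact Or.inl ⟨a, by simpa [tokenList] using hv⟩
      · simp [tokenList] at hv
    · exact Or.inr ⟨x, rfl, hv⟩
    · exact Or.inr ⟨x, rfl, hv⟩
  refine ⟨(List.nodup_range').map hbr, List.nodup_flatMap.2 ⟨?_, ?_⟩, ?_⟩
  · rintro ⟨⟨(a | x) | x, j⟩, b⟩ ht
    · cases b <;> simp [tokenList]
    · exact (h₁ x (hmem _ ht x rfl)).1
    · exact (h₁ x (hmem _ ht x rfl)).1
  · have h₃ : (allTokens ss).Pairwise fun t t' => t.1.2 ≠ t'.1.2 := List.pairwise_map.1 hidx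
    have h₄ := List.pairwise_filterMap.1 hvar
    refine (h₃.and h₄).imp_of_mem fun {t t'} ht ht' h => ?_
    intro v hv hv'
    rcases hcases t ht v hv with ⟨a, rfl⟩ | ⟨x, hx, hv⟩ <;>
    rcases hcases t' ht' _ hv' with ⟨a', ha'⟩ | ⟨x', hx', hv'⟩
    · exact h.1 (hl _ _ _ _ ha')
    · exact ((h₁ x' (hmem _ ht' _ hx')).2 _ hv').2 _ _ rfl
    · exact ((h₁ x (hmem _ ht _ hx)).2 _ hv).2 _ _ ha'
    · exact h₂ x (hmem _ ht _ hx) x' (hmem _ ht' _ hx') (h.2 x hx x' hx') hv hv'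
  · intro v hv w hw hvw
    subst hvw
    obtain ⟨i, -, rfl⟩ := List.mem_map.1 hv
    obtain ⟨t, ht, hw⟩ := List.mem_flatMap.1 hw
    rcases hcases t ht _ hw with ⟨a, ha⟩ | ⟨x, hx, hv⟩
    · exact hbl _ _ _ ha
    · exact ((h₁ x (hmem _ ht x hx)).2 _ hv).1 _ rfl

variable {F : Frame α N V}

theorem Frame.path_of_isChain {R lt : V → V → Prop} (hlab : ∀ a j, F.lab (letter a j) = some a)
    {b : Bool} {c : V} : ∀ {s : List (Token α X × ℕ)} {p : V},
      (∀ t ∈ s, (∀ x, t.1 = .inl (.inr x) → F.sil (sp x).first = b) ∧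
        ∀ x, t.1 = .inr x → F.sil (sp x).first = true) →
      (p :: (s.flatMap (tokenList letter sp b) ++ [c])).IsChain R →
      (F.rel R lt).Path (fun x => (sp x).first) (fun x => (sp x).last) b c (s.map Prod.fst) p
  | [], p, _, h => by simpa [Relations.Path, rel] using h
  | (.inl (.inl a), j) :: s, p, hs, h => by
    have hs' : ∀ t ∈ s, _ := fun t ht => hs t (List.mem_cons_of_mem _ ht)
    cases b with
    | true =>
      simp only [List.map_cons, Relations.Path, if_true]
      exact path_of_isChain hlab hs' h
    | false =>
      simp only [List.map_cons, Relations.Path, Bool.false_eq_true, if_false]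
      have h' : (p :: letter a j :: (s.flatMap (tokenList letter sp false) ++ [c])).IsChain R := h
      rw [List.isChain_cons_cons] at h'
      exact ⟨_, h'.1, hlab a j, path_of_isChain hlab hs' h'.2⟩
  | (.inl (.inr x), j) :: s, p, hs, h => by
    have hs' : ∀ t ∈ s, _ := fun t ht => hs t (List.mem_cons_of_mem _ ht)
    have h' : (p :: (sp x).first :: (((sp x).inner ++ [(sp x).last]) ++
      s.flatMap (tokenList letter sp b) ++ [c])).IsChain R := h
    rw [List.isChain_cons_cons] at h'
    refine ⟨h'.1, ?_, path_of_isChain hlab hs' (h'.2.suffix ?_)⟩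
    · show F.sil _ = true ↔ _
      rw [(hs _ List.mem_cons_self).1 x rfl]
    · exact ⟨(sp x).first :: (sp x).inner, by simp⟩
  | (.inr x, j) :: s, p, hs, h => by
    have hs' : ∀ t ∈ s, _ := fun t ht => hs t (List.mem_cons_of_mem _ ht)
    have h' : (p :: (sp x).first :: (((sp x).inner ++ [(sp x).last]) ++
      s.flatMap (tokenList letter sp b) ++ [c])).IsChain R := h
    rw [List.isChain_cons_cons] at h'
    refine ⟨h'.1, ?_, path_of_isChain hlab hs' (h'.2.suffix ?_)⟩
    · exact (hs _ List.mem_cons_self).2 x rfl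
    · exact ⟨(sp x).first :: (sp x).inner, by simp⟩

/-- The edge from the end `j` to the end `j + 1` crosses a span if `j` is even and leads to the next
span if `j` is odd. -/
theorem Frame.args_of_isChain {R lt : V → V → Prop} (hlab : ∀ a j, F.lab (letter a j) = some a) :
    ∀ {ss : List (List (Token α X × ℕ) × Bool)} {i : ℕ} {h : V},
      (∀ t ∈ allTokens ss, (∀ x, t.1.1 = .inl (.inr x) → F.sil (sp x).first = t.2) ∧
        ∀ x, t.1.1 = .inr x → F.sil (sp x).first = true) →
      (∀ j, j + 1 < 2 * (i + ss.length) → F.next (br j) = some (br (j + 1))) →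
      (ss ≠ [] → F.next h = some (br (2 * i))) →
      (∀ q ∈ ss.zipIdx i, F.sil (br (2 * q.2)) = q.1.2) →
      (∀ p ∈ ownSpans br letter sp i ss, p.list.IsChain R) →
      (F.rel R lt).Args (fun x => (sp x).first) (fun x => (sp x).last)
        (ss.map fun q => q.1.map Prod.fst) h
  | [], _, _, _, _, _, _, _ => trivial
  | q :: ss, i, h, h₁, h₂, h₃, h₄, h₅ => by
    rw [List.length_cons] at h₂
    rw [ownSpans_cons] at h₅
    rw [List.zipIdx_cons] at h₄
    rw [allTokens_cons] at h₁
    refine ⟨br (2 * i), br (2 * i + 1), h₃ (by simp), h₂ _ (by omega), ⟨q.2, ?_, ?_⟩, ?_⟩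
    · show F.sil _ = true ↔ _
      rw [h₄ _ List.mem_cons_self]
    · refine path_of_isChain hlab (fun t ht => h₁ (t, q.2) ?_) (h₅ _ List.mem_cons_self)
      exact List.mem_append_left _ (List.mem_map_of_mem (f := fun t => (t, q.2)) ht)
    · refine args_of_isChain (i := i + 1) hlab (fun t ht => h₁ t (List.mem_append_right _ ht))
        (fun j hj => h₂ j (by omega)) (fun hne => ?_)
        (fun r hr => h₄ r (List.mem_cons_of_mem _ hr))
        fun p hp => h₅ p (List.mem_cons_of_mem _ hp)
      have : 0 < ss.length := List.length_pos_iff.2 hne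
      rw [h₂ _ (by omega)]
      rfl

theorem Frame.chain_ownSpans {R : V → V → Prop} :
    ∀ {ss : List (List (Token α X × ℕ) × Bool)} {i : ℕ} {h : V},
      (∀ j, j + 1 < 2 * (i + ss.length) → F.next (br j) = some (br (j + 1))) →
      (ss ≠ [] → F.next h = some (br (2 * i))) →
      (F.rel R fun _ _ => True).Chain ((ownSpans br letter sp i ss).map Span.ends) h
  | [], _, _, _, _ => trivial
  | q :: ss, i, h, h₂, h₃ => by
    rw [List.length_cons] at h₂
    rw [ownSpans_cons]
    refine ⟨h₃ (by simp), h₂ _ (by omega), trivial, ?_⟩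
    refine chain_ownSpans (i := i + 1) (fun j hj => h₂ j (by omega)) fun hne => ?_
    have : 0 < ss.length := List.length_pos_iff.2 hne
    show F.next (br _) = _
    rw [h₂ _ (by omega)]
    rfl

theorem Frame.filterMap_tokenList {η : X → List α} (hlab : ∀ a j, F.lab (letter a j) = some a)
    {t : (Token α X × ℕ) × Bool}
    (ht : (∀ x, t.1.1 = .inl (.inr x) → F.sil (sp x).first = t.2) ∧
        ∀ x, t.1.1 = .inr x → F.sil (sp x).first = true)
    (hx : ∀ x, t.1.1.var = some x →
      (sp x).list.filterMap F.lab = if F.sil (sp x).first then [] else η x) :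
    (tokenList letter sp t.2 t.1).filterMap F.lab = Token.word t.2 η t.1.1 := by
  obtain ⟨⟨(a | x) | x, j⟩, b⟩ := t
  · cases b <;> simp [tokenList, Token.word, hlab]
  · simp [tokenList, Token.word, hx x rfl, ht.1 x rfl]
  · simp [tokenList, Token.word, hx x rfl, ht.2 x rfl]

theorem Frame.forall₂_ownSpans {η : X → List α} (hlab : ∀ a j, F.lab (letter a j) = some a) :
    ∀ {ss : List (List (Token α X × ℕ) × Bool)} {i : ℕ},
      (∀ t ∈ allTokens ss, (∀ x, t.1.1 = .inl (.inr x) → F.sil (sp x).first = t.2) ∧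
        ∀ x, t.1.1 = .inr x → F.sil (sp x).first = true) →
      (∀ t ∈ allTokens ss, ∀ x, t.1.1.var = some x →
        (sp x).list.filterMap F.lab = if F.sil (sp x).first then [] else η x) →
      (∀ q ∈ ss.zipIdx i, F.sil (br (2 * q.2)) = q.1.2) →
      List.Forall₂ (fun p w => p.inner.filterMap F.lab = if F.sil p.first then [] else w)
        (ownSpans br letter sp i ss)
        (ss.map fun q => (q.1.map Prod.fst).flatMap (Token.word false η))
  | [], _, _, _, _ => .nil
  | q :: ss, i, h₁, h₂, h₃ => by
    rw [List.zipIdx_cons] at h₃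
    rw [allTokens_cons] at h₁ h₂
    rw [ownSpans_cons, List.map_cons]
    refine .cons ?_ (forall₂_ownSpans hlab (fun t ht => h₁ t (List.mem_append_right _ ht))
      (fun t ht => h₂ t (List.mem_append_right _ ht)) fun r hr => h₃ r (List.mem_cons_of_mem _ hr))
    have e : q.1.flatMap (fun t => (tokenList letter sp q.2 t).filterMap F.lab) =
        (q.1.map Prod.fst).flatMap (Token.word q.2 η) := by
      rw [List.flatMap_map]
      refine List.flatMap_congr fun t ht => ?_
      have : (t, q.2) ∈ (q.1.map fun t => (t, q.2)) ++ allTokens ss :=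
        List.mem_append_left _ (List.mem_map_of_mem (f := fun t => (t, q.2)) ht)
      exact filterMap_tokenList (t := (t, q.2)) hlab (h₁ _ this) (h₂ _ this)
    rw [h₃ _ List.mem_cons_self, List.filterMap_flatMap, e]
    cases hq : q.2 with
    | true => exact Production.flatMap_word_true η _
    | false => rfl

/-- The node of a production needs to join only neighbours in the skeleton sequence; the insides of
the variable spans are already chains by the subtrees. -/
theorem isChain_ownSpans {R : V → V → Prop} {ss : List (List (Token α X × ℕ) × Bool)}
    (h : ((ownSpans br letter (fun x => (sp x).skeleton) 0 ss).flatMap Span.list).IsChain R)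
    (hx : ∀ t ∈ allTokens ss, ∀ x, t.1.1.var = some x → (sp x).list.IsChain R) :
    ∀ p ∈ ownSpans br letter sp 0 ss, p.list.IsChain R := by
  intro p hp
  obtain ⟨q, hq, rfl⟩ := List.mem_map.1 hp
  have h' := h.infix (List.infix_of_mem_flatten
    (List.mem_map_of_mem (f := Span.list) (List.mem_map_of_mem hq)))
  simp only [Span.list, List.isChain_cons] at h' ⊢
  have := List.isChain_flatMap_append (f := tokenList letter sp q.1.2) (fun t ht => ?_) h'.2
  · exact ⟨this.2 ▸ h'.1, this.1⟩
  · have ht' : (t, q.1.2) ∈ allTokens ss := mem_allTokens.2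
      ⟨q.1, by
        have := List.mem_map_of_mem (f := Prod.fst) hq
        rwa [List.zipIdx_map_fst] at this, ht, rfl⟩
    obtain ⟨(a | x) | x, j⟩ := t
    · cases q.1.2 <;> simp [tokenList]
    · exact ⟨hx _ ht' x rfl, by simp [tokenList, Span.list, Span.skeleton],
        by simp [tokenList, Span.list, Span.skeleton, List.getLast?_cons]⟩
    · exact ⟨hx _ ht' x rfl, by simp [tokenList, Span.list, Span.skeleton],
        by simp [tokenList, Span.list, Span.skeleton, List.getLast?_cons]⟩

theorem exists_infix_of_mem {t : (Token α X × ℕ) × Bool}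
    {ss : List (List (Token α X × ℕ) × Bool)} (ht : t ∈ allTokens ss) :
    ∃ p ∈ ownSpans br letter sp 0 ss, tokenList letter sp t.2 t.1 <:+: p.list := by
  obtain ⟨q, hq, h₁, h₂⟩ := mem_allTokens.1 ht
  rw [← List.zipIdx_map_fst 0 ss] at hq
  obtain ⟨r, hr, rfl⟩ := List.mem_map.1 hq
  refine ⟨_, List.mem_map_of_mem hr, ?_⟩
  have h : tokenList letter sp r.1.2 t.1 <:+: r.1.1.flatMap (tokenList letter sp r.1.2) :=
    List.infix_of_mem_flatten (List.mem_map_of_mem h₁)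
  rw [h₂]
  exact h.trans ⟨[br (2 * r.2)], [br (2 * r.2 + 1)], by simp [Span.list]⟩

end OwnSpans

/-! ### Graphs of derivations -/

/-- The vertices of the graph of a derivation: ends of the spans of the root, letters of the
production at the root, and vertices of the graphs of the subtrees. -/
inductive Node (α : Type) {ι : Type} (W : ι → Type) : Type
  | brk (j : ℕ)
  | letter (a : α) (j : ℕ)
  | sub (i : ι) (w : W i)

namespace Node

variable {α N ι : Type} {W : ι → Type}

/-- The frame of the graph of a derivation. -/
def frame (n : ℕ) (A : N) (D : List Bool) (F : ∀ i, Frame α N (W i)) : Frame α N (Node α W) where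
  next
    -- The ends form a cycle: the last closing end carries the colour and points back to the first
    -- opening end, so no extra vertex is spent on the nonterminal.
    | brk j => if j + 1 < 2 * n then some (brk (j + 1))
        else if j + 1 = 2 * n then some (brk 0) else none
    | letter _ _ => none
    | sub i w => ((F i).next w).map (sub i)
  lab
    | brk _ => none
    | letter a _ => some a
    | sub i w => (F i).lab w
  col
    | brk j => if j + 1 = 2 * n then some A else none
    | letter _ _ => none
    | sub i w => (F i).col w
  sil
    | brk j => D.getD (j / 2) false
    | letter _ _ => false
    | sub i w => (F i).sil w

theorem sub_injective (i : ι) : Function.Injective (sub (α := α) (W := W) i) := by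
  intro v w h
  cases h
  rfl

theorem of_sub_eq {P : ∀ i, W i → Prop} {i j : ι} {v : W i} {w : W j}
    (h : sub (α := α) i v = sub j w) (hw : P j w) : P i v := by
  cases h
  exact hw

theorem hom_sub (n : ℕ) (A : N) (D : List Bool) (F : ∀ i, Frame α N (W i)) (i : ι)
    (R lt : Node α W → Node α W → Prop) :
    ((F i).rel (fun v w => R (sub i v) (sub i w)) fun v w => lt (sub i v) (sub i w)).Hom
      ((frame n A D F).rel R lt) (sub i) where
  succ _ _ h := h
  lt _ _ h := h
  edge v w h := by
    have h : (F i).next v = some w := h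
    show ((F i).next v).map (sub i) = _
    rw [h]
    rfl
  lab _ _ _ _ h := h
  col _ _ h := h
  sil _ _ _ := Iff.rfl

end Node

/-- The graph of a derivation of a tuple `u` from a nonterminal `A`, in which the components of `u`
that are marked as silent in `D` are not spelled. -/
structure Piece {α N X : Type} [DecidableEq X] (G : MCFG α N X) (k : ℕ) (A : N) (u : List (List α))
    (D : List Bool) where
  V : Type
  frame : Frame α N V
  spans : List (Span V)
  decomp : Decomp V k
  nodup : (spans.flatMap Span.list).Nodup
  sil_eq : spans.map (fun p => frame.sil p.first) = D
  word : List.Forall₂ (fun p w => p.inner.filterMap frame.lab =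
    if frame.sil p.first then [] else w) spans u
  lab_next : ∀ v w, frame.next v = some w → frame.lab v = none ∧ frame.lab w = none
  chain : ∃ h, frame.col h = some A ∧
    (frame.rel (fun _ _ => True) fun _ _ => True).Chain (spans.map Span.ends) h
  -- The type may have elements that never become vertices, for instance unused numbers of ends;
  -- edges and colours stay away from them.
  mem_next : ∀ v w, frame.next v = some w →
    v ∈ spans.flatMap Span.list ∧ w ∈ spans.flatMap Span.list
  mem_col : ∀ v B, frame.col v = some B → v ∈ spans.flatMap Span.list
  joins_chain : ∀ p ∈ spans, p.list.IsChain decomp.Joins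
  joins_next : ∀ v w, frame.next v = some w → decomp.Joins v w
  root : ∀ p ∈ spans, p.first ∈ decomp.bag decomp.root ∧ p.last ∈ decomp.bag decomp.root
  -- The order of the final graph is unknown while pieces are assembled, so the productions must
  -- apply for every successor relation and order compatible with the spans.
  applies : ∀ R lt : V → V → Prop, (∀ p ∈ spans, p.list.IsChain R ∧ p.list.Pairwise lt) →
    ∀ B h, frame.col h = some B →
      ∃ ρ ∈ G.rules, ρ.head = B ∧ (frame.rel R lt).Applies ρ.args ρ.body h

/-- Edges do not depend on the order; a chain carries over to any order in which its spans point
upwards. -/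
theorem Frame.chain_rel {α N V : Type} {F : Frame α N V} {R R' lt lt' : V → V → Prop} :
    ∀ {P : List (V × V)} {h : V}, (F.rel R lt).Chain P h → (∀ p ∈ P, lt' p.1 p.2) →
      (F.rel R' lt').Chain P h
  | [], _, _, _ => trivial
  | p :: _, _, h, h' => ⟨h.1, h.2.1, h' p List.mem_cons_self,
      chain_rel h.2.2.2 fun q hq => h' q (List.mem_cons_of_mem _ hq)⟩

theorem Span.lt_of_pairwise {V : Type} {lt : V → V → Prop} {p : Span V} (h : p.list.Pairwise lt) :
    lt p.first p.last := by
  rw [Span.list, List.pairwise_cons] at h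
  exact h.1 _ (by simp)

namespace Piece

variable {α N X : Type} [DecidableEq X] {G : MCFG α N X} {k : ℕ}

theorem next_of_mem {A : N} {u : List (List α)} {D : List Bool} (P : Piece G k A u D)
    {p : Span P.V} (hp : p ∈ P.spans) : P.frame.next p.first = some p.last := by
  obtain ⟨h, -, hc⟩ := P.chain
  exact (hc.edge_lt p.ends (List.mem_map_of_mem hp)).1

/-- The graphs of the subtrees of a derivation are combined. -/
theorem nonempty_of_rule {ρ : Production α N X} (hρ : ρ ∈ G.rules) (η : X → List α)
    (hk : 2 * ρ.args.length + 2 * ρ.bodyVars.length + 2 ≤ k) {D : List Bool}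
    (hD : D.length = ρ.args.length)
    (hsub : ∀ t ∈ ρ.body, ∀ E : List Bool, E.length = t.2.length →
      Nonempty (Piece G k t.1 (t.2.map η) E)) :
    Nonempty (Piece G k ρ.head (ρ.args.map (Production.subst η)) D) := by
  classical
  have hn : 1 ≤ ρ.args.length := G.one_le_arity _ (G.head_mem ρ hρ)
  have hne : ρ.args ≠ [] := by
    intro h
    simp [h] at hn
  -- numbered tokens
  obtain ⟨toks, htoks⟩ : ∃ l, l = Production.tokens ρ.args ρ.body := ⟨_, rfl⟩
  have htl : toks.length = ρ.args.length := by rw [htoks, Production.length_tokens]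
  obtain ⟨ss, hss⟩ : ∃ l, l = (List.number 0 toks).zip D := ⟨_, rfl⟩
  have hlen : (List.number 0 toks).length = D.length := by rw [List.length_number, htl, hD]
  have hss₁ : ss.map Prod.fst = List.number 0 toks := by
    rw [hss, List.map_fst_zip hlen.le]
  have hss₂ : ss.map Prod.snd = D := by
    rw [hss, List.map_snd_zip hlen.ge]
  have hssl : ss.length = ρ.args.length := by rw [← hD, ← hss₂, List.length_map]
  have hss₃ : (ss.map fun q => q.1.map Prod.fst) = toks := by
    rw [← List.map_number 0 toks, ← hss₁, List.map_map]
    rfl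
  have hall : (allTokens ss).map Prod.fst = toks.flatten.zipIdx := by
    rw [← List.flatten_number, ← hss₁, allTokens, List.map_flatMap, ← List.flatMap_def]
    simp [Function.comp_def]
  have hidx : ((allTokens ss).map fun t => t.1.2).Nodup := by
    have : ((allTokens ss).map fun t => t.1.2) = ((allTokens ss).map Prod.fst).map Prod.snd := by
      rw [List.map_map]
      rfl
    rw [this, hall, List.zipIdx_map_snd]
    exact List.nodup_range'
  have hvar_eq : ((allTokens ss).filterMap fun t => t.1.1.var) =
      Production.dropped ρ.args ρ.body ++ ρ.headVars := by
    have : ((allTokens ss).filterMap fun t => t.1.1.var) =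
        (((allTokens ss).map Prod.fst).map Prod.fst).filterMap Token.var := by
      rw [List.filterMap_map, List.filterMap_map]
      rfl
    rw [this, hall, List.zipIdx_map_fst, htoks, Production.filterMap_var_tokens _ _ hne]
    rfl
  have hvar : ((allTokens ss).filterMap fun t => t.1.1.var).Nodup := by
    rw [hvar_eq, List.nodup_append]
    refine ⟨(G.nodup_body ρ hρ).filter _, G.nodup_head ρ hρ, ?_⟩
    rintro x hx y hy rfl
    have := (List.mem_filter.1 hx).2
    simp only [decide_eq_true_eq] at this
    exact this hy
  have hmem : ∀ x, x ∈ ((allTokens ss).filterMap fun t => t.1.1.var) ↔ x ∈ ρ.bodyVars := by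
    intro x
    rw [hvar_eq, List.mem_append]
    constructor
    · exact fun h => h.elim (fun h => (List.mem_filter.1 h).1) fun h => G.head_subset_body ρ hρ h
    · intro h
      by_cases hx : x ∈ ρ.headVars
      · exact Or.inr hx
      · exact Or.inl (List.mem_filter.2 ⟨h, decide_eq_true hx⟩)
  have hmem' : ∀ t ∈ allTokens ss, ∀ x, t.1.1.var = some x → x ∈ ρ.bodyVars :=
    fun t ht x hx => (hmem x).1 (List.mem_filterMap.2 ⟨t, ht, hx⟩)
  -- the graphs of the subtrees
  let silX : X → Bool := fun x => decide ¬ ∃ j, ((.inl (.inr x), j), false) ∈ allTokens ss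
  have pc : ∀ t : {t // t ∈ ρ.body}, Piece G k t.1.1 (t.1.2.map η) (t.1.2.map silX) :=
    fun t => Classical.choice (hsub t.1 t.2 _ (by simp))
  have hpl : ∀ t, (pc t).spans.length = t.1.2.length := fun t => by
    have := congrArg List.length (pc t).sil_eq
    simpa using this
  let W : {t // t ∈ ρ.body} → Type := fun t => (pc t).V
  have : Nonempty (Span (Node α W)) := ⟨⟨.brk 0, [], .brk 0⟩⟩
  obtain ⟨sp, hsp⟩ : ∃ sp : X → Span (Node α W), ∀ t ∈ ρ.body.attach,
      t.1.2.map sp = (pc t).spans.map (Span.map (Node.sub t)) := by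
    refine exists_map_eq _ _ _ ?_ fun t _ => by rw [List.length_map, hpl]
    have := G.nodup_body ρ hρ
    rw [Production.bodyVars, ← List.attach_map_subtype_val ρ.body, List.flatMap_map] at this
    exact this
  replace hsp := fun t => hsp t (List.mem_attach _ t)
  let F : Frame α N (Node α W) := Node.frame ρ.args.length ρ.head D fun t => (pc t).frame
  have hspx : ∀ x ∈ ρ.bodyVars, ∃ t : {t // t ∈ ρ.body}, x ∈ t.1.2 ∧
      ∃ p ∈ (pc t).spans, sp x = p.map (Node.sub t) := by
    intro x hx
    obtain ⟨t, ht, hxt⟩ := List.mem_flatMap.1 hx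
    have : sp x ∈ t.2.map sp := List.mem_map_of_mem hxt
    rw [hsp ⟨t, ht⟩] at this
    obtain ⟨p, hp, h⟩ := List.mem_map.1 this
    exact ⟨⟨t, ht⟩, hxt, p, hp, h.symm⟩
  have hsil : ∀ x ∈ ρ.bodyVars, F.sil (sp x).first = silX x := by
    intro x hx
    obtain ⟨t, hxt, -⟩ := hspx x hx
    have h : (t.1.2.map sp).map (fun p => F.sil p.first) = t.1.2.map silX := by
      rw [hsp t, List.map_map]
      exact (pc t).sil_eq
    rw [List.map_map] at h
    exact List.map_inj_left.1 h x hxt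
  have hlist : ∀ x ∈ ρ.bodyVars,
      (sp x).list.filterMap F.lab = if F.sil (sp x).first then [] else η x := by
    intro x hx
    obtain ⟨t, hxt, p, hp, hxp⟩ := hspx x hx
    have hw : List.Forall₂ (fun p w => p.inner.filterMap F.lab =
        if F.sil p.first then [] else w) (t.1.2.map sp) (t.1.2.map η) := by
      rw [hsp t, List.forall₂_map_left_iff]
      refine (pc t).word.imp fun p w h => ?_
      rw [Span.map, List.filterMap_map]
      exact h
    rw [List.forall₂_map_left_iff, List.forall₂_map_right_iff, List.forall₂_same] at hw
    have h₁ : F.lab (sp x).first = none := by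
      rw [hxp]
      exact ((pc t).lab_next _ _ ((pc t).next_of_mem hp)).1
    have h₂ : F.lab (sp x).last = none := by
      rw [hxp]
      exact ((pc t).lab_next _ _ ((pc t).next_of_mem hp)).2
    rw [← hw x hxt, Span.list, List.filterMap_cons_none h₁, List.filterMap_append,
      List.filterMap_cons_none h₂]
    simp
  -- A variable occurs only once among the tokens, so its chosen silence is that of its own
  -- argument. A dropped variable has no ordinary occurrence and is silent.
  have hT : ∀ t ∈ allTokens ss, (∀ x, t.1.1 = .inl (.inr x) → F.sil (sp x).first = t.2) ∧
      ∀ x, t.1.1 = .inr x → F.sil (sp x).first = true := by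
    rintro ⟨⟨t, j⟩, b⟩ ht
    refine ⟨?_, ?_⟩
    · rintro x rfl
      rw [hsil x (hmem' _ ht x rfl)]
      cases b with
      | false => exact decide_eq_false fun h => h ⟨j, ht⟩
      | true =>
        refine decide_eq_true ?_
        rintro ⟨j', h⟩
        have := List.eq_of_nodup_filterMap hvar ht h (x := x) rfl rfl
        simp at this
    · rintro x rfl
      rw [hsil x (hmem' _ ht x rfl)]
      refine decide_eq_true ?_
      rintro ⟨j', h⟩
      have := List.eq_of_nodup_filterMap hvar ht h (x := x) rfl rfl
      simp at this
  have hN₁ : ∀ x ∈ ρ.bodyVars, (sp x).list.Nodup ∧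
      ∀ v ∈ (sp x).list, (∀ i, v ≠ .brk i) ∧ ∀ a i, v ≠ .letter a i := by
    intro x hx
    obtain ⟨t, -, p, hp, h⟩ := hspx x hx
    rw [h, Span.list_map]
    refine ⟨(List.nodup_flatMap.1 (pc t).nodup).1 p hp |>.map (Node.sub_injective t), ?_⟩
    intro v hv
    obtain ⟨w, -, rfl⟩ := List.mem_map.1 hv
    exact ⟨fun i h => (by cases h), fun a i h => (by cases h)⟩
  have hN₂ : ∀ x ∈ ρ.bodyVars, ∀ y ∈ ρ.bodyVars, x ≠ y →
      List.Disjoint (sp x).list (sp y).list := by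
    intro x hx y hy hxy
    obtain ⟨t, hxt, p, hp, hxp⟩ := hspx x hx
    obtain ⟨t', hyt, p', hp', hyp⟩ := hspx y hy
    by_cases htt : t = t'
    · subst htt
      have : (t.1.2.flatMap fun x => (sp x).list).Nodup := by
        rw [← List.flatMap_map sp Span.list, hsp t, List.flatMap_map]
        simp only [Span.list_map]
        rw [← List.map_flatMap]
        exact (pc t).nodup.map (Node.sub_injective t)
      exact List.disjoint_of_nodup_flatMap this hxt hyt hxy
    · rw [hxp, hyp, Span.list_map, Span.list_map]
      intro v hv hv'
      obtain ⟨w, -, rfl⟩ := List.mem_map.1 hv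
      obtain ⟨w', -, h⟩ := List.mem_map.1 hv'
      cases h
      exact htt rfl
  have hbr : Function.Injective (Node.brk (α := α) (W := W)) := fun i j h => by
    cases h
    rfl
  have hzip : ∀ q ∈ ss.zipIdx 0, F.sil (.brk (2 * q.2)) = q.1.2 := by
    rintro ⟨q, i⟩ hq
    obtain ⟨hi, hqi⟩ := List.mem_zipIdx' hq
    show D.getD (2 * i / 2) false = q.2
    rw [Nat.mul_div_cancel_left i (by decide), ← hss₂, hqi]
    simp [hi]
  have hnext : ∀ j, j + 1 < 2 * (0 + ss.length) → F.next (.brk j) = some (.brk (j + 1)) := by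
    intro j hj
    exact if_pos (by omega)
  have hlast : F.next (.brk (2 * ρ.args.length - 1)) = some (.brk (2 * 0)) := by
    show (if _ then _ else _) = _
    rw [if_neg (by omega), if_pos (by omega)]
  have hlast' : F.col (.brk (2 * ρ.args.length - 1)) = some ρ.head := if_pos (by omega)
  -- the decomposition
  obtain ⟨B, hB⟩ : ∃ l : List (Node α W), l = (List.range' 0 (2 * ρ.args.length)).map Node.brk ++
    ρ.bodyVars.flatMap (fun x => [(sp x).first, (sp x).last]) := ⟨_, rfl⟩
  have hBbrk : ∀ j < 2 * ρ.args.length, Node.brk j ∈ B := fun j hj => by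
    rw [hB, List.mem_append]
    exact Or.inl (List.mem_map_of_mem (by simpa using hj))
  have hBsp : ∀ x ∈ ρ.bodyVars, (sp x).first ∈ B ∧ (sp x).last ∈ B := fun x hx => by
    rw [hB, List.mem_append, List.mem_append]
    exact ⟨Or.inr (List.mem_flatMap.2 ⟨x, hx, by simp⟩),
      Or.inr (List.mem_flatMap.2 ⟨x, hx, by simp⟩)⟩
  have hBcases : ∀ v ∈ B, (∃ j, v = .brk j) ∨ ∃ x ∈ ρ.bodyVars,
      v = (sp x).first ∨ v = (sp x).last := by
    intro v hv
    rw [hB, List.mem_append, List.mem_map, List.mem_flatMap] at hv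
    rcases hv with ⟨j, -, rfl⟩ | ⟨x, hx, hv⟩
    · exact Or.inl ⟨j, rfl⟩
    · exact Or.inr ⟨x, hx, by simpa using hv⟩
  have hBlen : B.length + 2 ≤ k := by
    rw [hB]
    simp only [List.length_append, List.length_map, List.length_range', List.length_flatMap,
      List.length_cons, List.length_nil, List.map_const', List.sum_replicate, smul_eq_mul]
    omega
  -- The bag `B` meets a subtree only in ends of spans, and these lie in the root bag of that
  -- subtree, as joining requires.
  let Dsub : ∀ _ : {t // t ∈ ρ.body}, Decomp (Node α W) k :=
    fun t => (pc t).decomp.map (Node.sub (α := α) (W := W) t) (Node.sub_injective t)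
  let D₀ : Decomp (Node α W) k := Decomp.join Dsub B (by omega)
    (by
      intro i j v hi hj
      obtain ⟨w, rfl⟩ : ∃ w, Node.sub i w = v := Decomp.covers_map hi
      obtain ⟨w', h⟩ : ∃ w', Node.sub j w' = Node.sub i w := Decomp.covers_map hj
      exact Node.of_sub_eq (P := fun t _ => t = j) h.symm rfl)
    (by
      intro t v hv hc
      obtain ⟨w, rfl⟩ : ∃ w, Node.sub t w = v := Decomp.covers_map hc
      rcases hBcases _ hv with ⟨j, h⟩ | ⟨x, hx, h⟩
      · cases h
      · obtain ⟨t', -, p, hp, hxp⟩ := hspx x hx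
        rw [hxp] at h
        rcases h with h | h
        · exact List.mem_map_of_mem (Node.of_sub_eq
            (P := fun t v => v ∈ (pc t).decomp.bag (pc t).decomp.root) h ((pc t').root p hp).1)
        · exact List.mem_map_of_mem (Node.of_sub_eq
            (P := fun t v => v ∈ (pc t).decomp.bag (pc t).decomp.root) h ((pc t').root p hp).2))
  have hsk : ∀ x, (sp x).skeleton.list ⊆ (sp x).list := fun x => (sp x).skeleton_sublist.subset
  -- The sweep runs over the skeletons of the variable spans. Of its elements only the letters are
  -- new; all ends are in `B` already.
  obtain ⟨D', hroot, hjoins, -, hchain⟩ := D₀.exists_isChain (B := B) rfl hBlen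
    (ls := (ownSpans Node.brk Node.letter (fun x => (sp x).skeleton) 0 ss).flatMap Span.list)
    (by
      refine nodup_ownSpans hbr (fun i a j h => by cases h) (fun a i b j h => by cases h; rfl)
        hidx hvar (fun x hx => ?_) fun x hx y hy hxy => ?_
      · obtain ⟨h₁, h₂⟩ := hN₁ x ((hmem x).1 hx)
        exact ⟨h₁.sublist (sp x).skeleton_sublist, fun v hv => h₂ v (hsk x hv)⟩
      · intro v hv hv'
        exact hN₂ x ((hmem x).1 hx) y ((hmem y).1 hy) hxy (hsk x hv) (hsk y hv'))
    (by
      intro v hv hc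
      rw [(ownSpans_perm 0 ss).mem_iff, List.mem_append] at hv
      rcases hv with hv | hv
      · obtain ⟨j, hj, rfl⟩ := List.mem_map.1 hv
        refine hBbrk j ?_
        simpa [hssl] using hj
      · obtain ⟨⟨⟨t, j⟩, b⟩, ht, hv⟩ := List.mem_flatMap.1 hv
        have key : ∀ x, t.var = some x → v ∈ (sp x).skeleton.list → v ∈ B := by
          intro x hx hv
          obtain ⟨h₁, h₂⟩ := hBsp x (hmem' _ ht x hx)
          simp only [Span.list, Span.skeleton, List.nil_append, List.mem_cons,
            List.not_mem_nil, or_false] at hv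
          rcases hv with rfl | rfl
          · exact h₁
          · exact h₂
        rcases t with (a | x) | x
        · cases b with
          | true => simp [tokenList] at hv
          | false =>
            obtain rfl : v = Node.letter a j := by simpa [tokenList] using hv
            rcases Decomp.covers_join hc with hc | ⟨t, hc⟩
            · exact hc
            · obtain ⟨w, h⟩ := Decomp.covers_map hc
              cases h
        · exact key x rfl hv
        · exact key x rfl hv)
  have hrootB : ∀ v ∈ B, v ∈ D'.bag D'.root := fun v hv => by
    rw [hroot]
    exact List.mem_append_left _ hv
  have hsubjoins : ∀ t v w, (pc t).decomp.Joins v w → D'.Joins (.sub t v) (.sub t w) :=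
    fun t v w h => hjoins _ _ (Decomp.Joins.join (D := Dsub) (i := t) h.map)
  have hends : ∀ p ∈ ownSpans Node.brk Node.letter sp 0 ss, p.first ∈ B ∧ p.last ∈ B := by
    intro p hp
    obtain ⟨⟨q, i⟩, hq, rfl⟩ := List.mem_map.1 hp
    have := (List.mem_zipIdx' hq).1
    exact ⟨hBbrk _ (by omega), hBbrk _ (by omega)⟩
  have hinfix : ∀ x ∈ ρ.bodyVars, ∃ p ∈ ownSpans Node.brk Node.letter sp 0 ss,
      (sp x).list <:+: p.list := by
    intro x hx
    obtain ⟨⟨⟨t, j⟩, b⟩, ht, hx⟩ := List.mem_filterMap.1 ((hmem x).2 hx)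
    obtain ⟨p, hp, hinf⟩ := exists_infix_of_mem (br := Node.brk) (letter := Node.letter)
      (sp := sp) ht
    have : tokenList Node.letter sp b (t, j) = (sp x).list := by
      rcases t with (a | y) | y
      · cases hx
      · cases hx
        rfl
      · cases hx
        rfl
    exact ⟨p, hp, this ▸ hinf⟩
  have hspt : ∀ t, ∀ p ∈ (pc t).spans, ∃ x ∈ ρ.bodyVars, sp x = p.map (Node.sub t) := by
    intro t p hp
    have : p.map (Node.sub t) ∈ t.1.2.map sp := by
      rw [hsp t]
      exact List.mem_map_of_mem hp
    obtain ⟨x, hx, hxp⟩ := List.mem_map.1 this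
    exact ⟨x, List.mem_flatMap.2 ⟨t.1, t.2, hx⟩, hxp⟩
  have hmem_brk : ∀ j < 2 * ρ.args.length,
      Node.brk j ∈ (ownSpans Node.brk Node.letter sp 0 ss).flatMap Span.list := by
    intro j hj
    rw [(ownSpans_perm 0 ss).mem_iff, List.mem_append]
    exact Or.inl (List.mem_map_of_mem (by simpa [hssl] using hj))
  have hmem_sub : ∀ t, ∀ v ∈ (pc t).spans.flatMap Span.list,
      Node.sub t v ∈ (ownSpans Node.brk Node.letter sp 0 ss).flatMap Span.list := by
    intro t v hv
    obtain ⟨p, hp, hv⟩ := List.mem_flatMap.1 hv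
    obtain ⟨x, hx, hxp⟩ := hspt t p hp
    obtain ⟨q, hq, hinf⟩ := hinfix x hx
    refine List.mem_flatMap.2 ⟨q, hq, hinf.subset ?_⟩
    rw [hxp, Span.list_map]
    exact List.mem_map_of_mem hv
  refine ⟨{
    V := Node α W
    frame := F
    spans := ownSpans Node.brk Node.letter sp 0 ss
    decomp := D'
    nodup := nodup_ownSpans hbr (fun i a j h => by cases h) (fun a i b j h => by cases h; rfl)
      hidx hvar (fun x hx => hN₁ x ((hmem x).1 hx))
      fun x hx y hy => hN₂ x ((hmem x).1 hx) y ((hmem y).1 hy)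
    sil_eq := ?_
    word := ?_
    lab_next := ?_
    mem_next := ?_
    mem_col := ?_
    chain := ⟨_, hlast', Frame.chain_ownSpans hnext fun _ => hlast⟩
    joins_chain := isChain_ownSpans hchain fun t ht x hx => ?_
    joins_next := ?_
    root := fun p hp => ⟨hrootB _ (hends p hp).1, hrootB _ (hends p hp).2⟩
    applies := ?_ }⟩
  · rw [ownSpans, List.map_map]
    have : (ss.zipIdx 0).map (fun q => F.sil (.brk (2 * q.2))) =
        (ss.zipIdx 0).map fun q => q.1.2 := List.map_congr_left hzip
    refine this.trans ?_
    rw [← hss₂, ← List.zipIdx_map_fst 0 ss, List.map_map, List.zipIdx_map_fst]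
    rfl
  · have := Frame.forall₂_ownSpans (F := F) (η := η) (br := Node.brk) (letter := Node.letter)
      (sp := sp) (fun a j => rfl) hT (fun t ht x hx => hlist x (hmem' t ht x hx)) hzip
    have e := Production.map_word_tokens η ρ.args ρ.body
    rw [← htoks, ← hss₃, List.map_map] at e
    exact e ▸ this
  · rintro (j | ⟨a, j⟩ | ⟨t, v⟩) w h
    · have h : (if _ then _ else if _ then _ else _) = _ := h
      split_ifs at h
      · cases h
        exact ⟨rfl, rfl⟩
      · cases h
        exact ⟨rfl, rfl⟩
    · cases h
    · obtain ⟨w', h', rfl⟩ := Option.map_eq_some_iff.1 h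
      exact (pc t).lab_next v w' h'
  · rintro (j | ⟨a, j⟩ | ⟨t, v⟩) w h
    · have h : (if _ then _ else if _ then _ else _) = _ := h
      split_ifs at h
      · cases h
        exact ⟨hmem_brk _ (by omega), hmem_brk _ (by omega)⟩
      · cases h
        exact ⟨hmem_brk _ (by omega), hmem_brk _ (by omega)⟩
    · cases h
    · obtain ⟨w', h', rfl⟩ := Option.map_eq_some_iff.1 h
      exact ((pc t).mem_next v w' h').imp (hmem_sub t v) (hmem_sub t w')
  · rintro (j | ⟨a, j⟩ | ⟨t, v⟩) B' h
    · have h : (if _ then _ else _) = _ := h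
      split_ifs at h
      exact hmem_brk _ (by omega)
    · cases h
    · exact hmem_sub t v ((pc t).mem_col v B' h)
  · obtain ⟨t', -, p, hp, hxp⟩ := hspx x (hmem' t ht x hx)
    rw [hxp, Span.list_map, List.isChain_map]
    exact ((pc t').joins_chain p hp).imp (hsubjoins t')
  · rintro (j | ⟨a, j⟩ | ⟨t, v⟩) w h
    · have h : (if _ then _ else if _ then _ else _) = _ := h
      split_ifs at h
      · cases h
        exact hjoins _ _ (Decomp.joins_join_of_mem (hBbrk _ (by omega)) (hBbrk _ (by omega)))
      · cases h
        exact hjoins _ _ (Decomp.joins_join_of_mem (hBbrk _ (by omega)) (hBbrk _ (by omega)))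
    · cases h
    · obtain ⟨w', h', rfl⟩ := Option.map_eq_some_iff.1 h
      exact hsubjoins t _ _ ((pc t).joins_next v w' h')
  · intro R lt hR A h hA
    have hRx : ∀ x ∈ ρ.bodyVars, (sp x).list.IsChain R ∧ (sp x).list.Pairwise lt := by
      intro x hx
      obtain ⟨p, hp, hinf⟩ := hinfix x hx
      exact ⟨(hR p hp).1.infix hinf, (hR p hp).2.sublist hinf.sublist⟩
    have hRt : ∀ t, ∀ p ∈ (pc t).spans,
        p.list.IsChain (fun v w => R (.sub t v) (.sub t w)) ∧
          p.list.Pairwise fun v w => lt (.sub t v) (.sub t w) := by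
      intro t p hp
      obtain ⟨x, hx, hxp⟩ := hspt t p hp
      have := hRx x hx
      rwa [hxp, Span.list_map, List.isChain_map, List.pairwise_map] at this
    -- A coloured vertex is either the last closing end, where the production of the root applies,
    -- or lies in a subtree, whose own production is transported.
    rcases h with j | ⟨a, j⟩ | ⟨t, v⟩
    · have hA : (if _ then _ else _) = _ := hA
      split_ifs at hA with hj
      cases hA
      refine ⟨ρ, hρ, rfl, fun x => (sp x).first, fun x => (sp x).last, fun t ht => ?_, ?_⟩
      · obtain ⟨h', hcol, hc⟩ := (pc ⟨t, ht⟩).chain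
        refine ⟨.sub ⟨t, ht⟩ h', hcol, ?_⟩
        have e : (t.2.map fun x => ((sp x).first, (sp x).last)) =
            ((pc ⟨t, ht⟩).spans.map Span.ends).map (Prod.map (Node.sub ⟨t, ht⟩)
              (Node.sub ⟨t, ht⟩)) := by
          have := congrArg (List.map Span.ends) (hsp ⟨t, ht⟩)
          rw [List.map_map, List.map_map] at this
          rw [List.map_map]
          exact this
        rw [e]
        refine Relations.Chain.map (Node.hom_sub _ _ _ _ _ R lt) (Frame.chain_rel hc ?_)
        intro p hp
        obtain ⟨p', hp', rfl⟩ := List.mem_map.1 hp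
        exact Span.lt_of_pairwise (hRt ⟨t, ht⟩ p' hp').2
      · rw [← htoks, ← hss₃]
        obtain rfl : j = 2 * ρ.args.length - 1 := by omega
        exact Frame.args_of_isChain (fun _ _ => rfl) hT hnext (fun _ => hlast) hzip
          fun p hp => (hR p hp).1
    · cases hA
    · obtain ⟨ρ', hρ', hh, ha⟩ := (pc t).applies _ _ (hRt t) A v hA
      exact ⟨ρ', hρ', hh, ha.map (Node.hom_sub _ _ _ _ _ R lt)⟩

/-- The statement ranges over all silence patterns, because the pattern of a subtree is prescribed
by the production above it. -/
theorem nonempty_of_derives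
    (hk : ∀ ρ ∈ G.rules, 2 * ρ.args.length + 2 * ρ.bodyVars.length + 2 ≤ k) {A : N}
    {u : List (List α)} (h : G.Derives A u) :
    ∀ D : List Bool, D.length = u.length → Nonempty (Piece G k A u D) := by
  induction h with
  | intro ρ hρ η h ih =>
    intro D hD
    exact nonempty_of_rule hρ η (hk ρ hρ) (by simpa using hD) fun t ht E hE =>
      ih t ht E (by simpa using hE)

end Piece

/-! ### From graphs of derivations to models -/

namespace MSO

variable {α N X : Type} [DecidableEq N] [DecidableEq X] [Encodable N] [Encodable X]
  {G : MCFG α N X} {k : ℕ}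

/-- The only span of the start symbol lists all vertices, and the positions in this list form the
linearly ordered vertex set. Its neighbours are joined in the decomposition, which covers the
successor relation. -/
theorem _root_.Piece.exists_represents {w : List α} (P : Piece G k G.start [w] [false]) :
    ∃ (H : LoGraph α Unit) (σ : ℕ → Set H.V), Represents H G σ ∧
      (∀ n, n ≠ 1 → (∀ p ∈ G.nonterminals, colVar p.1 ≠ n) → σ n = ∅) ∧
        H.specialTreewidth ≤ k ∧ H.word = w := by
  obtain ⟨p, hp⟩ : ∃ p, P.spans = [p] :=
    List.length_eq_one_iff.1 (by simpa using congrArg List.length P.sil_eq)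
  have hps : p ∈ P.spans := by simp [hp]
  have hsil : P.frame.sil p.first = false := by simpa [hp] using P.sil_eq
  have hword : p.inner.filterMap P.frame.lab = w := by simpa [hp, hsil] using P.word
  have hpn := P.next_of_mem hps
  have hfm : P.spans.flatMap Span.list = p.list := by simp [hp]
  obtain ⟨L, hL⟩ : ∃ L, L = p.list := ⟨_, rfl⟩
  have hnodup : L.Nodup := by
    rw [hL, ← hfm]
    exact P.nodup
  have hmn : ∀ u v, P.frame.next u = some v → (∃ i, L.get i = u) ∧ ∃ i, L.get i = v := by
    intro u v h
    simpa only [hfm, ← hL, List.mem_iff_get] using P.mem_next u v h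
  have hmc : ∀ u A, P.frame.col u = some A → ∃ i, L.get i = u := by
    intro u A h
    simpa only [hfm, ← hL, List.mem_iff_get] using P.mem_col u A h
  have hlen : L.length = p.inner.length + 2 := by simp [hL, Span.list]
  have hinj : Function.Injective L.get := List.nodup_iff_injective_get.1 hnodup
  have : Nonempty (Fin L.length) := ⟨⟨0, by omega⟩⟩
  -- Off the list the inverse takes an arbitrary value; edges, colours and successor steps never
  -- lead there.
  let f : P.V → Fin L.length := Function.invFun L.get
  have hf : ∀ i, f (L.get i) = i := Function.leftInverse_invFun hinj
  have hfirst : L.get ⟨0, by omega⟩ = p.first := by simp [hL, Span.list]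
  have hlast : L.get ⟨L.length - 1, by omega⟩ = p.last := by
    simp [hL, Span.list]
  let H : LoGraph α Unit :=
    { V := Fin L.length
      edge := fun _ i j => P.frame.next (L.get i) = some (L.get j)
      label := fun i => P.frame.lab (L.get i) }
  let σ : ℕ → Set H.V := fun n => if n = 1 then {i | P.frame.sil (L.get i) = true} else
    {i | ∃ q ∈ G.nonterminals, colVar q.1 = n ∧ P.frame.col (L.get i) = some q.1}
  have hcol : ∀ q ∈ G.nonterminals, ∀ i : H.V,
      i ∈ σ (colVar q.1) ↔ P.frame.col (L.get i) = some q.1 := by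
    intro q hq i
    have h : colVar q.1 ≠ 1 := by simp [colVar]
    simp only [σ, if_neg h, Set.mem_ofPred_eq]
    constructor
    · rintro ⟨q', -, h₁, h₂⟩
      have : q'.1 = q.1 := by simpa [colVar] using h₁
      rw [h₂, this]
    · exact fun h => ⟨q, hq, rfl, h⟩
  have hsucc : ∀ i j : H.V, H.Succ i j ↔ (i : Fin L.length).val + 1 = (j : Fin L.length).val := by
    intro i j
    exact Fin.covBy_iff.trans Nat.covBy_iff_add_one_eq
  have hedge : ∀ i : H.V, ∀ v, P.frame.next (L.get i) = some v → H.edge () i (f v) := by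
    intro i v h
    obtain ⟨j, rfl⟩ := (hmn _ _ h).2
    show P.frame.next (L.get i) = some (L.get (f (L.get j)))
    rw [hf, h]
  have happ := P.applies (fun u v => ∃ i j : H.V, L.get i = u ∧ L.get j = v ∧ H.Succ i j)
    (fun u v => ∃ i j : H.V, L.get i = u ∧ L.get j = v ∧ i < j)
    (by
      rw [hp]
      simp only [List.mem_singleton, forall_eq, ← hL]
      refine ⟨List.isChain_iff_getElem.2 fun i hi => ?_, List.pairwise_iff_get.2 fun i j h => ?_⟩
      · exact ⟨⟨i, by omega⟩, ⟨i + 1, by omega⟩, rfl, rfl, (hsucc _ _).2 rfl⟩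
      · exact ⟨i, j, rfl, rfl, h⟩)
  refine ⟨H, σ, ⟨?_, ?_, ?_, ?_⟩, ?_, ?_, ?_⟩
  · intro x y z h₁ h₂
    exact hinj (Option.some_injective _ (h₁.symm.trans h₂))
  · exact fun x y h => P.lab_next _ _ h
  · obtain ⟨h, hc, he⟩ := P.chain
    rw [hp] at he
    obtain ⟨i, rfl⟩ := hmc _ _ hc
    refine ⟨i, ⟨0, by omega⟩, ⟨L.length - 1, by omega⟩,
      ⟨(hcol _ G.start_mem i).2 hc, ?_, ?_⟩, ?_, ?_, ?_, ?_⟩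
    · show P.frame.next (L.get i) = some (L.get _)
      rw [hfirst]
      exact he.1
    · show P.frame.next (L.get _) = some (L.get _)
      rw [hfirst, hlast]
      exact hpn
    · show (0 : ℕ) < L.length - 1
      omega
    · show ¬ P.frame.sil (L.get _) = true
      rw [hfirst, hsil]
      decide
    · intro u hu
      rw [hsucc] at hu
      simp at hu
    · intro u hu
      rw [hsucc] at hu
      have := (u : Fin L.length).isLt
      simp only at hu
      omega
  · intro q hq i hi
    obtain ⟨ρ, hρ, hh, ha⟩ := happ _ _ ((hcol q hq i).1 hi)
    refine ⟨ρ, hρ, hh, ?_⟩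
    have := ha.map (S' := relations H σ) (f := f)
      { succ := by
          rintro _ _ ⟨i, j, rfl, rfl, h⟩
          rwa [hf, hf]
        lt := by
          rintro _ _ ⟨i, j, rfl, rfl, h⟩
          rwa [hf, hf]
        edge := by
          intro u v h
          obtain ⟨i, rfl⟩ := (hmn _ _ h).1
          rw [hf]
          exact hedge i v h
        lab := by
          rintro _ _ a ⟨i, j, rfl, rfl, -⟩ h
          rwa [hf]
        col := by
          intro A v h
          obtain ⟨i, rfl⟩ := hmc _ _ h
          -- A production with head `A` applies at a vertex coloured `A`, so `A` is one of the
          -- listed nonterminals.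
          obtain ⟨ρ, hρ, rfl, -⟩ := happ _ _ h
          exact (hcol _ (G.head_mem ρ hρ) _).2 (by rwa [hf])
        sil := by
          have key : ∀ i, P.frame.sil (L.get i) = true ↔ f (L.get i) ∈ σ 1 := by
            intro i
            rw [hf]
            rfl
          rintro u _ (⟨i, j, rfl, rfl, -⟩ | h)
          · exact key j
          · obtain ⟨j, rfl⟩ := (hmn _ _ h).2
            exact key j }
    rwa [hf] at this
  · intro n hn h
    simp only [σ, if_neg hn]
    ext i
    simp only [Set.mem_ofPred_eq, Set.mem_empty_iff_false, iff_false]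
    rintro ⟨q, hq, e, -⟩
    exact h q hq e
  · refine Decomp.specialTreewidth_le H P.decomp L.get hinj (fun i => ?_) fun i j hij => ?_
    · have h : P.decomp.Covers p.first := ⟨_, (P.root p hps).1⟩
      refine Decomp.covers_of_isChain h (P.joins_chain p hps) _ ?_
      show L.get i ∈ p.list
      rw [← hL]
      exact List.get_mem L i
    · rcases hij with h | ⟨_, h⟩
      · rw [hsucc] at h
        have := P.joins_chain p hps
        rw [← hL, List.isChain_iff_getElem] at this
        have := this (i : Fin L.length).val (h ▸ (j : Fin L.length).isLt)
        simp only [h] at this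
        exact this
      · exact P.joins_next _ _ h
  · show (((Finset.univ : Finset (Fin L.length)).sort (· ≤ ·)).filterMap
      fun i => P.frame.lab (L.get i)) = w
    rw [Fin.sort_univ, ← Function.comp_def P.frame.lab L.get, ← List.filterMap_map,
      ← List.ofFn_eq_map, List.ofFn_get, hL, Span.list,
      List.filterMap_cons_none (P.lab_next _ _ hpn).1, List.filterMap_append,
      List.filterMap_cons_none (P.lab_next _ _ hpn).2, hword]
    simp

end MSO

/-- There are at most `d` arguments and at most `r` terms with at most `d` variables each. As `d, r
≥ 1`, each of `2d`, `2dr` and `2` is at most `2dr`. -/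
theorem MCFG.le_of_isDMCFG {α N X : Type} {G : MCFG α N X} {d r : ℕ} (h : G.IsDMCFG d r) :
    ∀ ρ ∈ G.rules, 2 * ρ.args.length + 2 * ρ.bodyVars.length + 2 ≤ 6 * d * r := by
  have hmax : ∀ (l : List ℕ) (a : ℕ), a ≤ l.foldr max a ∧ ∀ n ∈ l, n ≤ l.foldr max a := by
    intro l a
    induction l with
    | nil => simp
    | cons m l ih =>
      simp only [List.foldr_cons, List.mem_cons, forall_eq_or_imp]
      exact ⟨ih.1.trans (le_max_right _ _), le_max_left _ _,
        fun n hn => (ih.2 n hn).trans (le_max_right _ _)⟩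
  have hd : ∀ p ∈ G.nonterminals, p.2 ≤ d := fun p hp =>
    ((hmax _ 0).2 _ (List.mem_map_of_mem hp)).trans h.1
  have hr : 1 ≤ r := (hmax _ 1).1.trans h.2
  intro ρ hρ
  have h₁ : ρ.body.length ≤ r := ((hmax _ 1).2 _ (List.mem_map_of_mem hρ)).trans h.2
  have h₂ : ρ.args.length ≤ d := hd _ (G.head_mem ρ hρ)
  have h₃ : 1 ≤ d := hd _ G.start_mem
  have h₄ : ρ.bodyVars.length ≤ d * r := by
    rw [Production.bodyVars, List.length_flatMap]
    have := List.sum_le_card_nsmul (ρ.body.map fun t => t.2.length) d (by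
      intro n hn
      obtain ⟨t, ht, rfl⟩ := List.mem_map.1 hn
      exact hd _ (G.body_mem ρ hρ t ht))
    rw [List.length_map, smul_eq_mul, mul_comm] at this
    exact this.trans (Nat.mul_le_mul_left d h₁)
  have h₅ : d ≤ d * r := Nat.le_mul_of_pos_right d hr
  rw [mul_assoc]
  omega

theorem mainTheorem3 {α N X : Type} [Finite α] [Primcodable α] [Primcodable N] [Primcodable X] :
    ∃ F : MCFG α N X → MSO α Unit, MCFG.IsEffective F ∧
      ∀ G : MCFG α N X, (F G).IsSentence ∧
        ∀ d r : ℕ, G.IsDMCFG d r →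
          MSO.boundedWordLanguage (6 * d * r) (F G) = G.language := by
  classical
  obtain ⟨letters, hl⟩ : ∃ l : List α, ∀ a, a ∈ l := by
    have := Fintype.ofFinite α
    exact ⟨Finset.univ.toList, by simp⟩
  refine ⟨MSO.grammarFormula letters, MSO.isEffective_grammarFormula letters, fun G =>
    ⟨MSO.isSentence_grammarFormula letters G, fun d r h => Set.Subset.antisymm ?_ ?_⟩⟩
  · rintro _ ⟨H, hH, rfl⟩
    obtain ⟨σ, hσ⟩ := MSO.exists_represents_of_models hl hH.1
    exact hσ.word_mem
  · intro w hw
    -- The single component of the start symbol is to be spelled, hence the pattern `[false]`.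
    obtain ⟨P⟩ := Piece.nonempty_of_derives (MCFG.le_of_isDMCFG h) hw [false] rfl
    obtain ⟨H, σ, hσ, hn, hk, rfl⟩ := P.exists_represents
    exact ⟨H, ⟨MSO.models_of_represents hl hn hσ, hk⟩, rfl⟩
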